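/- An elementary abelian $2$-group is a finite-dimensional $\mathbb F_2$-vector space $A$; $A^*=\mathrm{Hom}(A,C_2)$ is its group of characters, with trivial character $\epsilon$. **Equivariant formal group laws.** An $A$-equivariant formal group law $F=(k,R,\Delta,\theta,y(\epsilon))$ consists of a commutative ring $k$, a complete commutative topological $k$-algebra $R$, a continuous $k$-algebra map $\Delta\colon R\to R\hat\otimes_k R$, $k$-algebra maps $\theta(V)\colon R\to k$ for $V\in A^*$, and $y(\epsilon)\in R$, such that $\Delta$ is cocommutative, coassociative and counital for $\theta(\epsilon)$; $(\theta(V)\hat\otimes\theta(W))\circ\Delta=\theta(VW)$ for all $V,W\in A^*$; the finite products of the ideals $\ker\theta(V)$ form a basis of neighbourhoods of $0$ in $R$; and $y(\epsilon)$ is a regular element generating $\ker\theta(\epsilon)$. It is $2$-torsion if the composite $R\xrightarrow{\Delta}R\hat\otimes_k R\xrightarrow{\mathrm{mult}}R$ sends $y(\epsilon)$ to $0$. The Euler class of $V\in A^*$ is $e_V=\theta(V)(y(\epsilon))\in k$. A morphism is a pair of ring maps $k\to k'$, $R\to R'$ preserving all the structure. For a homomorphism $\alpha\colon B\to A$ and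 a $B$-equivariant formal group law $F$ over $k$, the push-forward $\alpha_*F$ is the $A$-equivariant formal group law over $k$ whose algebra is the completion of $R$ at the finite products of the ideals $\ker\theta(V\circ\alpha)$, $V\in A^*$, with the structure induced by that of $F$ (the augmentation at $V\in A^*$ is induced by $\theta(V\circ\alpha)$). **The global $2$-torsion Lazard ring.** $L^{2\text{-tor}}_A$ denotes the ground ring of an initial $2$-torsion $A$-equivariant formal group law $F_A$. For $\alpha\colon B\to A$ let $\alpha^*\colon L^{2\text{-tor}}_A\to L^{2\text{-tor}}_B$ be the ring map underlying the unique morphism $F_A\to\alpha_*F_B$. This defines a contravariant functor $\mathbf L^{2\text{-tor}}\colon A\mapsto L^{2\text{-tor}}_A$ from elementary abelian $2$-groups to commutative rings. Let $e_\sigma\in L^{2\text{-tor}}_{C_2}$ be the Euler class of the sign character $\sigma=\mathrm{id}_{C_2}$. **Global $2$-torsion group laws.** A global $2$-torsion group law is a contravariant functor $X$ from elementary abelian $2$-groups to commutative rings together with an element $e\in X(C_2)$, its coordinate, such that for every elementary abelian $2$-group $A$ and every non-trivial $V\in A^*$ the sequence $$0\to X(A)\xrightarrow{\;V^*(e)\cdot\;}X(A)\xrightarrow{\;\mathrm{res}\;}X(\ker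 V)\to 0$$ is exact. Morphisms are natural transformations of ring-valued functors preserving the coordinate. **Proposition.** There is an initial global $2$-torsion group law, and the global $2$-torsion Lazard ring $\mathbf L^{2\text{-tor}}$ exists (in particular, for every elementary abelian $2$-group $A$ there is an initial $2$-torsion $A$-equivariant formal group law). For every initial global $2$-torsion group law $(\widetilde{\mathbf L}^{2\text{-tor}},e)$ there is an isomorphism of functors $\mathbf L^{2\text{-tor}}\cong\widetilde{\mathbf L}^{2\text{-tor}}$ sending $e_\sigma$ to $e$, and it is the only such isomorphism. In particular $(\mathbf L^{2\text{-tor}},e_\sigma)$ is a global $2$-torsion group law, and for every elementary abelian $2$-group $A$ and every non-trivial $V\in A^*$ the Euler class $e_V$ is a regular element (a non-zero-divisor) of $L^{2\text{-tor}}_A$. -/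

import Mathlib

open CategoryTheory Opposite
open scoped TensorProduct

universe u

noncomputable section

/-! ### Completions at families of ideals -/

namespace IdealCompletion

variable {R S T k : Type u} [CommRing R] [CommRing S] [CommRing T] [CommRing k]
variable {ι κ μ : Type}

/-- The completion `lim R ⧸ I i` of `R` at a family of ideals, the limit being taken over all
inclusions between members of the family. -/
def Completion (I : ι → Ideal R) : Subring (∀ i, R ⧸ I i) where
  carrier := {x | ∀ i j (h : I i ≤ I j), Ideal.Quotient.factor h (x i) = x j}
  mul_mem' := fun hx hy i j h => by simp [hx i j h, hy i j h]
  one_mem' := fun i j h => by simp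
  add_mem' := fun hx hy i j h => by simp [hx i j h, hy i j h]
  zero_mem' := fun i j h => by simp
  neg_mem' := fun hx i j h => by simp [hx i j h]

/-- The completion map. -/
def of (I : ι → Ideal R) : R →+* Completion I :=
  RingHom.codRestrict (RingHom.pi fun i => Ideal.Quotient.mk (I i)) (Completion I)
    (fun x _ _ h => Ideal.Quotient.factor_mk h x)

/-- The projection of the completion to a quotient. Its kernels form the basis of neighbourhoods
of zero in the completion. -/
def proj (I : ι → Ideal R) (i : ι) : Completion I →+* R ⧸ I i :=
  (Pi.evalRingHom (fun i => R ⧸ I i) i).comp (Completion I).subtype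

@[simp]
lemma proj_of (I : ι → Ideal R) (i : ι) (x : R) :
    proj I i (of I x) = Ideal.Quotient.mk (I i) x := rfl

lemma factor_proj (I : ι → Ideal R) {i j : ι} (h : I i ≤ I j) (x : Completion I) :
    Ideal.Quotient.factor h (proj I i x) = proj I j x := x.2 i j h

/-- Continuity of a ring homomorphism into a completion, where the source carries the linear
topology with basis of neighbourhoods of zero the ideals `I i`. -/
def IsCont (I : ι → Ideal R) {J : κ → Ideal S} (f : R →+* Completion J) : Prop :=
  ∀ j, ∃ i, I i ≤ RingHom.ker ((proj J j).comp f)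

/-- The value at `j` of the continuous extension of `f` to the completion. -/
def extendAt {I : ι → Ideal R} {J : κ → Ideal S} {f : R →+* Completion J}
    (hf : IsCont I f) (j : κ) : Completion I →+* S ⧸ J j :=
  (Ideal.Quotient.lift (I (hf j).choose) ((proj J j).comp f)
    (fun _ ha => (hf j).choose_spec ha)).comp (proj I (hf j).choose)

lemma extendAt_apply {I : ι → Ideal R} (hI : Directed (· ≥ ·) I) {J : κ → Ideal S}
    {f : R →+* Completion J} (hf : IsCont I f) {i : ι} {j : κ}
    (h : I i ≤ RingHom.ker ((proj J j).comp f)) (x : Completion I) :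
    extendAt hf j x =
      Ideal.Quotient.lift (I i) ((proj J j).comp f) (fun _ ha => h ha) (proj I i x) := by
  obtain ⟨l, hl₁, hl₂⟩ := hI (hf j).choose i
  obtain ⟨r, hr⟩ := Ideal.Quotient.mk_surjective (proj I l x)
  have h₁ := factor_proj I hl₁ x
  have h₂ := factor_proj I hl₂ x
  rw [← hr] at h₁ h₂
  simp only [extendAt, RingHom.comp_apply, ← h₁, ← h₂, Ideal.Quotient.factor_mk]
  rfl

/-- The continuous extension to the completion of a continuous ring homomorphism. -/
def extend {I : ι → Ideal R} (hI : Directed (· ≥ ·) I) {J : κ → Ideal S}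
    {f : R →+* Completion J} (hf : IsCont I f) : Completion I →+* Completion J :=
  RingHom.codRestrict (RingHom.pi fun j => extendAt hf j) (Completion J) (by
    intro x j j' h
    have hle : I (hf j).choose ≤ RingHom.ker ((proj J j').comp f) := by
      intro a ha
      have := (hf j).choose_spec ha
      rw [RingHom.mem_ker, RingHom.comp_apply] at this ⊢
      rw [← factor_proj J h, this, map_zero]
    change Ideal.Quotient.factor h (extendAt hf j x) = extendAt hf j' x
    rw [extendAt_apply hI hf hle x]
    obtain ⟨r, hr⟩ := Ideal.Quotient.mk_surjective (proj I (hf j).choose x)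
    simp only [extendAt, RingHom.comp_apply, ← hr]
    exact factor_proj J h (f r))

lemma proj_extend {I : ι → Ideal R} (hI : Directed (· ≥ ·) I) {J : κ → Ideal S}
    {f : R →+* Completion J} (hf : IsCont I f) {i : ι} {j : κ}
    (h : I i ≤ RingHom.ker ((proj J j).comp f)) (x : Completion I) :
    proj J j (extend hI hf x) =
      Ideal.Quotient.lift (I i) ((proj J j).comp f) (fun _ ha => h ha) (proj I i x) :=
  extendAt_apply hI hf h x

lemma extend_of {I : ι → Ideal R} (hI : Directed (· ≥ ·) I) {J : κ → Ideal S}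
    {f : R →+* Completion J} (hf : IsCont I f) (x : R) :
    extend hI hf (of I x) = f x :=
  Subtype.ext (funext fun j => (extendAt_apply hI hf (hf j).choose_spec (of I x)).trans rfl)

lemma IsCont.extend_comp {I : ι → Ideal R} (hI : Directed (· ≥ ·) I) {J : κ → Ideal S}
    {f : R →+* Completion J} (hf : IsCont I f) {L : μ → Ideal T} {g : T →+* Completion I}
    (hg : IsCont L g) : IsCont L ((extend hI hf).comp g) := by
  intro j
  obtain ⟨i, hi⟩ := hf j
  obtain ⟨l, hl⟩ := hg i
  refine ⟨l, fun a ha => ?_⟩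
  have h0 : proj I i (g a) = 0 := hl ha
  rw [RingHom.mem_ker, RingHom.comp_apply, RingHom.comp_apply, proj_extend hI hf hi, h0, map_zero]

/-! ### Completed tensor products -/

/-- The ring homomorphism out of a tensor product of `k`-algebras determined by two ring
homomorphisms that agree on `k`. -/
def tensorLift [Algebra k R] [Algebra k S] (f : R →+* T) (g : S →+* T)
    (h : ∀ c : k, f (algebraMap k R c) = g (algebraMap k S c)) : R ⊗[k] S →+* T :=
  letI : Algebra k T := (f.comp (algebraMap k R)).toAlgebra
  (Algebra.TensorProduct.lift (A := R) (B := S) (C := T) (S := k) (R := k)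
    { f with commutes' := fun _ => rfl }
    { g with commutes' := fun c => (h c).symm }
    (fun _ _ => mul_comm _ _)).toRingHom

lemma tensorLift_tmul [Algebra k R] [Algebra k S] (f : R →+* T) (g : S →+* T)
    (h : ∀ c : k, f (algebraMap k R c) = g (algebraMap k S c)) (a : R) (b : S) :
    tensorLift f g h (a ⊗ₜ b) = f a * g b := rfl

/-- `a ↦ a ⊗ 1`. -/
def inl (k R S : Type u) [CommRing k] [CommRing R] [CommRing S] [Algebra k R] [Algebra k S] :
    R →+* R ⊗[k] S :=
  Algebra.TensorProduct.includeLeftRingHom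

/-- `b ↦ 1 ⊗ b`. -/
def inr (k R S : Type u) [CommRing k] [CommRing R] [CommRing S] [Algebra k R] [Algebra k S] :
    S →+* R ⊗[k] S :=
  (Algebra.TensorProduct.includeRight : S →ₐ[k] R ⊗[k] S).toRingHom

lemma inl_algebraMap (k R S : Type u) [CommRing k] [CommRing R] [CommRing S] [Algebra k R]
    [Algebra k S] (c : k) :
    inl k R S (algebraMap k R c) = inr k R S (algebraMap k S c) :=
  Algebra.TensorProduct.tmul_one_eq_one_tmul c

/-- The ideals `I i ⊗ S + R ⊗ J j` of `R ⊗ S`. -/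
def tensorIdeals (k : Type u) [CommRing k] [Algebra k R] [Algebra k S]
    (I : ι → Ideal R) (J : κ → Ideal S) (p : ι × κ) : Ideal (R ⊗[k] S) :=
  (I p.1).map (inl k R S) ⊔ (J p.2).map (inr k R S)

lemma directed_tensorIdeals [Algebra k R] [Algebra k S] {I : ι → Ideal R} {J : κ → Ideal S}
    (hI : Directed (· ≥ ·) I) (hJ : Directed (· ≥ ·) J) :
    Directed (· ≥ ·) (tensorIdeals k I J) := by
  rintro ⟨i, j⟩ ⟨i', j'⟩
  obtain ⟨a, ha, ha'⟩ := hI i i'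
  obtain ⟨b, hb, hb'⟩ := hJ j j'
  exact ⟨(a, b), sup_le_sup (Ideal.map_mono ha) (Ideal.map_mono hb),
    sup_le_sup (Ideal.map_mono ha') (Ideal.map_mono hb')⟩

/-- The completed tensor product `R ⊗̂ S` over `k` of two linearly topologized `k`-algebras:
the completion of `R ⊗ S` at the ideals `I i ⊗ S + R ⊗ J j`. -/
abbrev CompletedTensor (k : Type u) [CommRing k] [Algebra k R] [Algebra k S]
    (I : ι → Ideal R) (J : κ → Ideal S) := Completion (tensorIdeals k I J)

lemma isCont_tensorLift [Algebra k R] [Algebra k S] {I : ι → Ideal R} {J : κ → Ideal S}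
    {K : μ → Ideal T} {f : R →+* Completion K} {g : S →+* Completion K}
    (h : ∀ c : k, f (algebraMap k R c) = g (algebraMap k S c))
    (hf : IsCont I f) (hg : IsCont J g) :
    IsCont (tensorIdeals k I J) (tensorLift f g h) := by
  intro l
  obtain ⟨i, hi⟩ := hf l
  obtain ⟨j, hj⟩ := hg l
  refine ⟨(i, j), sup_le (Ideal.map_le_iff_le_comap.2 fun a ha => ?_)
    (Ideal.map_le_iff_le_comap.2 fun b hb => ?_)⟩
  · have h0 : proj K l (f a) = 0 := hi ha
    have h1 : tensorLift f g h (inl k R S a) = f a * g 1 := rfl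
    rw [Ideal.mem_comap, RingHom.mem_ker, RingHom.comp_apply, h1, map_mul, h0, zero_mul]
  · have h0 : proj K l (g b) = 0 := hj hb
    have h1 : tensorLift f g h (inr k R S b) = f 1 * g b := rfl
    rw [Ideal.mem_comap, RingHom.mem_ker, RingHom.comp_apply, h1, map_mul, h0, mul_zero]

/-- The continuous homomorphism `R ⊗̂ S → T^` determined by two continuous homomorphisms that
agree on `k`; it sends `a ⊗ b` to `f a * g b`. -/
def completedLift [Algebra k R] [Algebra k S] {I : ι → Ideal R} {J : κ → Ideal S}
    (hI : Directed (· ≥ ·) I) (hJ : Directed (· ≥ ·) J)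
    {K : μ → Ideal T} {f : R →+* Completion K} {g : S →+* Completion K}
    (hf : IsCont I f) (hg : IsCont J g)
    (h : ∀ c : k, f (algebraMap k R c) = g (algebraMap k S c)) :
    CompletedTensor k I J →+* Completion K :=
  extend (directed_tensorIdeals hI hJ) (isCont_tensorLift h hf hg)

lemma isCont_of (I : ι → Ideal R) : IsCont I (of I) := fun i => ⟨i, fun a ha => by
  rw [RingHom.mem_ker, RingHom.comp_apply, proj_of]
  exact Ideal.Quotient.eq_zero_iff_mem.2 ha⟩

lemma isCont_inl [Algebra k R] [Algebra k S] (I : ι → Ideal R) (J : κ → Ideal S) :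
    IsCont I ((of (tensorIdeals k I J)).comp (inl k R S)) := fun p => ⟨p.1, fun a ha => by
  rw [RingHom.mem_ker, RingHom.comp_apply, RingHom.comp_apply, proj_of]
  exact Ideal.Quotient.eq_zero_iff_mem.2 (Ideal.mem_sup_left (Ideal.mem_map_of_mem _ ha))⟩

lemma isCont_inr [Algebra k R] [Algebra k S] (I : ι → Ideal R) (J : κ → Ideal S) :
    IsCont J ((of (tensorIdeals k I J)).comp (inr k R S)) := fun p => ⟨p.2, fun a ha => by
  rw [RingHom.mem_ker, RingHom.comp_apply, RingHom.comp_apply, proj_of]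
  exact Ideal.Quotient.eq_zero_iff_mem.2 (Ideal.mem_sup_right (Ideal.mem_map_of_mem _ ha))⟩

lemma IsCont.of_comp {I : ι → Ideal R} {J : κ → Ideal S} {f : R →+* S}
    (hf : ∀ j, ∃ i, I i ≤ (J j).comap f) {K : μ → Ideal T} {g : S →+* Completion K}
    (hg : IsCont J g) : IsCont I (g.comp f) := fun l => by
  obtain ⟨j, hj⟩ := hg l
  obtain ⟨i, hi⟩ := hf j
  exact ⟨i, fun a ha => hj (hi ha)⟩

end IdealCompletion

/-! ### Equivariant formal group laws for elementary abelian 2-groups -/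

open IdealCompletion

/-- The group of characters of an elementary abelian 2-group, written additively, so that `0` is
the trivial character and `V + W` is the product of characters. -/
abbrev Character (A : Type) [AddCommGroup A] [Module (ZMod 2) A] := A →ₗ[ZMod 2] ZMod 2

/-- A commutative `k`-algebra `R` with augmentations `θ V : R → k` indexed by the characters. -/
structure AugmentedAlgebra (A : Type) [AddCommGroup A] [Module (ZMod 2) A]
    (k : Type u) [CommRing k] where
  R : Type u
  [commRing : CommRing R]
  [algebra : Algebra k R]
  θ : Character A → (R →ₐ[k] k)

attribute [instance] AugmentedAlgebra.commRing AugmentedAlgebra.algebra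

namespace AugmentedAlgebra

variable {A : Type} [AddCommGroup A] [Module (ZMod 2) A] {k : Type u} [CommRing k]
variable (F : AugmentedAlgebra A k)

/-- The finite products of the kernels of the augmentations. They form the basis of
neighbourhoods of zero of the topology of `R`. -/
def I (s : Multiset (Character A)) : Ideal F.R :=
  (s.map fun V => RingHom.ker (F.θ V)).prod

lemma I_singleton (V : Character A) : F.I {V} = RingHom.ker (F.θ V) := by simp [I]

lemma I_add (s t : Multiset (Character A)) : F.I (s + t) = F.I s * F.I t := by simp [I]

lemma directed_I : Directed (· ≥ ·) F.I := fun s t =>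
  ⟨s + t, (F.I_add s t).le.trans (Ideal.mul_le_inf.trans inf_le_left),
    (F.I_add s t).le.trans (Ideal.mul_le_inf.trans inf_le_right)⟩

/-- The completed tensor product `R ⊗̂ R`. -/
abbrev Tensor₂ := CompletedTensor k F.I F.I

/-- The completed tensor product `R ⊗̂ R ⊗̂ R`, the completion of `R ⊗ (R ⊗ R)` at the ideals
`I s ⊗ R ⊗ R + R ⊗ I t ⊗ R + R ⊗ R ⊗ I u`. -/
abbrev Tensor₃ := CompletedTensor k F.I (tensorIdeals k F.I F.I)

/-- `a ↦ a ⊗ 1`. -/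
def inc₁₂ : F.R →+* F.Tensor₂ := (of _).comp (inl k F.R F.R)

/-- `a ↦ 1 ⊗ a`. -/
def inc₂₂ : F.R →+* F.Tensor₂ := (of _).comp (inr k F.R F.R)

/-- `a ↦ a ⊗ 1 ⊗ 1`. -/
def inc₁₃ : F.R →+* F.Tensor₃ := (of _).comp (inl k F.R (F.R ⊗[k] F.R))

/-- `a ↦ 1 ⊗ a ⊗ 1`. -/
def inc₂₃ : F.R →+* F.Tensor₃ :=
  ((of _).comp (inr k F.R (F.R ⊗[k] F.R))).comp (inl k F.R F.R)

/-- `a ↦ 1 ⊗ 1 ⊗ a`. -/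
def inc₃₃ : F.R →+* F.Tensor₃ :=
  ((of _).comp (inr k F.R (F.R ⊗[k] F.R))).comp (inr k F.R F.R)

lemma isCont_inc₁₂ : IsCont F.I F.inc₁₂ := isCont_inl _ _

lemma isCont_inc₂₂ : IsCont F.I F.inc₂₂ := isCont_inr _ _

lemma isCont_inc₁₃ : IsCont F.I F.inc₁₃ := isCont_inl _ _

lemma isCont_inc₂₃ : IsCont F.I F.inc₂₃ :=
  IsCont.of_comp (J := tensorIdeals k F.I F.I)
    (fun p => ⟨p.1, Ideal.map_le_iff_le_comap.1 le_sup_left⟩) (isCont_inr _ _)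

lemma isCont_inc₃₃ : IsCont F.I F.inc₃₃ :=
  IsCont.of_comp (J := tensorIdeals k F.I F.I)
    (fun p => ⟨p.2, Ideal.map_le_iff_le_comap.1 le_sup_right⟩) (isCont_inr _ _)

lemma inc₁₂_algebraMap (c : k) :
    F.inc₁₂ (algebraMap k F.R c) = F.inc₂₂ (algebraMap k F.R c) :=
  congrArg (of _) (inl_algebraMap k F.R F.R c)

lemma inc₂₃_algebraMap (c : k) :
    F.inc₂₃ (algebraMap k F.R c) = F.inc₃₃ (algebraMap k F.R c) :=
  congrArg (fun z => of _ (inr k F.R (F.R ⊗[k] F.R) z)) (inl_algebraMap k F.R F.R c)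

lemma inc₁₃_algebraMap (c : k) :
    F.inc₁₃ (algebraMap k F.R c) = F.inc₂₃ (algebraMap k F.R c) :=
  congrArg (of _) (inl_algebraMap k F.R (F.R ⊗[k] F.R) c)

/-- `R ⊗̂ R → R ⊗̂ R ⊗̂ R`, `a ⊗ b ↦ a ⊗ b ⊗ 1`. -/
def j₁₂ : F.Tensor₂ →+* F.Tensor₃ :=
  completedLift F.directed_I F.directed_I F.isCont_inc₁₃ F.isCont_inc₂₃ F.inc₁₃_algebraMap

/-- `R ⊗̂ R → R ⊗̂ R ⊗̂ R`, `a ⊗ b ↦ 1 ⊗ a ⊗ b`. -/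
def j₂₃ : F.Tensor₂ →+* F.Tensor₃ :=
  completedLift F.directed_I F.directed_I F.isCont_inc₂₃ F.isCont_inc₃₃ F.inc₂₃_algebraMap

lemma j₁₂_inc₁₂ (x : F.R) : F.j₁₂ (F.inc₁₂ x) = F.inc₁₃ x := by
  refine (extend_of (directed_tensorIdeals F.directed_I F.directed_I) _ _).trans ?_
  exact (tensorLift_tmul _ _ _ x 1).trans (by rw [map_one, mul_one])

lemma j₂₃_inc₁₂ (x : F.R) : F.j₂₃ (F.inc₁₂ x) = F.inc₂₃ x := by
  refine (extend_of (directed_tensorIdeals F.directed_I F.directed_I) _ _).trans ?_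
  exact (tensorLift_tmul _ _ _ x 1).trans (by rw [map_one, mul_one])

/-- The multiplication `R ⊗̂ R → R`, where `R` is written as its own completion. -/
def mulHat : F.Tensor₂ →+* Completion F.I :=
  completedLift F.directed_I F.directed_I (isCont_of _) (isCont_of _) (fun _ => rfl)

/-- The interchange of the two factors of `R ⊗̂ R`. -/
def swapHat : F.Tensor₂ →+* F.Tensor₂ :=
  completedLift F.directed_I F.directed_I F.isCont_inc₂₂ F.isCont_inc₁₂
    (fun c => (F.inc₁₂_algebraMap c).symm)

lemma isCont_θ {ι : Type} {T : Type u} [CommRing T] {J : ι → Ideal T} (V : Character A)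
    (g : k →+* Completion J) :
    IsCont F.I (g.comp (F.θ V : F.R →+* k)) := fun _ => ⟨{V}, fun a ha => by
  rw [I_singleton, RingHom.mem_ker] at ha
  rw [RingHom.mem_ker, RingHom.comp_apply, RingHom.comp_apply, RingHom.coe_coe, ha, map_zero,
    map_zero]⟩

/-- The map `θ V ⊗̂ id : R ⊗̂ R → R`, where `R` is written as its own completion. -/
def θHatId (V : Character A) : F.Tensor₂ →+* Completion F.I :=
  completedLift F.directed_I F.directed_I
    (F.isCont_θ V ((of F.I).comp (algebraMap k F.R))) (isCont_of F.I) (fun c => by simp)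

/-- The map `θ V ⊗̂ θ W : R ⊗̂ R → k`, where the discrete ring `k` is written as its completion at
the zero ideal. -/
def θHatθ (V W : Character A) : F.Tensor₂ →+* Completion (fun _ : Unit => (⊥ : Ideal k)) :=
  completedLift F.directed_I F.directed_I (F.isCont_θ V (of _)) (F.isCont_θ W (of _))
    (fun c => by simp)

end AugmentedAlgebra

/-- An augmented algebra together with a continuous comultiplication of `k`-algebras
`R → R ⊗̂ R`. -/
structure AugmentedBialgebra (A : Type) [AddCommGroup A] [Module (ZMod 2) A]
    (k : Type u) [CommRing k] extends AugmentedAlgebra A k where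
  Δ : R →+* toAugmentedAlgebra.Tensor₂
  Δ_algebraMap : ∀ c : k, Δ (algebraMap k R c) = toAugmentedAlgebra.inc₁₂ (algebraMap k R c)
  Δ_cont : IsCont toAugmentedAlgebra.I Δ

namespace AugmentedBialgebra

variable {A : Type} [AddCommGroup A] [Module (ZMod 2) A] {k : Type u} [CommRing k]
variable (F : AugmentedBialgebra A k)

/-- `Δ ⊗̂ id : R ⊗̂ R → R ⊗̂ R ⊗̂ R`. -/
def ΔHatId : F.Tensor₂ →+* F.Tensor₃ :=
  completedLift F.directed_I F.directed_I
    (f := F.j₁₂.comp F.Δ) (g := F.inc₃₃)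
    (IsCont.extend_comp (directed_tensorIdeals F.directed_I F.directed_I) _ F.Δ_cont) F.isCont_inc₃₃
    (fun c => by
      rw [RingHom.comp_apply, F.Δ_algebraMap, F.j₁₂_inc₁₂, F.inc₁₃_algebraMap,
        F.inc₂₃_algebraMap])

/-- `id ⊗̂ Δ : R ⊗̂ R → R ⊗̂ R ⊗̂ R`. -/
def idHatΔ : F.Tensor₂ →+* F.Tensor₃ :=
  completedLift F.directed_I F.directed_I
    (f := F.inc₁₃) (g := F.j₂₃.comp F.Δ)
    F.isCont_inc₁₃ (IsCont.extend_comp (directed_tensorIdeals F.directed_I F.directed_I) _ F.Δ_cont)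
    (fun c => by
      rw [RingHom.comp_apply, F.Δ_algebraMap, F.j₂₃_inc₁₂, F.inc₁₃_algebraMap])

end AugmentedBialgebra

/-- An `A`-equivariant formal group law `(k, R, Δ, θ, y(ε))` with ground ring `k`, for an elementary
abelian 2-group `A`. The topology of `R` is the one generated by the finite products of the kernels
of the augmentations, so it is determined by `θ` and not recorded separately. -/
structure EquivariantFGL (A : Type) [AddCommGroup A] [Module (ZMod 2) A]
    (k : Type u) [CommRing k] extends AugmentedBialgebra A k where
  /-- The orientation `y(ε)`. -/
  y : R
  /-- `R` is complete (and separated). -/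
  complete : Function.Bijective (of toAugmentedAlgebra.I)
  cocomm : ∀ x, toAugmentedAlgebra.swapHat (Δ x) = Δ x
  coassoc : ∀ x, toAugmentedBialgebra.ΔHatId (Δ x) = toAugmentedBialgebra.idHatΔ (Δ x)
  /-- The left counit law; the right one follows by cocommutativity. -/
  counit : ∀ x, toAugmentedAlgebra.θHatId 0 (Δ x) = of _ x
  /-- The compatibility of `θ` with the comultiplication. -/
  θ_Δ : ∀ V W x, toAugmentedAlgebra.θHatθ V W (Δ x) = of _ (θ (V + W) x)
  y_regular : y ∈ nonZeroDivisors R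
  span_y : Ideal.span {y} = RingHom.ker (θ 0)

namespace EquivariantFGL

variable {A B C : Type} [AddCommGroup A] [Module (ZMod 2) A] [AddCommGroup B] [Module (ZMod 2) B]
variable {k k' : Type u} [CommRing k] [CommRing k']

/-- The Euler class `e_V = θ(V)(y(ε))`. -/
def euler (F : EquivariantFGL A k) (V : Character A) : k := F.θ V F.y

/-- The formal group law is 2-torsion if the composite `R → R ⊗̂ R → R` of comultiplication and
multiplication sends `y(ε)` to zero. -/
def IsTwoTorsion (F : EquivariantFGL A k) : Prop := F.mulHat (F.Δ F.y) = 0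

/-- The part of the definition of a morphism that does not involve the comultiplication: for
homomorphisms `α : B → A` and `f : k → k'`, a ring homomorphism `R → R'` over `f` that is compatible
with the orientations and with the augmentations, where the augmentations of the source are indexed
by the characters of `A` through `α`. -/
structure PreHom (α : B →ₗ[ZMod 2] A) (f : k →+* k')
    (F : EquivariantFGL B k) (G : EquivariantFGL A k') where
  φ : F.R →+* G.R
  map_algebraMap : ∀ c, φ (algebraMap k F.R c) = algebraMap k' G.R (f c)
  map_θ : ∀ (V : Character A) (x : F.R), G.θ V (φ x) = f (F.θ (V ∘ₗ α) x)
  map_y : φ F.y = G.y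

namespace PreHom

variable {α : B →ₗ[ZMod 2] A} {f : k →+* k'} {F : EquivariantFGL B k} {G : EquivariantFGL A k'}

lemma I_le_comap (g : PreHom α f F G) (s : Multiset (Character A)) :
    F.I (s.map fun V => V ∘ₗ α) ≤ (G.I s).comap g.φ := by
  induction s using Multiset.induction_on with
  | empty => simp [AugmentedAlgebra.I]
  | cons V s ih =>
    have h1 : F.I ((V ::ₘ s).map fun V => V ∘ₗ α) =
        RingHom.ker (F.θ (V ∘ₗ α)) * F.I (s.map fun V => V ∘ₗ α) := by
      simp [AugmentedAlgebra.I]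
    have h2 : G.I (V ::ₘ s) = RingHom.ker (G.θ V) * G.I s := by
      simp [AugmentedAlgebra.I]
    rw [h1, h2, Ideal.mul_le]
    intro a ha b hb
    rw [Ideal.mem_comap, map_mul]
    refine Ideal.mul_mem_mul ?_ (ih hb)
    rw [RingHom.mem_ker] at ha ⊢
    rw [g.map_θ, ha, map_zero]

/-- The map `φ ⊗̂ φ : R ⊗̂ R → R' ⊗̂ R'`. -/
def hat (g : PreHom α f F G) : F.Tensor₂ →+* G.Tensor₂ :=
  completedLift F.directed_I F.directed_I
    (f := G.inc₁₂.comp g.φ) (g := G.inc₂₂.comp g.φ)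
    (IsCont.of_comp (fun s => ⟨_, g.I_le_comap s⟩) G.isCont_inc₁₂)
    (IsCont.of_comp (fun s => ⟨_, g.I_le_comap s⟩) G.isCont_inc₂₂)
    (fun c => by
      rw [RingHom.comp_apply, RingHom.comp_apply, g.map_algebraMap, G.inc₁₂_algebraMap])

end PreHom

/-- The structure preserving maps over `α : B → A` and `f : k → k'` from a `B`-equivariant to an
`A`-equivariant formal group law. For `α = id` these are the morphisms of `A`-equivariant formal
group laws with first component `f`. -/
structure HomOver (α : B →ₗ[ZMod 2] A) (f : k →+* k')
    (F : EquivariantFGL B k) (G : EquivariantFGL A k') extends PreHom α f F G where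
  map_Δ : ∀ x, G.Δ (φ x) = toPreHom.hat (F.Δ x)

/-- A morphism `F → G` of `A`-equivariant formal group laws is a pair of a map of ground rings and
a map of algebras over it, preserving all structure. -/
def Hom (F : EquivariantFGL A k) (G : EquivariantFGL A k') :=
  Σ f : k →+* k', HomOver (LinearMap.id : A →ₗ[ZMod 2] A) f F G

/-- `G` is the push-forward `α_* F` of the `B`-equivariant formal group law `F` along `α : B → A`:
it has the same ground ring and its algebra is the completion of the algebra `R` of `F` at the
finite products of the ideals `I_V` with `V` in the image of `α^*`, in such a way that all the
structure of `G` is induced from that of `F` along the completion map `c : R → R_α`. -/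
def IsPushforward (α : B →ₗ[ZMod 2] A) (F : EquivariantFGL B k) (G : EquivariantFGL A k) : Prop :=
  ∃ c : HomOver α (RingHom.id k) F G, ∀ s : Multiset (Character A),
    Function.Bijective
      (Ideal.quotientMap (G.I s) c.φ (c.I_le_comap s) :
        F.R ⧸ F.I (s.map fun V => V ∘ₗ α) →+* G.R ⧸ G.I s)

/-- `F` is an initial object of the category of 2-torsion `A`-equivariant formal group laws. -/
def IsUniversalTwoTorsion (F : EquivariantFGL A k) : Prop :=
  F.IsTwoTorsion ∧ ∀ (k' : Type u) [CommRing k'] (G : EquivariantFGL A k'),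
    G.IsTwoTorsion → Nonempty (Unique (Hom F G))

end EquivariantFGL

/-! ### Global 2-torsion group laws -/

/-- The category of elementary abelian 2-groups. -/
abbrev El₂ := FGModuleCat.{0} (ZMod 2)

/-- The group with two elements. -/
abbrev C₂ : El₂ := FGModuleCat.of (ZMod 2) (ZMod 2)

/-- A functor from elementary abelian 2-groups to commutative rings. -/
abbrev El₂Algebra := El₂ᵒᵖ ⥤ CommRingCat.{u}

namespace El₂Algebra

/-- The restriction homomorphism `α^* : X(A) → X(B)` for `α : B → A`. -/
def res (X : El₂Algebra.{u}) {A B : El₂} (α : B ⟶ A) : X.obj (op A) →+* X.obj (op B) :=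
  (X.map α.op).hom

/-- The pullback `e_V = V^* e` of a class `e ∈ X(C₂)` along a character `V`. -/
def pullback (X : El₂Algebra.{u}) (e : X.obj (op C₂)) {A : El₂} (V : Character A) :
    X.obj (op A) :=
  X.res (A := C₂) (B := A) (FGModuleCat.ofHom V) e

/-- The inclusion of the kernel of a character. -/
def kerInclusion {A : El₂} (V : Character A) :
    FGModuleCat.of (ZMod 2) (LinearMap.ker V) ⟶ A :=
  FGModuleCat.ofHom (LinearMap.ker V).subtype

/-- A class `e ∈ X(C₂)` is a coordinate if for every non-trivial character `V` of every elementary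
abelian 2-group `A` the sequence `0 → X(A) → X(A) → X(ker V) → 0`, given by multiplication by `e_V`
and by restriction, is exact. -/
def IsCoordinate (X : El₂Algebra.{u}) (e : X.obj (op C₂)) : Prop :=
  ∀ (A : El₂) (V : Character A), V ≠ 0 →
    Function.Injective (fun x => X.pullback e V * x) ∧
    Function.Exact (fun x => X.pullback e V * x) (X.res (kerInclusion V)) ∧
    Function.Surjective (X.res (kerInclusion V))

end El₂Algebra

/-- A global 2-torsion group law. -/
structure GlobalGroupLaw where
  X : El₂Algebra.{u}
  e : X.obj (op C₂)
  isCoordinate : X.IsCoordinate e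

/-- `X` is an initial global 2-torsion group law: there is exactly one map of algebras preserving
the coordinate into every other one. -/
def GlobalGroupLaw.IsInitial (X : GlobalGroupLaw.{u}) : Prop :=
  ∀ Y : GlobalGroupLaw.{u}, ∃! φ : X.X ⟶ Y.X, (φ.app (op C₂)).hom X.e = Y.e

/-- A global 2-torsion Lazard ring: a functor whose value at `A` is the ground ring `L_A` of an
initial 2-torsion `A`-equivariant formal group law, and whose value at `α : B → A` is the map
`L_A → L_B` underlying the unique morphism from the initial `A`-equivariant formal group law to the
push-forward along `α` of the initial `B`-equivariant one. These data are unique up to unique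
isomorphism. -/
structure GlobalLazardRing where
  L : El₂Algebra.{u}
  F : ∀ A : El₂, EquivariantFGL A (L.obj (op A))
  universal : ∀ A, (F A).IsUniversalTwoTorsion
  res_classifies : ∀ {A B : El₂} (α : B ⟶ A), ∃ G : EquivariantFGL A (L.obj (op B)),
    EquivariantFGL.IsPushforward α.hom.hom (F B) G ∧
      Nonempty (EquivariantFGL.HomOver (LinearMap.id : A →ₗ[ZMod 2] A) (L.res α) (F A) G)

/-- The universal Euler class `e_σ ∈ L_{C₂}` of the sign character of `C₂`. -/
def GlobalLazardRing.eσ (𝓛 : GlobalLazardRing.{u}) : 𝓛.L.obj (op C₂) :=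
  (𝓛.F C₂).euler (LinearMap.id : ZMod 2 →ₗ[ZMod 2] ZMod 2)

end

-- Formal group laws are studied through their points, the continuous `k`-algebra maps from `R` to
-- discrete rings `T`. The comultiplication adds points. In the 2-torsion case they form an
-- elementary abelian 2-group, and the augmentations are a homomorphism from `A^*` to it (`θPt`).
-- Points separate elements, both of a complete `R` and of the completed tensor powers, so
-- identities are checked on points.
--
-- From formal group laws to global group laws: let `F` be 2-torsion. The functions on the scheme of
-- homomorphisms from `B^*` to the points of `F` form, as `B` varies, a global group law
-- (`functionsLaw`). The key is to deform a homomorphism `x` so that its value at `V` becomes a free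
-- parameter `t`. The coordinate at `V` is then `y(ε)`, and division by `y(ε)` is a `k`-linear
-- operator that survives base change. Specialising `t` to `x(V)` recovers `x`, while `t = 0` gives
-- a homomorphism vanishing at `V`. This yields regularity and divisibility.
--
-- An initial global group law exists because division by an Euler class is unique. Its elements are
-- the families, over all laws, given by a formal expression in the ring operations, restrictions,
-- Euler classes and divisions. Laws of functions live one universe higher, so the families range
-- over laws in that universe. Evaluating at the law of functions of `F`, at the homomorphism `θPt`,
-- gives a ring map from the value of the initial law at `A` to the ground ring of `F` (`classify`),
-- natural in `F` and `A`.
--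
-- From global group laws to formal group laws: for `α : B → A`, complete `X(B × C₂)` at products of
-- the kernels of restriction to graphs of characters `V ∘ α`. These kernels are generated by
-- regular Euler classes. After completion `X(B × C₂ × C₂)` becomes a completed tensor square of
-- `X(B × C₂)` over `X(B)` (`exists_join`, `join_ext`), and the addition of `C₂` induces the
-- comultiplication. The result `fgl α` is the push-forward of `fgl id` along `α`.
--
-- For the initial law, the classifying maps of the `fgl id` assemble to an endomorphism of the
-- initial law, hence are identities (`classify_lazardFGL`). A morphism to any 2-torsion `G` exists
-- by evaluating functions at the universal point of `G` (`fromLazardFGL`). It is unique because `R`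
-- is topologically generated over the ground ring by the translates of `y(ε)` (`homOver_ext`). So
-- `fgl id` over the initial law is universal at every `A`, and by `classify_bijective` every global
-- Lazard ring is isomorphic to the initial law. Regularity of Euler classes is then part of the
-- definition of a coordinate.

universe v w

noncomputable section

/-! ### Continuous maps from completions to discrete rings -/

namespace IdealCompletion

variable {R S T T' k : Type u} [CommRing R] [CommRing S] [CommRing T] [CommRing T'] [CommRing k]
variable {ι κ μ : Type}

/-- A ring homomorphism from a completion to a discrete ring is continuous if it vanishes on the
kernel of one of the projections. -/
def IsContOut {I : ι → Ideal R} (Φ : Completion I →+* T) : Prop :=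
  ∃ i, RingHom.ker (proj I i) ≤ RingHom.ker Φ

lemma isContOut_proj (I : ι → Ideal R) (i : ι) : IsContOut (proj I i) := ⟨i, le_rfl⟩

lemma IsContOut.comp_left {I : ι → Ideal R} {Φ : Completion I →+* T} (h : IsContOut Φ)
    (φ : T →+* T') : IsContOut (φ.comp Φ) := by
  obtain ⟨i, hi⟩ := h
  refine ⟨i, fun x hx => ?_⟩
  have : Φ x = 0 := hi hx
  simp [RingHom.mem_ker, this]

lemma IsContOut.comp_extend {I : ι → Ideal R} (hI : Directed (· ≥ ·) I) {J : κ → Ideal S}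
    {f : R →+* Completion J} (hf : IsCont I f) {Φ : Completion J →+* T} (h : IsContOut Φ) :
    IsContOut (Φ.comp (extend hI hf)) := by
  obtain ⟨j, hj⟩ := h
  obtain ⟨i, hi⟩ := hf j
  refine ⟨i, fun x hx => hj ?_⟩
  rw [RingHom.mem_ker] at hx ⊢
  rw [proj_extend hI hf hi, hx, map_zero]

lemma exists_of_sub_mem_ker (I : ι → Ideal R) (i : ι) (x : Completion I) :
    ∃ r, x - of I r ∈ RingHom.ker (proj I i) := by
  obtain ⟨r, hr⟩ := Ideal.Quotient.mk_surjective (proj I i x)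
  exact ⟨r, by rw [RingHom.mem_ker, map_sub, proj_of, hr, sub_self]⟩

lemma ker_proj_mono {I : ι → Ideal R} {i j : ι} (h : I i ≤ I j) :
    RingHom.ker (proj I i) ≤ RingHom.ker (proj I j) := by
  intro x hx
  rw [RingHom.mem_ker] at hx ⊢
  rw [← factor_proj I h, hx, map_zero]

/-- The image of `R` is dense and the target discrete: both maps vanish on the kernel of a common
projection, and modulo that kernel every element comes from `R`. -/
lemma IsContOut.ext {I : ι → Ideal R} (hI : Directed (· ≥ ·) I) {Φ Ψ : Completion I →+* T}
    (hΦ : IsContOut Φ) (hΨ : IsContOut Ψ) (h : ∀ r, Φ (of I r) = Ψ (of I r)) : Φ = Ψ := by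
  obtain ⟨i, hi⟩ := hΦ
  obtain ⟨j, hj⟩ := hΨ
  obtain ⟨l, hli, hlj⟩ := hI i j
  ext x
  obtain ⟨r, hr⟩ := exists_of_sub_mem_ker I l x
  have h1 : Φ (x - of I r) = 0 := hi (ker_proj_mono hli hr)
  have h2 : Ψ (x - of I r) = 0 := hj (ker_proj_mono hlj hr)
  rw [map_sub, sub_eq_zero] at h1 h2
  rw [h1, h2, h]

lemma IsContOut.isCont {I : ι → Ideal R} {J : κ → Ideal S} {f : R →+* Completion J}
    (hf : IsCont I f) {Φ : Completion J →+* T} (h : IsContOut Φ) :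
    ∃ i, I i ≤ RingHom.ker (Φ.comp f) := by
  obtain ⟨j, hj⟩ := h
  obtain ⟨i, hi⟩ := hf j
  exact ⟨i, fun a ha => hj (hi ha)⟩

lemma completion_ext {I : ι → Ideal R} {x y : Completion I} (h : ∀ i, proj I i x = proj I i y) :
    x = y := Subtype.ext (funext h)

lemma tmul_eq_inl_mul_inr [Algebra k R] [Algebra k S] (a : R) (b : S) :
    a ⊗ₜ[k] b = inl k R S a * inr k R S b := by simp [inl, inr]

lemma tensor_hom_ext [Algebra k R] [Algebra k S] {f g : R ⊗[k] S →+* T}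
    (hl : ∀ a, f (inl k R S a) = g (inl k R S a)) (hr : ∀ b, f (inr k R S b) = g (inr k R S b)) :
    f = g := by
  refine RingHom.ext fun x => ?_
  induction x using TensorProduct.induction_on with
  | zero => simp
  | tmul a b =>
    rw [tmul_eq_inl_mul_inr, map_mul, map_mul, hl, hr]
  | add x y hx hy => rw [map_add, map_add, hx, hy]

lemma tensorLift_inl [Algebra k R] [Algebra k S] (f : R →+* T) (g : S →+* T)
    (h : ∀ c : k, f (algebraMap k R c) = g (algebraMap k S c)) (a : R) :
    tensorLift f g h (inl k R S a) = f a :=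
  (tensorLift_tmul f g h a 1).trans (by rw [map_one, mul_one])

lemma tensorLift_inr [Algebra k R] [Algebra k S] (f : R →+* T) (g : S →+* T)
    (h : ∀ c : k, f (algebraMap k R c) = g (algebraMap k S c)) (b : S) :
    tensorLift f g h (inr k R S b) = g b :=
  (tensorLift_tmul f g h 1 b).trans (by rw [map_one, one_mul])

lemma tensorIdeals_le_ker [Algebra k R] [Algebra k S] {I : ι → Ideal R} {J : κ → Ideal S}
    {Φ : R ⊗[k] S →+* T} {i : ι} {j : κ} (hi : I i ≤ RingHom.ker (Φ.comp (inl k R S)))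
    (hj : J j ≤ RingHom.ker (Φ.comp (inr k R S))) :
    tensorIdeals k I J (i, j) ≤ RingHom.ker Φ :=
  sup_le (Ideal.map_le_iff_le_comap.2 hi) (Ideal.map_le_iff_le_comap.2 hj)

lemma tensorIdeals_le_ker_tensorLift [Algebra k R] [Algebra k S] {I : ι → Ideal R}
    {J : κ → Ideal S} {f : R →+* T} {g : S →+* T}
    (h : ∀ c : k, f (algebraMap k R c) = g (algebraMap k S c)) {i : ι} {j : κ}
    (hi : I i ≤ RingHom.ker f) (hj : J j ≤ RingHom.ker g) :
    tensorIdeals k I J (i, j) ≤ RingHom.ker (tensorLift f g h) :=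
  tensorIdeals_le_ker
    (fun a ha => by rw [RingHom.mem_ker, RingHom.comp_apply, tensorLift_inl]; exact hi ha)
    (fun a ha => by rw [RingHom.mem_ker, RingHom.comp_apply, tensorLift_inr]; exact hj ha)

/-- The continuous homomorphism from a completed tensor product to a discrete ring determined by
continuous homomorphisms on both factors. -/
def evTensor [Algebra k R] [Algebra k S] {I : ι → Ideal R} {J : κ → Ideal S} (f : R →+* T)
    (g : S →+* T) (h : ∀ c : k, f (algebraMap k R c) = g (algebraMap k S c))
    (hf : ∃ i, I i ≤ RingHom.ker f) (hg : ∃ j, J j ≤ RingHom.ker g) :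
    CompletedTensor k I J →+* T :=
  (Ideal.Quotient.lift (tensorIdeals k I J (hf.choose, hg.choose)) (tensorLift f g h)
    (fun _ ha => tensorIdeals_le_ker_tensorLift h hf.choose_spec hg.choose_spec ha)).comp
    (proj (tensorIdeals k I J) (hf.choose, hg.choose))

section evTensor

variable [Algebra k R] [Algebra k S] {I : ι → Ideal R} {J : κ → Ideal S} {f : R →+* T}
  {g : S →+* T} (h : ∀ c : k, f (algebraMap k R c) = g (algebraMap k S c))
  (hf : ∃ i, I i ≤ RingHom.ker f) (hg : ∃ j, J j ≤ RingHom.ker g)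

lemma isContOut_evTensor : IsContOut (evTensor f g h hf hg) :=
  (isContOut_proj _ _).comp_left _

lemma evTensor_inl (a : R) : evTensor f g h hf hg (of _ (inl k R S a)) = f a :=
  tensorLift_inl f g h a

lemma evTensor_inr (b : S) : evTensor f g h hf hg (of _ (inr k R S b)) = g b :=
  tensorLift_inr f g h b

end evTensor

lemma completedTensor_hom_ext [Algebra k R] [Algebra k S] {I : ι → Ideal R} {J : κ → Ideal S}
    (hI : Directed (· ≥ ·) I) (hJ : Directed (· ≥ ·) J)
    {Φ Ψ : CompletedTensor k I J →+* T} (hΦ : IsContOut Φ) (hΨ : IsContOut Ψ)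
    (hl : ∀ a, Φ (of _ (inl k R S a)) = Ψ (of _ (inl k R S a)))
    (hr : ∀ b, Φ (of _ (inr k R S b)) = Ψ (of _ (inr k R S b))) : Φ = Ψ :=
  hΦ.ext (directed_tensorIdeals hI hJ) hΨ fun r =>
    RingHom.congr_fun (tensor_hom_ext (f := Φ.comp (of _)) (g := Ψ.comp (of _)) hl hr) r

section completedLift

variable [Algebra k R] [Algebra k S] {I : ι → Ideal R} {J : κ → Ideal S}
    (hI : Directed (· ≥ ·) I) (hJ : Directed (· ≥ ·) J)
    {K : μ → Ideal T} {f : R →+* Completion K} {g : S →+* Completion K}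
    (hf : IsCont I f) (hg : IsCont J g)
    (h : ∀ c : k, f (algebraMap k R c) = g (algebraMap k S c))

lemma completedLift_inl (a : R) : completedLift hI hJ hf hg h (of _ (inl k R S a)) = f a :=
  (extend_of (directed_tensorIdeals hI hJ) _ _).trans (tensorLift_inl f g h a)

lemma completedLift_inr (b : S) : completedLift hI hJ hf hg h (of _ (inr k R S b)) = g b :=
  (extend_of (directed_tensorIdeals hI hJ) _ _).trans (tensorLift_inr f g h b)

lemma IsContOut.comp_completedLift {Φ : Completion K →+* T'} (hΦ : IsContOut Φ) :
    IsContOut (Φ.comp (completedLift hI hJ hf hg h)) :=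
  hΦ.comp_extend _ _

end completedLift

end IdealCompletion

open IdealCompletion

/-! ### Points of augmented algebras -/

namespace AugmentedAlgebra

variable {A : Type} [AddCommGroup A] [Module (ZMod 2) A] {k : Type u} [CommRing k]
variable {T' T : Type u} [CommRing T'] [CommRing T]

/-- The points of `Spf R` with values in a `k`-algebra `T`, given by its structure map `η`: the
continuous `k`-algebra homomorphisms `R → T`. -/
@[ext]
structure Pt (F : AugmentedAlgebra A k) {T : Type u} [CommRing T] (η : k →+* T) where
  hom : F.R →+* T
  hom_algebraMap : ∀ c, hom (algebraMap k F.R c) = η c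
  cont : ∃ s, F.I s ≤ RingHom.ker hom

namespace Pt

variable {F : AugmentedAlgebra A k} {η : k →+* T}

lemma agree (p q : F.Pt η) (c : k) : p.hom (algebraMap k F.R c) = q.hom (algebraMap k F.R c) := by
  rw [p.hom_algebraMap, q.hom_algebraMap]

/-- Base change of points. -/
@[simps]
def map (φ : T →+* T') (p : F.Pt η) : F.Pt (φ.comp η) where
  hom := φ.comp p.hom
  hom_algebraMap c := by simp [p.hom_algebraMap]
  cont := p.cont.imp fun s hs x hx => by
    have : p.hom x = 0 := hs hx
    simp [RingHom.mem_ker, this]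

/-- The points given by the augmentations. -/
@[simps]
def ofθ (F : AugmentedAlgebra A k) (η : k →+* T) (V : Character A) : F.Pt η where
  hom := η.comp (F.θ V : F.R →+* k)
  hom_algebraMap c := by simp
  cont := ⟨{V}, fun x hx => by
    rw [F.I_singleton, RingHom.mem_ker] at hx
    simp [RingHom.mem_ker, hx]⟩

/-- The homomorphism `R ⊗̂ R → T` determined by two points. -/
def hat (p q : F.Pt η) : F.Tensor₂ →+* T := evTensor p.hom q.hom (p.agree q) p.cont q.cont

/-- The homomorphism `R ⊗̂ R ⊗̂ R → T` determined by three points. -/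
def hat₃ (p q r : F.Pt η) : F.Tensor₃ →+* T :=
  evTensor p.hom (tensorLift q.hom r.hom (q.agree r))
    (fun c => (p.agree q c).trans (tensorLift_inl _ _ (q.agree r) _).symm) p.cont
    (by
      obtain ⟨s, hs⟩ := q.cont
      obtain ⟨t, ht⟩ := r.cont
      exact ⟨(s, t), tensorIdeals_le_ker_tensorLift (q.agree r) hs ht⟩)

/-- The homomorphism from the completion of `R` to `T` determined by a point. -/
def hat₁ (p : F.Pt η) : Completion F.I →+* T :=
  (Ideal.Quotient.lift (F.I p.cont.choose) p.hom (fun _ ha => p.cont.choose_spec ha)).comp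
    (proj F.I p.cont.choose)

lemma isContOut_hat (p q : F.Pt η) : IsContOut (p.hat q) := isContOut_evTensor _ _ _

lemma isContOut_hat₃ (p q r : F.Pt η) : IsContOut (p.hat₃ q r) := isContOut_evTensor _ _ _

lemma isContOut_hat₁ (p : F.Pt η) : IsContOut p.hat₁ := (isContOut_proj _ _).comp_left _

@[simp] lemma hat_inc₁₂ (p q : F.Pt η) (a : F.R) : p.hat q (F.inc₁₂ a) = p.hom a :=
  evTensor_inl _ _ _ a

@[simp] lemma hat_inc₂₂ (p q : F.Pt η) (a : F.R) : p.hat q (F.inc₂₂ a) = q.hom a :=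
  evTensor_inr _ _ _ a

@[simp] lemma hat₃_inc₁₃ (p q r : F.Pt η) (a : F.R) : p.hat₃ q r (F.inc₁₃ a) = p.hom a :=
  evTensor_inl _ _ _ a

@[simp] lemma hat₃_inc₂₃ (p q r : F.Pt η) (a : F.R) : p.hat₃ q r (F.inc₂₃ a) = q.hom a :=
  (evTensor_inr _ _ _ _).trans (tensorLift_inl _ _ (q.agree r) _)

@[simp] lemma hat₃_inc₃₃ (p q r : F.Pt η) (a : F.R) : p.hat₃ q r (F.inc₃₃ a) = r.hom a :=
  (evTensor_inr _ _ _ _).trans (tensorLift_inr _ _ (q.agree r) _)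

@[simp] lemma hat₁_of (p : F.Pt η) (a : F.R) : p.hat₁ (of _ a) = p.hom a := rfl

lemma eq_hat {Φ : F.Tensor₂ →+* T} (hΦ : IsContOut Φ) (p q : F.Pt η)
    (h₁ : ∀ a, Φ (F.inc₁₂ a) = p.hom a) (h₂ : ∀ a, Φ (F.inc₂₂ a) = q.hom a) : Φ = p.hat q :=
  completedTensor_hom_ext F.directed_I F.directed_I hΦ (isContOut_hat p q)
    (fun a => (h₁ a).trans (hat_inc₁₂ p q a).symm) (fun a => (h₂ a).trans (hat_inc₂₂ p q a).symm)

lemma eq_hat₃ {Φ : F.Tensor₃ →+* T} (hΦ : IsContOut Φ) (p q r : F.Pt η)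
    (h₁ : ∀ a, Φ (F.inc₁₃ a) = p.hom a) (h₂ : ∀ a, Φ (F.inc₂₃ a) = q.hom a)
    (h₃ : ∀ a, Φ (F.inc₃₃ a) = r.hom a) : Φ = p.hat₃ q r :=
  completedTensor_hom_ext F.directed_I (directed_tensorIdeals F.directed_I F.directed_I) hΦ
    (isContOut_hat₃ p q r) (fun a => (h₁ a).trans (hat₃_inc₁₃ p q r a).symm)
    (RingHom.congr_fun (tensor_hom_ext
      (f := (Φ.comp (of _)).comp (inr k F.R (F.R ⊗[k] F.R)))
      (g := ((p.hat₃ q r).comp (of _)).comp (inr k F.R (F.R ⊗[k] F.R)))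
      (fun a => (h₂ a).trans (hat₃_inc₂₃ p q r a).symm)
      (fun a => (h₃ a).trans (hat₃_inc₃₃ p q r a).symm)))

lemma eq_hat₁ {Φ : Completion F.I →+* T} (hΦ : IsContOut Φ) (p : F.Pt η)
    (h : ∀ a, Φ (of _ a) = p.hom a) : Φ = p.hat₁ :=
  hΦ.ext F.directed_I p.isContOut_hat₁ h

lemma map_hat (φ : T →+* T') (p q : F.Pt η) (x : F.Tensor₂) :
    φ (p.hat q x) = (p.map φ).hat (q.map φ) x :=
  RingHom.congr_fun (eq_hat ((isContOut_hat p q).comp_left φ) (p.map φ) (q.map φ)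
    (by simp) (by simp)) x

lemma comp_completedLift {ι : Type} {S : Type u} [CommRing S] {K : ι → Ideal S}
    {f g : F.R →+* Completion K} (hf : IsCont F.I f) (hg : IsCont F.I g)
    (h : ∀ c : k, f (algebraMap k F.R c) = g (algebraMap k F.R c)) {Φ : Completion K →+* T}
    (hΦ : IsContOut Φ) (p q : F.Pt η) (h₁ : ∀ a, Φ (f a) = p.hom a) (h₂ : ∀ a, Φ (g a) = q.hom a)
    (x : F.Tensor₂) :
    Φ (completedLift F.directed_I F.directed_I hf hg h x) = p.hat q x :=
  RingHom.congr_fun (eq_hat (hΦ.comp_completedLift F.directed_I F.directed_I hf hg h) p q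
    (fun a => (congrArg Φ (completedLift_inl F.directed_I F.directed_I hf hg h a)).trans (h₁ a))
    (fun a => (congrArg Φ (completedLift_inr F.directed_I F.directed_I hf hg h a)).trans (h₂ a))) x

lemma hat_swapHat (p q : F.Pt η) (x : F.Tensor₂) : p.hat q (F.swapHat x) = q.hat p x := by
  unfold swapHat
  exact comp_completedLift _ _ _ (isContOut_hat p q) _ _ (hat_inc₂₂ p q) (hat_inc₁₂ p q) x

lemma hat₁_mulHat (p : F.Pt η) (x : F.Tensor₂) : p.hat₁ (F.mulHat x) = p.hat p x := by
  unfold mulHat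
  exact comp_completedLift _ _ _ (isContOut_hat₁ p) _ _ (hat₁_of p) (hat₁_of p) x

lemma hat₁_θHatId (p : F.Pt η) (V : Character A) (x : F.Tensor₂) :
    p.hat₁ (F.θHatId V x) = (ofθ F η V).hat p x := by
  unfold θHatId
  exact comp_completedLift _ _ _ (isContOut_hat₁ p) _ _ (fun a => p.hom_algebraMap _)
    (hat₁_of p) x

lemma proj_θHatθ (V W : Character A) (x : F.Tensor₂) :
    proj _ () (F.θHatθ V W x) =
      (ofθ F (Ideal.Quotient.mk _) V).hat (ofθ F (Ideal.Quotient.mk _) W) x := by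
  unfold θHatθ
  exact comp_completedLift _ _ _ (isContOut_proj _ ()) _ _ (fun a => rfl) (fun a => rfl) x

lemma hat₃_j₁₂ (p q r : F.Pt η) (x : F.Tensor₂) : p.hat₃ q r (F.j₁₂ x) = p.hat q x := by
  unfold j₁₂
  exact comp_completedLift _ _ _ (isContOut_hat₃ p q r) _ _ (hat₃_inc₁₃ p q r)
    (hat₃_inc₂₃ p q r) x

lemma hat₃_j₂₃ (p q r : F.Pt η) (x : F.Tensor₂) : p.hat₃ q r (F.j₂₃ x) = q.hat r x := by
  unfold j₂₃
  exact comp_completedLift _ _ _ (isContOut_hat₃ p q r) _ _ (hat₃_inc₂₃ p q r)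
    (hat₃_inc₃₃ p q r) x

end Pt

variable (F : AugmentedAlgebra A k)

/-- Each projection of `R ⊗̂ R` to a discrete quotient is itself the map attached to a pair of
points, the images of the two inclusions. Hence pairs of points separate elements, and identities
involving comultiplications may be tested on points. -/
lemma tensor₂_ext {x y : F.Tensor₂}
    (h : ∀ (T : Type u) [CommRing T] (η : k →+* T) (p q : F.Pt η), p.hat q x = p.hat q y) :
    x = y := by
  refine completion_ext fun i => ?_
  let Φ := proj (tensorIdeals k F.I F.I) i
  let η : k →+* _ := (Φ.comp F.inc₁₂).comp (algebraMap k F.R)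
  let p : F.Pt η := ⟨Φ.comp F.inc₁₂, fun _ => rfl, F.isCont_inc₁₂ i⟩
  let q : F.Pt η := ⟨Φ.comp F.inc₂₂, fun c => congrArg Φ (F.inc₁₂_algebraMap c).symm,
    F.isCont_inc₂₂ i⟩
  have := Pt.eq_hat (isContOut_proj _ i) p q (fun _ => rfl) (fun _ => rfl)
  rw [this]
  exact h _ η p q

lemma tensor₃_ext {x y : F.Tensor₃}
    (h : ∀ (T : Type u) [CommRing T] (η : k →+* T) (p q r : F.Pt η),
      p.hat₃ q r x = p.hat₃ q r y) : x = y := by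
  refine completion_ext fun i => ?_
  let Φ := proj (tensorIdeals k F.I (tensorIdeals k F.I F.I)) i
  let η : k →+* _ := (Φ.comp F.inc₁₃).comp (algebraMap k F.R)
  let p : F.Pt η := ⟨Φ.comp F.inc₁₃, fun _ => rfl, F.isCont_inc₁₃ i⟩
  let q : F.Pt η := ⟨Φ.comp F.inc₂₃, fun c => congrArg Φ (F.inc₁₃_algebraMap c).symm,
    F.isCont_inc₂₃ i⟩
  let r : F.Pt η := ⟨Φ.comp F.inc₃₃, fun c => congrArg Φ
    ((F.inc₂₃_algebraMap c).symm.trans (F.inc₁₃_algebraMap c).symm), F.isCont_inc₃₃ i⟩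
  have := Pt.eq_hat₃ (isContOut_proj _ i) p q r (fun _ => rfl) (fun _ => rfl) (fun _ => rfl)
  rw [this]
  exact h _ η p q r

/-- The tautological point of `R` with values in `R ⧸ I s`. -/
@[simps]
def tautPt (s : Multiset (Character A)) :
    F.Pt ((Ideal.Quotient.mk (F.I s)).comp (algebraMap k F.R)) where
  hom := Ideal.Quotient.mk (F.I s)
  hom_algebraMap _ := rfl
  cont := ⟨s, by rw [Ideal.mk_ker]⟩

lemma completion_I_ext {x y : Completion F.I}
    (h : ∀ (T : Type u) [CommRing T] (η : k →+* T) (p : F.Pt η), p.hat₁ x = p.hat₁ y) :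
    x = y := by
  refine completion_ext fun s => ?_
  have := Pt.eq_hat₁ (isContOut_proj _ s) (F.tautPt s) (fun _ => rfl)
  rw [this]
  exact h _ _ _

end AugmentedAlgebra

open AugmentedAlgebra

/-! ### The addition of points -/

namespace AugmentedBialgebra

variable {A : Type} [AddCommGroup A] [Module (ZMod 2) A] {k : Type u} [CommRing k]
variable {T T' : Type u} [CommRing T] [CommRing T']
variable (F : AugmentedBialgebra A k) {η : k →+* T}

/-- The sum of two points. -/
def star (p q : F.Pt η) : F.Pt η where
  hom := (p.hat q).comp F.Δ
  hom_algebraMap c := by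
    rw [RingHom.comp_apply, F.Δ_algebraMap, Pt.hat_inc₁₂, p.hom_algebraMap]
  cont := (Pt.isContOut_hat p q).isCont F.Δ_cont

lemma star_hom (p q : F.Pt η) (x : F.R) : (F.star p q).hom x = p.hat q (F.Δ x) := rfl

lemma hat₃_ΔHatId (p q r : F.Pt η) (x : F.Tensor₂) :
    p.hat₃ q r (F.ΔHatId x) = (F.star p q).hat r x := by
  unfold ΔHatId
  exact Pt.comp_completedLift _ _ _ (Pt.isContOut_hat₃ p q r) _ _
    (fun a => Pt.hat₃_j₁₂ p q r _) (Pt.hat₃_inc₃₃ p q r) x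

lemma hat₃_idHatΔ (p q r : F.Pt η) (x : F.Tensor₂) :
    p.hat₃ q r (F.idHatΔ x) = p.hat (F.star q r) x := by
  unfold idHatΔ
  exact Pt.comp_completedLift _ _ _ (Pt.isContOut_hat₃ p q r) _ _
    (Pt.hat₃_inc₁₃ p q r) (fun a => Pt.hat₃_j₂₃ p q r _) x

lemma star_map (φ : T →+* T') (p q : F.Pt η) :
    (F.star p q).map φ = F.star (p.map φ) (q.map φ) :=
  Pt.ext (RingHom.ext fun x => Pt.map_hat φ p q (F.Δ x))

end AugmentedBialgebra

namespace EquivariantFGL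

variable {A : Type} [AddCommGroup A] [Module (ZMod 2) A] {k : Type u} [CommRing k]
variable {T T' : Type u} [CommRing T] [CommRing T']
variable (F : EquivariantFGL A k) {η : k →+* T}

instance : Add (F.Pt η) := ⟨F.star⟩

instance : Zero (F.Pt η) := ⟨Pt.ofθ _ η 0⟩

/-- Each law is the matching axiom of `Δ` evaluated at points; the right unit law combines the left
counit with cocommutativity. -/
instance : AddCommMonoid (F.Pt η) where
  nsmul := nsmulRec
  add_assoc p q r := Pt.ext <| RingHom.ext fun x =>
    (F.hat₃_ΔHatId p q r (F.Δ x)).symm.trans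
      ((congrArg (p.hat₃ q r) (F.coassoc x)).trans (F.hat₃_idHatΔ p q r (F.Δ x)))
  add_comm p q := Pt.ext <| RingHom.ext fun x =>
    (Pt.hat_swapHat q p (F.Δ x)).symm.trans (congrArg (q.hat p) (F.cocomm x))
  zero_add p := Pt.ext <| RingHom.ext fun x =>
    (Pt.hat₁_θHatId p 0 (F.Δ x)).symm.trans (congrArg p.hat₁ (F.counit x))
  add_zero p := Pt.ext <| RingHom.ext fun x =>
    (Pt.hat_swapHat _ p (F.Δ x)).symm.trans <| (congrArg ((Pt.ofθ _ η 0).hat p) (F.cocomm x)).trans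
      ((Pt.hat₁_θHatId p 0 (F.Δ x)).symm.trans (congrArg p.hat₁ (F.counit x)))

lemma zero_def : (0 : F.Pt η) = Pt.ofθ _ η 0 := rfl

lemma map_add (φ : T →+* T') (p q : F.Pt η) : (p + q).map φ = p.map φ + q.map φ :=
  F.star_map φ p q

lemma map_zero (φ : T →+* T') : (0 : F.Pt η).map φ = 0 := Pt.ext rfl

lemma θ_y : F.θ 0 F.y = 0 := by
  have : F.y ∈ RingHom.ker (F.θ 0) := F.span_y ▸ Ideal.mem_span_singleton_self F.y
  exact this

lemma zero_y : (0 : F.Pt η).hom F.y = 0 := by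
  rw [zero_def, Pt.ofθ_hom, RingHom.comp_apply, RingHom.coe_coe, θ_y, _root_.map_zero]

/-- Every `x` differs from the constant `θ(ε)(x)` by a multiple of `y(ε)`, so a point killing `y(ε)`
is determined. This is what turns the condition on the single element `y(ε)` into `p + p = 0` for
all points. -/
lemma eq_zero_of_hom_y {p : F.Pt η} (h : p.hom F.y = 0) : p = 0 := by
  refine Pt.ext (RingHom.ext fun x => ?_)
  have hx : x - algebraMap k F.R (F.θ 0 x) ∈ RingHom.ker (F.θ 0) := by
    simp [RingHom.mem_ker]
  rw [← F.span_y, Ideal.mem_span_singleton] at hx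
  obtain ⟨z, hz⟩ := hx
  have h2 := congrArg p.hom hz
  rw [_root_.map_sub, _root_.map_mul, h, zero_mul, sub_eq_zero, p.hom_algebraMap] at h2
  exact h2

lemma add_self (hF : F.IsTwoTorsion) (p : F.Pt η) : p + p = 0 := by
  refine F.eq_zero_of_hom_y ?_
  refine (Pt.hat₁_mulHat p (F.Δ F.y)).symm.trans ?_
  rw [show F.mulHat (F.Δ F.y) = 0 from hF, _root_.map_zero]

lemma ofθ_add (V W : Character A) :
    Pt.ofθ F.toAugmentedAlgebra η V + Pt.ofθ F.toAugmentedAlgebra η W =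
      Pt.ofθ F.toAugmentedAlgebra η (V + W) := by
  refine Pt.ext (RingHom.ext fun x => ?_)
  -- The axiom `θ_Δ` takes place in the completion of `k` at the zero ideal, so it is read in `k ⧸
  -- ⊥`, into which `k` injects.
  have hinj : Function.Injective (Ideal.Quotient.mk (⊥ : Ideal k)) := by
    rw [RingHom.injective_iff_ker_eq_bot, Ideal.mk_ker]
  have h := congrArg (proj _ ()) (F.θ_Δ V W x)
  rw [Pt.proj_θHatθ] at h
  let a : F.Pt (RingHom.id k) := Pt.ofθ F.toAugmentedAlgebra _ V
  let b : F.Pt (RingHom.id k) := Pt.ofθ F.toAugmentedAlgebra _ W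
  have h2 : Ideal.Quotient.mk (⊥ : Ideal k) (a.hat b (F.Δ x)) =
      Ideal.Quotient.mk (⊥ : Ideal k) (F.θ (V + W) x) :=
    (Pt.map_hat (Ideal.Quotient.mk (⊥ : Ideal k)) a b (F.Δ x)).trans h
  have h3 := congrArg η (hinj h2)
  exact (Pt.map_hat η a b (F.Δ x)).symm.trans h3

/-- The homomorphism from the group of characters to the group of points given by the
augmentations. -/
@[simps]
def θPt (η : k →+* T) : Character A →+ F.Pt η where
  toFun V := Pt.ofθ _ η V
  map_zero' := rfl
  map_add' V W := (F.ofθ_add V W).symm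

/-- Base change of points as a homomorphism. -/
@[simps]
def mapPt (η : k →+* T) (φ : T →+* T') : F.Pt η →+ F.Pt (φ.comp η) where
  toFun p := p.map φ
  map_zero' := F.map_zero φ
  map_add' := F.map_add φ

end EquivariantFGL

/-! ### The functions on the scheme of homomorphisms to a formal group law -/

/-- Restriction of characters. -/
@[simps]
def Character.comap {B C : Type} [AddCommGroup B] [Module (ZMod 2) B] [AddCommGroup C]
    [Module (ZMod 2) C] (β : B →ₗ[ZMod 2] C) : Character C →+ Character B where
  toFun V := V ∘ₗ β
  map_zero' := LinearMap.zero_comp β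
  map_add' V W := LinearMap.add_comp β W V

lemma ZMod.eq_zero_or_one (c : ZMod 2) : c = 0 ∨ c = 1 := by revert c; decide

/-- The modification of a homomorphism out of a group of characters by `t` times the evaluation at
`b`. -/
@[simps]
def Character.twist {B M : Type*} [AddCommGroup B] [Module (ZMod 2) B] [AddCommMonoid M] (b : B)
    (x : (B →ₗ[ZMod 2] ZMod 2) →+ M) (t : M) (ht : t + t = 0) :
    (B →ₗ[ZMod 2] ZMod 2) →+ M where
  toFun W := x W + if W b = 0 then 0 else t
  map_zero' := by simp
  map_add' V W := by
    rw [map_add, add_add_add_comm, LinearMap.add_apply]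
    congr 1
    rcases ZMod.eq_zero_or_one (V b) with h | h <;> rcases ZMod.eq_zero_or_one (W b) with h' | h' <;>
      simp [h, h', ht, show (1 : ZMod 2) + 1 = 0 from rfl]

namespace EquivariantFGL

variable {A B C : Type} [AddCommGroup A] [Module (ZMod 2) A] [AddCommGroup B] [Module (ZMod 2) B]
  [AddCommGroup C] [Module (ZMod 2) C]
variable {k : Type u} [CommRing k] (F : EquivariantFGL A k)

section Over

variable {F} {T T' : Type u} [CommRing T] [CommRing T'] {η : k →+* T} {η' : k →+* T'}
  {φ : T →+* T'}

/-- Constants lie in `R`, so a ring map relating two points respects the structure maps from `k`.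
For this reason naturality of functions can be stated without mentioning `η`. -/
lemma comp_eq_of_over {p : F.Pt η} {p' : F.Pt η'} (h : ∀ a, φ (p.hom a) = p'.hom a) :
    η' = φ.comp η := by
  ext c
  rw [← p'.hom_algebraMap, ← h, p.hom_algebraMap, RingHom.comp_apply]

lemma over_add {p q : F.Pt η} {p' q' : F.Pt η'} (hp : ∀ a, φ (p.hom a) = p'.hom a)
    (hq : ∀ a, φ (q.hom a) = q'.hom a) (a : F.R) : φ ((p + q).hom a) = (p' + q').hom a := by
  obtain rfl := comp_eq_of_over hp
  have h1 : p.map φ = p' := Pt.ext (RingHom.ext hp)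
  have h2 : q.map φ = q' := Pt.ext (RingHom.ext hq)
  rw [← h1, ← h2, ← F.map_add]
  rfl

lemma over_zero (h : η' = φ.comp η) (a : F.R) :
    φ ((0 : F.Pt η).hom a) = (0 : F.Pt η').hom a := by
  subst h
  rfl

lemma over_twist {b : B} {x : Character B →+ F.Pt η} {x' : Character B →+ F.Pt η'} {t : F.Pt η}
    {t' : F.Pt η'} {ht : t + t = 0} {ht' : t' + t' = 0}
    (hx : ∀ W a, φ ((x W).hom a) = (x' W).hom a) (h : ∀ a, φ (t.hom a) = t'.hom a)
    (W : Character B) (a : F.R) :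
    φ ((Character.twist b x t ht W).hom a) = (Character.twist b x' t' ht' W).hom a := by
  refine over_add (hx W) (fun a => ?_) a
  split_ifs
  · exact over_zero (comp_eq_of_over h) a
  · exact h a

end Over

/-- A `k`-algebra `T` together with a homomorphism from the characters of `B` to the `T`-valued
points of a formal group law over `k`. -/
structure TestPt (B : Type) [AddCommGroup B] [Module (ZMod 2) B] : Type (u + 1) where
  T : Type u
  [commRing : CommRing T]
  η : k →+* T
  x : Character B →+ F.Pt η

attribute [instance] TestPt.commRing

/-- The ring of functions on the scheme of homomorphisms from the characters of `B` to a formal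
group law. -/
def functions (B : Type) [AddCommGroup B] [Module (ZMod 2) B] :
    Subring (∀ p : F.TestPt B, p.T) where
  carrier := {h | ∀ (p q : F.TestPt B) (φ : p.T →+* q.T),
    (∀ W a, φ ((p.x W).hom a) = (q.x W).hom a) → φ (h p) = h q}
  mul_mem' ha hb p q φ h := by simp [ha p q φ h, hb p q φ h]
  one_mem' p q φ h := by simp
  add_mem' ha hb p q φ h := by simp [ha p q φ h, hb p q φ h]
  zero_mem' p q φ h := by simp
  neg_mem' ha p q φ h := by simp [ha p q φ h]

variable {F}

/-- The image of a test point under a homomorphism of groups. -/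
@[simps]
def TestPt.push (β : B →ₗ[ZMod 2] C) (p : F.TestPt B) : F.TestPt C where
  T := p.T
  η := p.η
  x := p.x.comp (Character.comap β)

/-- The restriction of functions along a homomorphism of groups. -/
def functionsMap (F : EquivariantFGL A k) (β : B →ₗ[ZMod 2] C) :
    F.functions C →+* F.functions B where
  toFun h := ⟨fun p => h.1 (p.push β), fun p q φ hφ =>
    h.2 (p.push β) (q.push β) φ fun W a => hφ (W ∘ₗ β) a⟩
  map_one' := rfl
  map_mul' _ _ := rfl
  map_zero' := rfl
  map_add' _ _ := rfl

/-- The coordinate function pulled back along a character. -/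
def coordinate (F : EquivariantFGL A k) (V : Character B) : F.functions B :=
  ⟨fun p => (p.x V).hom F.y, fun _ _ _ h => h V F.y⟩

/-! ### Divided differences -/

lemma exists_divDiff (F : EquivariantFGL A k) (r : F.R) :
    ∃ q, F.y * q = r - algebraMap k F.R (F.θ 0 r) := by
  have hx : r - algebraMap k F.R (F.θ 0 r) ∈ RingHom.ker (F.θ 0) := by simp [RingHom.mem_ker]
  rw [← F.span_y, Ideal.mem_span_singleton] at hx
  obtain ⟨z, hz⟩ := hx
  exact ⟨z, hz.symm⟩

lemma y_cancel (F : EquivariantFGL A k) {a b : F.R} (h : F.y * a = F.y * b) : a = b :=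
  (mul_cancel_left_mem_nonZeroDivisors F.y_regular).1 h

/-- The operator `r ↦ (r - θ(ε)(r)) / y(ε)`. -/
def divDiff (F : EquivariantFGL A k) : F.R →ₗ[k] F.R where
  toFun r := (F.exists_divDiff r).choose
  map_add' a b := F.y_cancel (by
    rw [mul_add, (F.exists_divDiff _).choose_spec, (F.exists_divDiff _).choose_spec,
      (F.exists_divDiff _).choose_spec, _root_.map_add, _root_.map_add]
    ring)
  map_smul' c a := F.y_cancel (by
    rw [mul_smul_comm, RingHom.id_apply, (F.exists_divDiff _).choose_spec,
      (F.exists_divDiff _).choose_spec, _root_.map_smul, smul_sub, smul_eq_mul, _root_.map_mul,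
      ← Algebra.smul_def])

lemma y_mul_divDiff (r : F.R) : F.y * F.divDiff r = r - algebraMap k F.R (F.θ 0 r) :=
  (F.exists_divDiff r).choose_spec

lemma divDiff_y_mul (r : F.R) : F.divDiff (F.y * r) = r :=
  F.y_cancel (by rw [y_mul_divDiff, _root_.map_mul, F.θ_y, zero_mul, _root_.map_zero, sub_zero])

/-! ### Deforming a test point: regularity and divisibility of coordinates -/

namespace TestPt

variable (p q : F.TestPt B)

instance : Algebra k p.T := p.η.toAlgebra

/-- The algebra of functions on the base change of `Spf R`, before completion. -/
abbrev D := p.T ⊗[k] F.R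

/-- The ideals generated by `I s`. -/
def K (s : Multiset (Character A)) : Ideal p.D := (F.I s).map (inr k p.T F.R)

/-- The divided difference operator after base change. -/
def ρ : p.D →ₗ[k] p.D := F.divDiff.lTensor p.T

/-- A regular element need not stay regular after base change. Here `y` does, because its left
inverse `divDiff` is `k`-linear and can be tensored with `T`. -/
lemma ρ_y_mul (d : p.D) : p.ρ (inr k p.T F.R F.y * d) = d := by
  induction d using TensorProduct.induction_on with
  | zero => simp
  | tmul t r =>
    have : inr k p.T F.R F.y * t ⊗ₜ[k] r = t ⊗ₜ[k] (F.y * r) := by simp [inr]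
    rw [this, ρ, LinearMap.lTensor_tmul, divDiff_y_mul]
  | add a b ha hb => rw [mul_add, _root_.map_add, ha, hb]

/-- The value of a function at a point. -/
def ev (t : F.Pt p.η) : p.D →+* p.T :=
  tensorLift (RingHom.id p.T) t.hom fun c => (t.hom_algebraMap c).symm

lemma ev_inl (t : F.Pt p.η) (c : p.T) : p.ev t (inl k p.T F.R c) = c := tensorLift_inl _ _ _ _

lemma ev_inr (t : F.Pt p.η) (a : F.R) : p.ev t (inr k p.T F.R a) = t.hom a :=
  tensorLift_inr _ _ _ _

lemma K_le_ker_ev {t : F.Pt p.η} {s : Multiset (Character A)} (h : F.I s ≤ RingHom.ker t.hom) :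
    p.K s ≤ RingHom.ker (p.ev t) :=
  Ideal.map_le_iff_le_comap.2 fun a ha => by
    rw [Ideal.mem_comap, RingHom.mem_ker, ev_inr]
    exact h ha

lemma y_mul_ρ (d : p.D) :
    inr k p.T F.R F.y * p.ρ d = d - inl k p.T F.R (p.ev 0 d) := by
  induction d using TensorProduct.induction_on with
  | zero => simp
  | tmul t r =>
    have h1 : inr k p.T F.R F.y * t ⊗ₜ[k] (F.divDiff r) = t ⊗ₜ[k] (F.y * F.divDiff r) := by
      simp [inr]
    have h2 : p.ev 0 (t ⊗ₜ[k] r) = t * p.η (F.θ 0 r) := rfl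
    have h3 : inl k p.T F.R (p.η (F.θ 0 r)) = inr k p.T F.R (algebraMap k F.R (F.θ 0 r)) :=
      inl_algebraMap k p.T F.R _
    rw [ρ, LinearMap.lTensor_tmul, h1, y_mul_divDiff, TensorProduct.tmul_sub, h2, _root_.map_mul,
      h3]
    rw [tmul_eq_inl_mul_inr t (algebraMap k F.R (F.θ 0 r))]
  | add a b ha hb =>
    rw [_root_.map_add, mul_add, ha, hb, _root_.map_add, _root_.map_add]
    ring

lemma I_cons (s : Multiset (Character A)) : F.I (0 ::ₘ s) = Ideal.span {F.y} * F.I s := by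
  rw [F.span_y]
  simp [AugmentedAlgebra.I]

lemma mem_K_cons {s : Multiset (Character A)} {z : p.D} :
    z ∈ p.K (0 ::ₘ s) ↔ ∃ w ∈ p.K s, inr k p.T F.R F.y * w = z := by
  rw [K, I_cons, Ideal.map_mul, Ideal.map_span, Set.image_singleton,
    Ideal.mem_span_singleton_mul]
  rfl

/-- Dividing by `y` loses exactly one factor of `ker θ(ε)`. This is why the deformations below are
taken modulo `K (0 ::ₘ s)` when a result modulo `K s` is wanted. -/
lemma ρ_mem_K {s : Multiset (Character A)} {z : p.D} (h : z ∈ p.K (0 ::ₘ s)) :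
    p.ρ z ∈ p.K s := by
  obtain ⟨w, hw, rfl⟩ := p.mem_K_cons.1 h
  rwa [ρ_y_mul]

variable {p q}

/-- The map of base changes over a map of test points. -/
def mapD (φ : p.T →+* q.T) (h : q.η = φ.comp p.η) : p.D →+* q.D :=
  tensorLift ((inl k q.T F.R).comp φ) (inr k q.T F.R) fun c => by
    rw [← inl_algebraMap]
    exact congrArg (inl k q.T F.R) (RingHom.congr_fun h c).symm

lemma mapD_inl (φ : p.T →+* q.T) (h : q.η = φ.comp p.η) (c : p.T) :
    mapD φ h (inl k p.T F.R c) = inl k q.T F.R (φ c) := tensorLift_inl _ _ _ _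

lemma mapD_inr (φ : p.T →+* q.T) (h : q.η = φ.comp p.η) (a : F.R) :
    mapD φ h (inr k p.T F.R a) = inr k q.T F.R a := tensorLift_inr _ _ _ _

lemma K_le_comap_mapD (φ : p.T →+* q.T) (h : q.η = φ.comp p.η) {s t : Multiset (Character A)}
    (hst : F.I s ≤ F.I t) : p.K s ≤ (q.K t).comap (mapD φ h) :=
  Ideal.map_le_iff_le_comap.2 fun a ha => by
    rw [Ideal.mem_comap, Ideal.mem_comap, mapD_inr]
    exact Ideal.mem_map_of_mem _ (hst ha)

lemma ρ_mapD (φ : p.T →+* q.T) (h : q.η = φ.comp p.η) (d : p.D) :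
    q.ρ (mapD φ h d) = mapD φ h (p.ρ d) := by
  induction d using TensorProduct.induction_on with
  | zero => simp
  | tmul t r =>
    have h1 (t : p.T) (r : F.R) : mapD φ h (t ⊗ₜ[k] r) = φ t ⊗ₜ[k] r := by
      refine (tensorLift_tmul _ _ _ _ _).trans ?_
      simp [inl, inr]
    rw [h1, ρ, ρ, LinearMap.lTensor_tmul, LinearMap.lTensor_tmul, h1]
  | add a b ha hb => simp only [_root_.map_add, ha, hb]

lemma ev_mapD (φ : p.T →+* q.T) (h : q.η = φ.comp p.η) {t : F.Pt p.η} {t' : F.Pt q.η}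
    (ht : ∀ a, φ (t.hom a) = t'.hom a) (d : p.D) : q.ev t' (mapD φ h d) = φ (p.ev t d) :=
  RingHom.congr_fun (tensor_hom_ext (f := (q.ev t').comp (mapD φ h)) (g := φ.comp (p.ev t))
    (fun c => by simp [mapD_inl, ev_inl]) (fun a => by simp [mapD_inr, ev_inr, ht])) d

variable (p)

/-- The structure map of the base change. -/
def ηK (s : Multiset (Character A)) : k →+* p.D ⧸ p.K s :=
  ((Ideal.Quotient.mk (p.K s)).comp (inl k p.T F.R)).comp p.η

/-- The universal point of the base change. -/
@[simps]
def tautK (s : Multiset (Character A)) : F.Pt (p.ηK s) where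
  hom := (Ideal.Quotient.mk (p.K s)).comp (inr k p.T F.R)
  hom_algebraMap c := congrArg (Ideal.Quotient.mk (p.K s)) (inl_algebraMap k p.T F.R c).symm
  cont := ⟨s, fun a ha => by
    rw [RingHom.mem_ker, RingHom.comp_apply]
    exact Ideal.Quotient.eq_zero_iff_mem.2 (Ideal.mem_map_of_mem _ ha)⟩

/-- The base change of the homomorphism belonging to a test point. -/
def xK (s : Multiset (Character A)) : Character B →+ F.Pt (p.ηK s) :=
  (F.mapPt p.η ((Ideal.Quotient.mk (p.K s)).comp (inl k p.T F.R))).comp p.x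

variable (hF : F.IsTwoTorsion) (b : B) (V : Character B)

/-- The universal deformation of a test point in the direction of `b`. -/
def univ (s : Multiset (Character A)) : F.TestPt B where
  T := p.D ⧸ p.K s
  η := p.ηK s
  -- If `V b = 1`, the correction `t + x(V)` changes the value at `V` from `x(V)` to the free
  -- parameter `t`, by 2-torsion. At `t = x(V)` the correction vanishes and the original point
  -- returns; at `t = 0` the value at `V` becomes zero.
  x := Character.twist b (p.xK s) (p.tautK s + p.xK s V) (F.add_self hF _)

lemma univ_over {T : Type u} [CommRing T] {η : k →+* T} {s : Multiset (Character A)}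
    (ψ : p.D ⧸ p.K s →+* T) {x : Character B →+ F.Pt η} {t : F.Pt η}
    (hx : ∀ W a, ψ (Ideal.Quotient.mk _ (inl k p.T F.R ((p.x W).hom a))) = (x W).hom a)
    (ht : ∀ a, ψ (Ideal.Quotient.mk _ (inr k p.T F.R a)) = t.hom a) (W : Character B) (a : F.R) :
    ψ (((p.univ hF b V s).x W).hom a) =
      (Character.twist b x (t + x V) (F.add_self hF _) W).hom a :=
  over_twist (x := p.xK s) (ht := F.add_self hF _) hx (over_add ht (hx V)) W a

lemma univ_over_map {φ : p.T →+* q.T} (hφ : ∀ W a, φ ((p.x W).hom a) = (q.x W).hom a)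
    (h : q.η = φ.comp p.η) {s t : Multiset (Character A)} (hst : F.I s ≤ F.I t)
    (W : Character B) (a : F.R) :
    Ideal.quotientMap (q.K t) (mapD φ h) (K_le_comap_mapD φ h hst)
      (((p.univ hF b V s).x W).hom a) = ((q.univ hF b V t).x W).hom a := by
  refine p.univ_over hF b V _ (fun W a => ?_) (fun a => ?_) W a
  · rw [Ideal.quotientMap_mk, mapD_inl, hφ]
    rfl
  · rw [Ideal.quotientMap_mk, mapD_inr]
    rfl

lemma univ_over_ev (t : F.Pt p.η) {s : Multiset (Character A)} (h : F.I s ≤ RingHom.ker t.hom)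
    (W : Character B) (a : F.R) :
    Ideal.Quotient.lift (p.K s) (p.ev t) (fun _ ha => p.K_le_ker_ev h ha)
      (((p.univ hF b V s).x W).hom a) =
        (Character.twist b p.x (t + p.x V) (F.add_self hF _) W).hom a := by
  refine p.univ_over hF b V _ (fun W a => ?_) (fun a => ?_) W a
  · exact (Ideal.Quotient.lift_mk _ _ _).trans (p.ev_inl t _)
  · exact (Ideal.Quotient.lift_mk _ _ _).trans (p.ev_inr t _)

/-- Specialising the parameter to `x(V)` undoes the deformation, since `x(V) + x(V) = 0`; naturality
of `h` does the rest. -/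
lemma ev_lift {h : F.functions B} {s : Multiset (Character A)}
    (hs : F.I s ≤ RingHom.ker (p.x V).hom) {w : p.D}
    (hw : Ideal.Quotient.mk _ w = h.1 (p.univ hF b V s)) : p.ev (p.x V) w = h.1 p := by
  have h1 := h.2 (p.univ hF b V s) p
    (Ideal.Quotient.lift (p.K s) (p.ev (p.x V)) (fun _ ha => p.K_le_ker_ev hs ha))
    (fun W a => (p.univ_over_ev hF b V _ hs W a).trans (by
      rw [Character.twist_apply, F.add_self hF, ite_self, add_zero]))
  rw [← h1, ← hw]
  exact (Ideal.Quotient.lift_mk _ _ _).symm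

variable {b V}

lemma univ_x (hb : V b = 1) (s : Multiset (Character A)) : (p.univ hF b V s).x V = p.tautK s := by
  refine (Character.twist_apply b (p.xK s) _ (F.add_self hF _) V).trans ?_
  rw [hb, if_neg one_ne_zero, add_comm, add_assoc, F.add_self hF, add_zero]

/-- Specialising the parameter to zero gives a test point that kills `V`, where `h` vanishes by
assumption. -/
lemma ev_zero_lift (hb : V b = 1) {h : F.functions B}
    (h0 : ∀ q : F.TestPt B, q.x V = 0 → h.1 q = 0)
    {s : Multiset (Character A)} {w : p.D}
    (hw : Ideal.Quotient.mk _ w = h.1 (p.univ hF b V (0 ::ₘ s))) : p.ev 0 w = 0 := by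
  have hs : F.I (0 ::ₘ s) ≤ RingHom.ker (0 : F.Pt p.η).hom := by
    rw [I_cons]
    refine Ideal.mul_le_left.trans ((Ideal.span_singleton_le_iff_mem _).2 F.zero_y)
  let q : F.TestPt B := ⟨p.T, p.η, Character.twist b p.x (0 + p.x V) (F.add_self hF _)⟩
  have hq : q.x V = 0 := by
    refine (Character.twist_apply b p.x _ (F.add_self hF _) V).trans ?_
    rw [hb, if_neg one_ne_zero, zero_add, F.add_self hF]
  have h1 := h.2 (p.univ hF b V (0 ::ₘ s)) q
    (Ideal.Quotient.lift (p.K (0 ::ₘ s)) (p.ev 0) (fun _ ha => p.K_le_ker_ev hs ha))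
    (p.univ_over_ev hF b V _ hs)
  rw [h0 q hq, ← hw] at h1
  exact (Ideal.Quotient.lift_mk _ _ _).symm.trans h1

/-- On the universal deformation the coordinate at `V` is `y`, which `ρ` cancels at the cost of one
level of precision. Specialising the parameter to `x(V)` then shows that `g` vanishes at the
original test point. -/
lemma coordinate_mul_eq_zero (hF : F.IsTwoTorsion) (hb : V b = 1) {g : F.functions B}
    (hg : F.coordinate V * g = 0) : g = 0 := by
  refine Subtype.ext (funext fun p => ?_)
  obtain ⟨s, hs⟩ := (p.x V).cont
  have hs' : F.I (0 ::ₘ s) ≤ RingHom.ker (p.x V).hom := by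
    rw [I_cons]
    exact Ideal.mul_le_right.trans hs
  obtain ⟨w, hw⟩ := Ideal.Quotient.mk_surjective (I := p.K (0 ::ₘ s))
    (g.1 (p.univ hF b V (0 ::ₘ s)))
  have h1 : (((p.univ hF b V (0 ::ₘ s)).x V).hom F.y) * g.1 (p.univ hF b V (0 ::ₘ s)) = 0 :=
    congrFun (congrArg Subtype.val hg) (p.univ hF b V (0 ::ₘ s))
  rw [p.univ_x hF hb, ← hw] at h1
  have h2 : Ideal.Quotient.mk (p.K (0 ::ₘ s)) (inr k p.T F.R F.y * w) = 0 := by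
    rw [_root_.map_mul]
    exact h1
  have h3 := p.ρ_mem_K (Ideal.Quotient.eq_zero_iff_mem.1 h2)
  rw [ρ_y_mul] at h3
  rw [← p.ev_lift hF b V hs' hw]
  exact p.K_le_ker_ev hs h3

/-- The candidate quotient is insensitive to the level of the quotient, to the lift chosen in `D`,
and to a change of test point. Both well-definedness and naturality come out of this one comparison.
-/
lemma φ_ev_ρ_lift {h : F.functions B} {φ : p.T →+* q.T}
    (hφ : ∀ W a, φ ((p.x W).hom a) = (q.x W).hom a) {m t : Multiset (Character A)}
    (hmt : F.I m ≤ F.I t) (ht : F.I t ≤ RingHom.ker (q.x V).hom) {w : p.D} {w' : q.D}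
    (hw : Ideal.Quotient.mk _ w = h.1 (p.univ hF b V (0 ::ₘ m)))
    (hw' : Ideal.Quotient.mk _ w' = h.1 (q.univ hF b V (0 ::ₘ t))) :
    φ (p.ev (p.x V) (p.ρ w)) = q.ev (q.x V) (q.ρ w') := by
  have hη : q.η = φ.comp p.η := comp_eq_of_over (hφ V)
  have hmt' : F.I (0 ::ₘ m) ≤ F.I (0 ::ₘ t) := by
    rw [I_cons, I_cons]
    exact Ideal.mul_mono_right hmt
  have h1 := h.2 (p.univ hF b V (0 ::ₘ m)) (q.univ hF b V (0 ::ₘ t)) _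
    (p.univ_over_map hF b V hφ hη hmt')
  rw [← hw, ← hw'] at h1
  have h2 : Ideal.Quotient.mk (q.K (0 ::ₘ t)) (mapD φ hη w) =
      Ideal.Quotient.mk (q.K (0 ::ₘ t)) w' := (Ideal.quotientMap_mk).symm.trans h1
  have h3 := q.ρ_mem_K (Ideal.Quotient.eq.1 h2)
  have h4 := q.K_le_ker_ev ht h3
  rw [RingHom.mem_ker, _root_.map_sub, _root_.map_sub, sub_eq_zero, ρ_mapD,
    ev_mapD φ hη (hφ V)] at h4
  exact h4

lemma exists_eq_coordinate_mul (hF : F.IsTwoTorsion) (hb : V b = 1) {h : F.functions B}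
    (h0 : ∀ q : F.TestPt B, q.x V = 0 → h.1 q = 0) :
    ∃ g : F.functions B, h = F.coordinate V * g := by
  have key (p : F.TestPt B) : ∃ (s : Multiset (Character A)) (w : p.D),
      F.I s ≤ RingHom.ker (p.x V).hom ∧
        Ideal.Quotient.mk _ w = h.1 (p.univ hF b V (0 ::ₘ s)) := by
    obtain ⟨s, hs⟩ := (p.x V).cont
    obtain ⟨w, hw⟩ := Ideal.Quotient.mk_surjective (I := p.K (0 ::ₘ s))
      (h.1 (p.univ hF b V (0 ::ₘ s)))
    exact ⟨s, w, hs, hw⟩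
  choose s w hs hw using key
  -- The quotient is the divided difference of `h` on the universal deformation, evaluated at the
  -- parameter `x(V)`.
  refine ⟨⟨fun p => p.ev (p.x V) (p.ρ (w p)), fun p q φ hφ => ?_⟩,
    Subtype.ext (funext fun p => ?_)⟩
  · obtain ⟨m, hm₁, hm₂⟩ := F.directed_I (s p) (s q)
    obtain ⟨w', hw'⟩ := Ideal.Quotient.mk_surjective (I := p.K (0 ::ₘ m))
      (h.1 (p.univ hF b V (0 ::ₘ m)))
    -- The levels chosen at `p` and `q` are unrelated, so both are compared with the common
    -- refinement `m`, once along the identity of `p` and once along `φ`.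
    have h1 := p.φ_ev_ρ_lift hF (φ := RingHom.id _) (fun _ _ => rfl) hm₁ (hs p) hw' (hw p)
    have h2 := p.φ_ev_ρ_lift hF hφ hm₂ (hs q) hw' (hw q)
    exact (congrArg φ h1.symm).trans h2
  · have h1 := congrArg (p.ev (p.x V)) (p.y_mul_ρ (w p))
    have hs' : F.I (0 ::ₘ s p) ≤ RingHom.ker (p.x V).hom := by
      rw [I_cons]
      exact Ideal.mul_le_right.trans (hs p)
    rw [p.ev_zero_lift hF hb h0 (hw p), _root_.map_zero, sub_zero, p.ev_lift hF b V hs' (hw p),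
      _root_.map_mul, ev_inr] at h1
    exact h1.symm

end TestPt

end EquivariantFGL

/-! ### Generalities on global 2-torsion group laws -/

/-- The endomorphism `a ↦ a - V(a) b`; if `V(b) = 1` it is a projection onto the kernel of `V`. -/
def Character.projKer {B : Type} [AddCommGroup B] [Module (ZMod 2) B] (V : Character B) (b : B) :
    B →ₗ[ZMod 2] B :=
  LinearMap.id - V.smulRight b

lemma Character.projKer_apply {B : Type} [AddCommGroup B] [Module (ZMod 2) B] (V : Character B)
    (b a : B) : V.projKer b a = a - V a • b := rfl

lemma Character.exists_eq_one {B : Type} [AddCommGroup B] [Module (ZMod 2) B] {V : Character B}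
    (hV : V ≠ 0) : ∃ b, V b = 1 := by
  by_contra! h
  exact hV (LinearMap.ext fun b => (ZMod.eq_zero_or_one (V b)).resolve_right (h b))

namespace El₂Algebra

variable (X : El₂Algebra.{u}) {A B C : El₂}

/-- Restriction along a linear map. -/
def rs (α : B →ₗ[ZMod 2] A) : X.obj (op A) →+* X.obj (op B) :=
  X.res (A := A) (B := B) (FGModuleCat.ofHom α)

lemma rs_rs (α : B →ₗ[ZMod 2] A) (β : C →ₗ[ZMod 2] B) (x : X.obj (op A)) :
    X.rs β (X.rs α x) = X.rs (α ∘ₗ β) x := by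
  have h : (FGModuleCat.ofHom (α ∘ₗ β) : C ⟶ A) =
    (FGModuleCat.ofHom β : C ⟶ B) ≫ (FGModuleCat.ofHom α : B ⟶ A) := rfl
  change _ = (X.map (FGModuleCat.ofHom (α ∘ₗ β) : C ⟶ A).op).hom x
  rw [h, op_comp, X.map_comp]
  rfl

lemma rs_id (x : X.obj (op A)) : X.rs (LinearMap.id : A →ₗ[ZMod 2] A) x = x := by
  have h : (FGModuleCat.ofHom (LinearMap.id : A →ₗ[ZMod 2] A) : A ⟶ A) = 𝟙 A := rfl
  change (X.map (FGModuleCat.ofHom (LinearMap.id : A →ₗ[ZMod 2] A) : A ⟶ A).op).hom x = x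
  rw [h, op_id, X.map_id]
  rfl

lemma pullback_eq_rs (e : X.obj (op C₂)) (V : Character A) :
    X.pullback e V = X.rs (A := C₂) V e := rfl

lemma rs_pullback (e : X.obj (op C₂)) (V : Character A) (β : B →ₗ[ZMod 2] A) :
    X.rs β (X.pullback e V) = X.pullback e (V ∘ₗ β) :=
  X.rs_rs (A := C₂) V β e

lemma pullback_id (e : X.obj (op C₂)) :
    X.pullback (A := C₂) e (LinearMap.id : ZMod 2 →ₗ[ZMod 2] ZMod 2) = e :=
  X.rs_id (A := C₂) e

/-- The projection to the kernel of a character. -/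
def toKer (V : Character A) (b : A) (hb : V b = 1) :
    A →ₗ[ZMod 2] FGModuleCat.of (ZMod 2) (LinearMap.ker V) :=
  (V.projKer b).codRestrict (LinearMap.ker V) fun a => by
    simp [Character.projKer_apply, hb]

lemma toKer_comp (V : Character A) (b : A) (hb : V b = 1) :
    toKer V b hb ∘ₗ (LinearMap.ker V).subtype = LinearMap.id := by
  refine LinearMap.ext fun a => Subtype.ext ?_
  have h : V a.1 = 0 := a.2
  change V.projKer b a.1 = a.1
  rw [Character.projKer_apply, h, zero_smul, sub_zero]

variable {X}

lemma rs_projKer (V : Character A) (b : A) (hb : V b = 1) (x : X.obj (op A)) :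
    X.rs (V.projKer b) x = X.rs (toKer V b hb) (X.res (kerInclusion V) x) :=
  (X.rs_rs (B := FGModuleCat.of (ZMod 2) (LinearMap.ker V)) (LinearMap.ker V).subtype
    (toKer V b hb) x).symm

/-- A vector `b` with `V b = 1` splits the inclusion of `ker V`. So restriction to `ker V` is
surjective for free, and an element of its kernel is killed by the endomorphism `rs (V.projKer b)`.
Exactness thus becomes a statement inside `X(A)`. -/
lemma isCoordinate_of {e : X.obj (op C₂)}
    (hreg : ∀ (A : El₂) (V : Character A) (b : A), V b = 1 → ∀ x, X.pullback e V * x = 0 → x = 0)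
    (hzero : ∀ A : El₂, X.pullback e (0 : Character A) = 0)
    (hdiv : ∀ (A : El₂) (V : Character A) (b : A), V b = 1 → ∀ x,
      X.rs (V.projKer b) x = 0 → ∃ g, x = X.pullback e V * g) : X.IsCoordinate e := by
  intro A V hV
  obtain ⟨b, hb⟩ := Character.exists_eq_one hV
  refine ⟨fun x y hxy => ?_, fun x => ⟨fun hx => ?_, ?_⟩, fun x => ⟨X.rs (toKer V b hb) x, ?_⟩⟩
  · refine sub_eq_zero.1 (hreg A V b hb _ ?_)
    rw [mul_sub, sub_eq_zero]
    exact hxy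
  · obtain ⟨g, hg⟩ := hdiv A V b hb x (by rw [rs_projKer V b hb, hx, map_zero])
    exact ⟨g, hg.symm⟩
  · rintro ⟨g, rfl⟩
    have : X.res (kerInclusion V) (X.pullback e V) = 0 := by
      refine (X.rs_pullback (B := FGModuleCat.of (ZMod 2) (LinearMap.ker V)) e V
        (LinearMap.ker V).subtype).trans ?_
      convert hzero (FGModuleCat.of (ZMod 2) (LinearMap.ker V))
      ext a
      exact a.2
    change X.res (kerInclusion V) (X.pullback e V * g) = 0
    rw [map_mul, this, zero_mul]
  · refine (X.rs_rs (C := FGModuleCat.of (ZMod 2) (LinearMap.ker V)) (toKer V b hb)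
      (LinearMap.ker V).subtype x).trans ?_
    rw [toKer_comp]
    exact X.rs_id x

end El₂Algebra

namespace GlobalGroupLaw

variable (X : GlobalGroupLaw.{u}) {A B C : El₂}

/-- The Euler class of a character. -/
def euler (V : Character A) : X.X.obj (op A) := X.X.pullback X.e V

lemma rs_euler (V : Character A) (β : B →ₗ[ZMod 2] A) :
    X.X.rs β (X.euler V) = X.euler (V ∘ₗ β) := X.X.rs_pullback X.e V β

lemma euler_id : X.euler (A := C₂) (LinearMap.id : ZMod 2 →ₗ[ZMod 2] ZMod 2) = X.e :=
  X.X.pullback_id X.e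

lemma euler_mul_cancel {V : Character A} {b : A} (hb : V b = 1) {x y : X.X.obj (op A)}
    (h : X.euler V * x = X.euler V * y) : x = y :=
  (X.isCoordinate A V (by rintro rfl; simp at hb)).1 h

lemma exists_eq_euler_mul {V : Character A} {b : A} (hb : V b = 1) {x : X.X.obj (op A)}
    (h : X.X.rs (V.projKer b) x = 0) : ∃ g, x = X.euler V * g := by
  obtain ⟨-, h2, -⟩ := X.isCoordinate A V (by rintro rfl; simp at hb)
  have h3 : X.X.res (El₂Algebra.kerInclusion V) x =
      X.X.res (El₂Algebra.kerInclusion V) (X.X.rs (V.projKer b) x) := by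
    refine Eq.trans ?_ (X.X.rs_rs (C := FGModuleCat.of (ZMod 2) (LinearMap.ker V)) (V.projKer b)
      (LinearMap.ker V).subtype x).symm
    change X.X.rs (B := FGModuleCat.of (ZMod 2) (LinearMap.ker V)) (LinearMap.ker V).subtype x = _
    congr 1
    congr 1
    ext a
    have : V a.1 = 0 := a.2
    simp [Character.projKer_apply, this]
  rw [h, map_zero] at h3
  obtain ⟨g, hg⟩ := (h2 x).1 h3
  exact ⟨g, hg.symm⟩

/-- The zero character factors through the kernel of the identity of `C₂`, and `e = e * 1` restricts
to zero there by exactness. -/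
lemma euler_zero : X.euler (0 : Character A) = 0 := by
  obtain ⟨-, h2, -⟩ := X.isCoordinate C₂ (LinearMap.id : ZMod 2 →ₗ[ZMod 2] ZMod 2)
    (fun h => one_ne_zero (LinearMap.congr_fun h 1))
  have h3 := (h2 (X.e)).2 ⟨1, by
    change X.X.pullback X.e _ * 1 = _
    rw [mul_one, X.X.pullback_id]⟩
  have h4 : X.euler (0 : Character A) =
      X.X.rs (A := FGModuleCat.of (ZMod 2) (LinearMap.ker (LinearMap.id : ZMod 2 →ₗ[ZMod 2] ZMod 2)))
        (B := A) 0 (X.X.res (El₂Algebra.kerInclusion (A := C₂) LinearMap.id) X.e) := by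
    refine Eq.trans ?_ (X.X.rs_rs (A := C₂)
      (B := FGModuleCat.of (ZMod 2) (LinearMap.ker (LinearMap.id : ZMod 2 →ₗ[ZMod 2] ZMod 2)))
      (LinearMap.ker (LinearMap.id : ZMod 2 →ₗ[ZMod 2] ZMod 2)).subtype 0 X.e).symm
    rw [LinearMap.comp_zero]
    rfl
  rw [h4, h3, map_zero]

lemma projKer_comp_projKer {V : Character A} {b : A} (hb : V b = 1) :
    V.projKer b ∘ₗ V.projKer b = V.projKer b := by
  ext a
  simp [Character.projKer_apply, hb]

/-- The projection is idempotent, so the difference dies under it and is divisible. Subtracting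
makes division by an Euler class defined on every element, hence available as an operation in formal
expressions. -/
lemma exists_divDiff (V : Character A) (b : A) (hb : V b = 1) (x : X.X.obj (op A)) :
    ∃ g, X.euler V * g = x - X.X.rs (V.projKer b) x := by
  obtain ⟨g, hg⟩ := X.exists_eq_euler_mul hb (x := x - X.X.rs (V.projKer b) x) (by
    rw [map_sub, X.X.rs_rs, projKer_comp_projKer hb, sub_self])
  exact ⟨g, hg.symm⟩

end GlobalGroupLaw

/-- A morphism of global group laws in possibly different universes. -/
structure GlobalGroupLaw.LawHom (X : GlobalGroupLaw.{u}) (Y : GlobalGroupLaw.{v}) where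
  app : ∀ A : El₂, X.X.obj (op A) →+* Y.X.obj (op A)
  naturality : ∀ {A B : El₂} (α : B →ₗ[ZMod 2] A) (x : X.X.obj (op A)),
    app B (X.X.rs α x) = Y.X.rs α (app A x)
  app_e : app C₂ X.e = Y.e

lemma GlobalGroupLaw.LawHom.app_euler {X : GlobalGroupLaw.{u}} {Y : GlobalGroupLaw.{v}}
    (φ : X.LawHom Y) {A : El₂} (V : Character A) : φ.app A (X.euler V) = Y.euler V :=
  (φ.naturality (A := C₂) V X.e).trans (congrArg (Y.X.rs (A := C₂) V) φ.app_e)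

/-! ### The global group law of functions on a formal group law -/

namespace EquivariantFGL

variable {A : Type} [AddCommGroup A] [Module (ZMod 2) A] {k : Type u} [CommRing k]
variable (F : EquivariantFGL A k)

/-- The rings of functions on the schemes of homomorphisms to a formal group law. -/
def functionsAlgebra : El₂Algebra.{u + 1} where
  obj B := CommRingCat.of (F.functions B.unop)
  map f := CommRingCat.ofHom (F.functionsMap f.unop.hom.hom)
  map_id _ := rfl
  map_comp _ _ := rfl

/-- The global group law of functions on a 2-torsion formal group law. -/
def functionsLaw (hF : F.IsTwoTorsion) : GlobalGroupLaw.{u + 1} where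
  X := F.functionsAlgebra
  e := F.coordinate (B := ZMod 2) LinearMap.id
  isCoordinate := by
    refine El₂Algebra.isCoordinate_of (fun B V b hb x hx => ?_) (fun B => ?_)
      (fun B V b hb x hx => ?_)
    · exact TestPt.coordinate_mul_eq_zero hF hb hx
    · refine Subtype.ext (funext fun p => ?_)
      change (p.x 0).hom F.y = 0
      rw [_root_.map_zero, F.zero_y]
    · refine TestPt.exists_eq_coordinate_mul hF hb (h := x) fun q hq => ?_
      have h1 : x.1 (q.push (V.projKer b)) = 0 := congrFun (congrArg Subtype.val hx) q
      refine (x.2 (q.push (V.projKer b)) q (RingHom.id q.T) fun W a => ?_).symm.trans h1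
      change (q.x (W ∘ₗ V.projKer b)).hom a = _
      -- `W` and its composite with the projection differ by a multiple of `V`. When `x(V) = 0`, the
      -- test point therefore agrees with its push-forward along the projection, where `x` vanishes
      -- by assumption.
      have h2 : W ∘ₗ V.projKer b + (if W b = 0 then 0 else V) = W := by
        ext c
        rcases ZMod.eq_zero_or_one (W b) with h | h <;> simp [Character.projKer_apply, h]
      have h3 := congrArg q.x h2
      rw [_root_.map_add, apply_ite q.x, hq, _root_.map_zero, ite_self, add_zero] at h3
      rw [h3]

end EquivariantFGL

open GlobalGroupLaw

/-! ### The initial global 2-torsion group law -/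

/-- Formal expressions for elements of the values of a global group law at `(ℤ/2)ⁿ`. -/
inductive LawTerm : ℕ → Type
  | zero {n : ℕ} : LawTerm n
  | one {n : ℕ} : LawTerm n
  | add {n : ℕ} (s t : LawTerm n) : LawTerm n
  | neg {n : ℕ} (t : LawTerm n) : LawTerm n
  | mul {n : ℕ} (s t : LawTerm n) : LawTerm n
  | res {m n : ℕ} (α : (Fin m → ZMod 2) →ₗ[ZMod 2] (Fin n → ZMod 2)) (t : LawTerm n) : LawTerm m
  | euler {n : ℕ} (V : Character (Fin n → ZMod 2)) : LawTerm n
  | div {n : ℕ} (V : Character (Fin n → ZMod 2)) (b : Fin n → ZMod 2) (hb : V b = 1)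
      (t : LawTerm n) : LawTerm n

/-- The group `(ℤ/2)ⁿ`. -/
abbrev El₂.cube (n : ℕ) : El₂ := FGModuleCat.of (ZMod 2) (Fin n → ZMod 2)

/-- The value of an expression in a global group law. -/
def LawTerm.eval (Y : GlobalGroupLaw.{u}) : ∀ {n : ℕ}, LawTerm n → Y.X.obj (op (El₂.cube n))
  | _, .zero => 0
  | _, .one => 1
  | _, .add s t => s.eval Y + t.eval Y
  | _, .neg t => -t.eval Y
  | _, .mul s t => s.eval Y * t.eval Y
  | _, .res (m := m) (n := n) α t => Y.X.rs (A := El₂.cube n) (B := El₂.cube m) α (t.eval Y)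
  | n, .euler V => Y.euler (A := El₂.cube n) V
  -- The choice is harmless: multiplication by the Euler class is injective, so the quotient is
  -- unique.
  | n, .div V b hb t => (Y.exists_divDiff (A := El₂.cube n) V b hb (t.eval Y)).choose

namespace El₂

/-- Coordinates on an elementary abelian 2-group. -/
def coords (A : El₂) : A ≃ₗ[ZMod 2] (Fin (Module.finrank (ZMod 2) A) → ZMod 2) :=
  (Module.finBasis (ZMod 2) A).equivFun

/-- The cube isomorphic to `A`. -/
abbrev dcube (A : El₂) : El₂ := cube (Module.finrank (ZMod 2) A)

/-- The coordinates as a linear map. -/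
def toCube (A : El₂) : A →ₗ[ZMod 2] A.dcube := (coords A).toLinearMap

/-- The inverse of the coordinates. -/
def ofCube (A : El₂) : A.dcube →ₗ[ZMod 2] A := (coords A).symm.toLinearMap

lemma ofCube_toCube (A : El₂) : A.ofCube ∘ₗ A.toCube = LinearMap.id :=
  LinearMap.ext fun x => (coords A).symm_apply_apply x

end El₂

namespace InitialLaw

/-- The ring of those families of elements of the values at `A` of all global group laws that are
given by an expression. -/
def definable (A : El₂) : Subring (∀ Y : GlobalGroupLaw.{v}, Y.X.obj (op A)) where
  carrier := {f | ∃ t : LawTerm (Module.finrank (ZMod 2) A),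
    ∀ Y, f Y = Y.X.rs A.toCube (t.eval Y)}
  mul_mem' := by
    rintro _ _ ⟨s, hs⟩ ⟨t, ht⟩
    exact ⟨.mul s t, fun Y => by rw [Pi.mul_apply, hs, ht, LawTerm.eval, map_mul]⟩
  one_mem' := ⟨.one, fun Y => by rw [Pi.one_apply, LawTerm.eval, map_one]⟩
  add_mem' := by
    rintro _ _ ⟨s, hs⟩ ⟨t, ht⟩
    exact ⟨.add s t, fun Y => by rw [Pi.add_apply, hs, ht, LawTerm.eval, map_add]⟩
  zero_mem' := ⟨.zero, fun Y => by rw [Pi.zero_apply, LawTerm.eval, map_zero]⟩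
  neg_mem' := by
    rintro _ ⟨t, ht⟩
    exact ⟨.neg t, fun Y => by rw [Pi.neg_apply, ht, LawTerm.eval, map_neg]⟩

variable {A B : El₂}

lemma rs_mem_definable {f : ∀ Y : GlobalGroupLaw.{v}, Y.X.obj (op A)} (hf : f ∈ definable A)
    (α : B →ₗ[ZMod 2] A) : (fun Y => Y.X.rs α (f Y)) ∈ definable B := by
  obtain ⟨t, ht⟩ := hf
  refine ⟨.res (A.toCube ∘ₗ α ∘ₗ B.ofCube) t, fun Y => ?_⟩
  beta_reduce
  rw [ht, LawTerm.eval, Y.X.rs_rs, Y.X.rs_rs, LinearMap.comp_assoc, LinearMap.comp_assoc,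
    El₂.ofCube_toCube, LinearMap.comp_id]

lemma eval_mem_definable {n : ℕ} (t : LawTerm n) :
    (fun Y : GlobalGroupLaw.{v} => t.eval Y) ∈ definable (El₂.cube n) := by
  refine ⟨.res (El₂.cube n).ofCube t, fun Y => ?_⟩
  rw [LawTerm.eval, Y.X.rs_rs, El₂.ofCube_toCube, Y.X.rs_id]

lemma euler_mem_definable (V : Character A) :
    (fun Y : GlobalGroupLaw.{v} => Y.euler V) ∈ definable A := by
  refine ⟨.euler (V ∘ₗ A.ofCube), fun Y => ?_⟩
  rw [LawTerm.eval, Y.rs_euler, LinearMap.comp_assoc, El₂.ofCube_toCube, LinearMap.comp_id]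

/-- Coordinates carry `V` and `b` to a character and a vector of the cube and intertwine the two
projections, so the division formed in the cube can be restricted back to `A`. -/
lemma div_mem_definable {f : ∀ Y : GlobalGroupLaw.{v}, Y.X.obj (op A)} (hf : f ∈ definable A)
    {V : Character A} {b : A} (hb : V b = 1) :
    ∃ g ∈ definable A, ∀ Y, Y.euler V * g Y = f Y - Y.X.rs (V.projKer b) (f Y) := by
  obtain ⟨t, ht⟩ := hf
  have hb' : (V ∘ₗ A.ofCube) (A.toCube b) = 1 := by
    rw [← LinearMap.comp_apply, LinearMap.comp_assoc, El₂.ofCube_toCube, LinearMap.comp_id, hb]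
  have hproj : Character.projKer (V ∘ₗ A.ofCube) (A.toCube b) ∘ₗ A.toCube =
      A.toCube ∘ₗ V.projKer b := by
    ext a : 1
    have h : A.ofCube (A.toCube a) = a := LinearMap.congr_fun A.ofCube_toCube a
    simp [Character.projKer_apply, h]
  refine ⟨_, ⟨.div (V ∘ₗ A.ofCube) (A.toCube b) hb' t, fun Y => rfl⟩, fun Y => ?_⟩
  have h := congrArg (Y.X.rs A.toCube)
    (Y.exists_divDiff (A := A.dcube) (V ∘ₗ A.ofCube) (A.toCube b) hb' (t.eval Y)).choose_spec
  rw [map_mul, Y.rs_euler, LinearMap.comp_assoc, El₂.ofCube_toCube, LinearMap.comp_id, map_sub,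
    Y.X.rs_rs, hproj, ← Y.X.rs_rs, ← ht] at h
  exact h

/-- The families range over all laws of a universe and so form a large type, but each is named by an
expression, and the expressions form a type in the lowest universe. -/
instance small_definable (A : El₂) : Small.{u} (definable.{v} A) := by
  let f : LawTerm (Module.finrank (ZMod 2) A) → definable.{v} A := fun t =>
    ⟨fun Y => Y.X.rs A.toCube (t.eval Y), t, fun _ => rfl⟩
  refine small_of_surjective (f := f) ?_
  rintro ⟨g, t, ht⟩
  exact ⟨t, Subtype.ext (funext fun Y => (ht Y).symm)⟩

/-- Restriction of definable families. -/
def definableMap (α : B →ₗ[ZMod 2] A) : definable.{v} A →+* definable.{v} B where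
  toFun f := ⟨fun Y => Y.X.rs α (f.1 Y), rs_mem_definable f.2 α⟩
  map_one' := Subtype.ext (funext fun Y => map_one (Y.X.rs α))
  map_mul' f g := Subtype.ext (funext fun Y => map_mul (Y.X.rs α) (f.1 Y) (g.1 Y))
  map_zero' := Subtype.ext (funext fun Y => map_zero (Y.X.rs α))
  map_add' f g := Subtype.ext (funext fun Y => map_add (Y.X.rs α) (f.1 Y) (g.1 Y))

/-- Small models of the rings of definable families. -/
abbrev Ob (A : El₂) : Type u := Shrink.{u} (definable.{v} A)

/-- The value of a definable family at a global group law. -/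
def evalAt (A : El₂) (Y : GlobalGroupLaw.{v}) : Ob.{u, v} A →+* Y.X.obj (op A) :=
  ((Pi.evalRingHom (fun Y : GlobalGroupLaw.{v} => (Y.X.obj (op A) : Type v)) Y).comp
    (definable A).subtype).comp (Shrink.ringEquiv (definable.{v} A)).toRingHom

lemma ob_ext {x y : Ob.{u, v} A} (h : ∀ Y, evalAt A Y x = evalAt A Y y) : x = y :=
  (Shrink.ringEquiv (definable.{v} A)).injective (Subtype.ext (funext h))

lemma exists_evalAt {f : ∀ Y : GlobalGroupLaw.{v}, Y.X.obj (op A)} (hf : f ∈ definable A) :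
    ∃ x : Ob.{u, v} A, ∀ Y, evalAt A Y x = f Y := by
  refine ⟨(Shrink.ringEquiv (definable.{v} A)).symm ⟨f, hf⟩, fun Y => ?_⟩
  change ((Shrink.ringEquiv (definable.{v} A)) ((Shrink.ringEquiv (definable.{v} A)).symm _)).1 Y = _
  rw [RingEquiv.apply_symm_apply]

lemma evalAt_mem_definable (x : Ob.{u, v} A) :
    (fun Y : GlobalGroupLaw.{v} => evalAt A Y x) ∈ definable A :=
  ((Shrink.ringEquiv (definable.{v} A)) x).2

/-- Restriction maps of the initial law. -/
def obMap (α : B →ₗ[ZMod 2] A) : Ob.{u, v} A →+* Ob.{u, v} B :=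
  ((Shrink.ringEquiv (definable.{v} B)).symm.toRingHom.comp (definableMap α)).comp
    (Shrink.ringEquiv (definable.{v} A)).toRingHom

lemma evalAt_obMap (α : B →ₗ[ZMod 2] A) (x : Ob.{u, v} A) (Y : GlobalGroupLaw.{v}) :
    evalAt B Y (obMap α x) = Y.X.rs α (evalAt A Y x) := by
  change ((Shrink.ringEquiv (definable.{v} B)) ((Shrink.ringEquiv (definable.{v} B)).symm _)).1 Y = _
  rw [RingEquiv.apply_symm_apply]
  rfl

/-- The functor underlying the initial law. -/
def lawAlgebra : El₂Algebra.{u} where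
  obj A := CommRingCat.of (Ob.{u, v} A.unop)
  map f := CommRingCat.ofHom (obMap f.unop.hom.hom)
  map_id _ := CommRingCat.hom_ext <| RingHom.ext fun _ =>
    ob_ext fun Y => (evalAt_obMap _ _ Y).trans (Y.X.rs_id _)
  map_comp _ _ := CommRingCat.hom_ext <| RingHom.ext fun _ =>
    ob_ext fun Y => ((evalAt_obMap _ _ Y).trans (((Y.X.rs_rs _ _ _).symm.trans
      (congrArg _ (evalAt_obMap _ _ Y).symm)).trans (evalAt_obMap _ _ Y).symm))

/-- The value of an element of the initial law in a global group law. -/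
def val (A : El₂) (Y : GlobalGroupLaw.{v}) : lawAlgebra.{u, v}.obj (op A) →+* Y.X.obj (op A) :=
  evalAt A Y

lemma val_ext {x y : lawAlgebra.{u, v}.obj (op A)} (h : ∀ Y, val A Y x = val A Y y) : x = y :=
  ob_ext h

lemma exists_val {f : ∀ Y : GlobalGroupLaw.{v}, Y.X.obj (op A)} (hf : f ∈ definable A) :
    ∃ x : lawAlgebra.{u, v}.obj (op A), ∀ Y, val A Y x = f Y := exists_evalAt hf

lemma val_mem_definable (x : lawAlgebra.{u, v}.obj (op A)) :
    (fun Y : GlobalGroupLaw.{v} => val A Y x) ∈ definable A := evalAt_mem_definable x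

lemma val_rs (α : B →ₗ[ZMod 2] A) (x : lawAlgebra.{u, v}.obj (op A)) (Y : GlobalGroupLaw.{v}) :
    val B Y (lawAlgebra.rs α x) = Y.X.rs α (val A Y x) := evalAt_obMap α x Y

/-- The coordinate of the initial law. -/
def coord : lawAlgebra.{u, v}.obj (op C₂) :=
  (exists_val.{u, v} (euler_mem_definable (A := C₂) LinearMap.id)).choose

lemma val_coord (Y : GlobalGroupLaw.{v}) : val C₂ Y coord.{u, v} = Y.e :=
  ((exists_val.{u, v} (euler_mem_definable (A := C₂) LinearMap.id)).choose_spec Y).trans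
    Y.euler_id

lemma val_pullback (V : Character A) (Y : GlobalGroupLaw.{v}) :
    val A Y (lawAlgebra.{u, v}.pullback coord V) = Y.euler V :=
  (val_rs (A := C₂) V _ Y).trans (congrArg (Y.X.rs (A := C₂) V) (val_coord Y))

lemma exists_div {V : Character A} {b : A} (hb : V b = 1) (x : lawAlgebra.{u, v}.obj (op A)) :
    ∃ g, lawAlgebra.{u, v}.pullback coord V * g = x - lawAlgebra.rs (V.projKer b) x := by
  obtain ⟨g, hg, h⟩ := div_mem_definable (val_mem_definable x) hb
  obtain ⟨z, hz⟩ := exists_val.{u, v} hg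
  refine ⟨z, val_ext fun Y => ?_⟩
  have h1 := h Y
  rw [← hz, ← val_pullback, ← map_mul] at h1
  rw [h1, map_sub, val_rs]

end InitialLaw

open InitialLaw in
/-- The initial global 2-torsion group law. -/
def initialLaw : GlobalGroupLaw.{u} where
  X := lawAlgebra.{u, v}
  e := coord
  isCoordinate := by
    refine El₂Algebra.isCoordinate_of (fun A V b hb x hx => val_ext fun Y => ?_)
      (fun A => val_ext fun Y => ?_) (fun A V b hb x hx => ?_)
    · refine Y.euler_mul_cancel hb ?_
      rw [map_zero, mul_zero, ← val_pullback, ← map_mul]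
      exact (congrArg (val A Y) hx).trans (map_zero _)
    · rw [val_pullback, Y.euler_zero, map_zero]
    · obtain ⟨g, hg⟩ := exists_div hb x
      rw [hx, sub_zero] at hg
      exact ⟨g, hg.symm⟩

/-! ### Universal property of the initial law -/

namespace InitialLaw

/-- The morphism from the initial law. -/
def toLaw (Y : GlobalGroupLaw.{v}) : initialLaw.{u, v}.LawHom Y where
  app A := val A Y
  naturality α x := val_rs α x Y
  app_e := val_coord Y

lemma law_ext {x y : initialLaw.{u, v}.X.obj (op A)}
    (h : ∀ Y, (toLaw Y).app A x = (toLaw Y).app A y) : x = y := val_ext h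

lemma exists_law {f : ∀ Y : GlobalGroupLaw.{v}, Y.X.obj (op A)} (hf : f ∈ definable A) :
    ∃ x : initialLaw.{u, v}.X.obj (op A), ∀ Y, (toLaw Y).app A x = f Y := exists_val hf

lemma law_mem_definable (x : initialLaw.{u, v}.X.obj (op A)) :
    (fun Y : GlobalGroupLaw.{v} => (toLaw Y).app A x) ∈ definable A := val_mem_definable x

/-- Induction on an expression for the element. Morphisms preserve ring operations, restrictions and
Euler classes; a quotient by an Euler class is preserved because that class can be cancelled in `Y`.
The universe of `Y` plays no role, which later permits comparison of maps into laws of functions. -/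
lemma hom_ext {Y : GlobalGroupLaw.{w}} (φ ψ : initialLaw.{u, v}.LawHom Y) (A : El₂) :
    φ.app A = ψ.app A := by
  have key (n : ℕ) (t : LawTerm n) : ∀ x : initialLaw.{u, v}.X.obj (op (El₂.cube n)),
      (∀ Z, (toLaw Z).app _ x = t.eval Z) → φ.app _ x = ψ.app _ x := by
    induction t with
    | zero =>
      intro x hx
      have : x = 0 := law_ext fun Z => (hx Z).trans (map_zero _).symm
      rw [this, map_zero, map_zero]
    | one =>
      intro x hx
      have : x = 1 := law_ext fun Z => (hx Z).trans (map_one _).symm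
      rw [this, map_one, map_one]
    | add s t hs ht =>
      intro x hx
      obtain ⟨a, ha⟩ := exists_law.{u} (eval_mem_definable.{v} s)
      obtain ⟨b, hb⟩ := exists_law.{u} (eval_mem_definable.{v} t)
      have : x = a + b := law_ext fun Z => (hx Z).trans (by rw [map_add, ha, hb, LawTerm.eval])
      rw [this, map_add, map_add, hs a ha, ht b hb]
    | neg t ht =>
      intro x hx
      obtain ⟨b, hb⟩ := exists_law.{u} (eval_mem_definable.{v} t)
      have : x = -b := law_ext fun Z => (hx Z).trans (by rw [map_neg, hb, LawTerm.eval])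
      rw [this, map_neg, map_neg, ht b hb]
    | mul s t hs ht =>
      intro x hx
      obtain ⟨a, ha⟩ := exists_law.{u} (eval_mem_definable.{v} s)
      obtain ⟨b, hb⟩ := exists_law.{u} (eval_mem_definable.{v} t)
      have : x = a * b := law_ext fun Z => (hx Z).trans (by rw [map_mul, ha, hb, LawTerm.eval])
      rw [this, map_mul, map_mul, hs a ha, ht b hb]
    | @res m n α t ht =>
      intro x hx
      obtain ⟨a, ha⟩ := exists_law.{u} (eval_mem_definable.{v} t)
      have : x = initialLaw.{u, v}.X.rs (A := El₂.cube n) (B := El₂.cube m) α a :=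
        law_ext fun Z => (hx Z).trans (by rw [LawHom.naturality, ha, LawTerm.eval])
      rw [this, φ.naturality, ψ.naturality, ht a ha]
    | @euler n V =>
      intro x hx
      have : x = initialLaw.{u, v}.euler (A := El₂.cube n) V :=
        law_ext fun Z => (hx Z).trans (by rw [LawHom.app_euler, LawTerm.eval])
      rw [this, φ.app_euler, ψ.app_euler]
    | @div n V b hb t ht =>
      intro x hx
      obtain ⟨a, ha⟩ := exists_law.{u} (eval_mem_definable.{v} t)
      -- The defining equation of a quotient holds in the initial law because it holds in every law
      -- `Z`; it can then be transported along `φ` and `ψ`.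
      have h : initialLaw.{u, v}.euler (A := El₂.cube n) V * x =
          a - initialLaw.{u, v}.X.rs (A := El₂.cube n) (B := El₂.cube n) (V.projKer b) a := by
        refine law_ext fun Z => ?_
        rw [map_mul, map_sub, LawHom.naturality, LawHom.app_euler, hx, ha]
        exact (Z.exists_divDiff (A := El₂.cube n) V b hb (t.eval Z)).choose_spec
      refine Y.euler_mul_cancel (A := El₂.cube n) hb ?_
      have h2 := congrArg (φ.app _) h
      have h3 := congrArg (ψ.app _) h
      rw [map_mul, map_sub, φ.app_euler, φ.naturality] at h2
      rw [map_mul, map_sub, ψ.app_euler, ψ.naturality] at h3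
      rw [h2, h3, ht a ha]
  ext x
  obtain ⟨t, ht⟩ := law_mem_definable.{u, v} x
  obtain ⟨z, hz⟩ := exists_law.{u} (eval_mem_definable.{v} t)
  have : x = initialLaw.{u, v}.X.rs (A := A.dcube) A.toCube z :=
    law_ext fun Z => (ht Z).trans (by rw [LawHom.naturality, hz])
  rw [this, φ.naturality, ψ.naturality, key _ t z hz]

end InitialLaw

/-! ### Change of universe -/

/-- A functor from elementary abelian 2-groups to rings in a larger universe. -/
def El₂Algebra.ulift (X : El₂Algebra.{u}) : El₂Algebra.{max u v} where
  obj A := CommRingCat.of (ULift.{v} (X.obj A))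
  map f := CommRingCat.ofHom ((ULift.ringEquiv.symm.toRingHom.comp (X.map f).hom).comp
    ULift.ringEquiv.toRingHom)
  map_id A := CommRingCat.hom_ext <| RingHom.ext fun x =>
    congrArg ULift.up (RingHom.congr_fun (congrArg CommRingCat.Hom.hom (X.map_id A)) x.down)
  map_comp f g := CommRingCat.hom_ext <| RingHom.ext fun x =>
    congrArg ULift.up (RingHom.congr_fun (congrArg CommRingCat.Hom.hom (X.map_comp f g)) x.down)

/-- The comparison of a functor with its lift to a larger universe. -/
def El₂Algebra.down (X : El₂Algebra.{u}) (A : El₂) :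
    (El₂Algebra.ulift.{u, v} X).obj (op A) ≃+* X.obj (op A) := ULift.ringEquiv

lemma El₂Algebra.down_rs (X : El₂Algebra.{u}) {A B : El₂} (α : B →ₗ[ZMod 2] A)
    (x : (El₂Algebra.ulift.{u, v} X).obj (op A)) :
    X.down B ((El₂Algebra.ulift.{u, v} X).rs α x) = X.rs α (X.down A x) := rfl

/-- A global group law in a larger universe. -/
def GlobalGroupLaw.ulift (Y : GlobalGroupLaw.{u}) : GlobalGroupLaw.{max u v} where
  X := El₂Algebra.ulift.{u, v} Y.X
  e := (Y.X.down C₂).symm Y.e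
  isCoordinate := by
    have h (A : El₂) (V : Character A) : Y.X.down A ((El₂Algebra.ulift.{u, v} Y.X).pullback
        ((Y.X.down C₂).symm Y.e) V) = Y.euler V := by
      rw [El₂Algebra.pullback_eq_rs, El₂Algebra.down_rs, RingEquiv.apply_symm_apply]
      rfl
    refine El₂Algebra.isCoordinate_of (fun A V b hb x hx => ?_) (fun A => ?_)
      (fun A V b hb x hx => ?_)
    · refine (Y.X.down A).injective (Y.euler_mul_cancel hb ?_)
      rw [map_zero, mul_zero, ← h, ← map_mul, hx, map_zero]
    · refine (Y.X.down A).injective ?_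
      rw [h, Y.euler_zero, map_zero]
    · obtain ⟨g, hg⟩ := Y.exists_eq_euler_mul hb (x := Y.X.down A x) (by
        rw [← El₂Algebra.down_rs, hx, map_zero])
      refine ⟨(Y.X.down A).symm g, (Y.X.down A).injective ?_⟩
      rw [map_mul, h, RingEquiv.apply_symm_apply, hg]

/-- The comparison of a global group law with its lift to a larger universe. -/
def GlobalGroupLaw.down (Y : GlobalGroupLaw.{u}) : (GlobalGroupLaw.ulift.{u, v} Y).LawHom Y where
  app A := (Y.X.down A).toRingHom
  naturality α x := Y.X.down_rs α x
  app_e := (El₂Algebra.down.{u, v} Y.X C₂).apply_symm_apply Y.e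

/-- The composite of morphisms of global group laws. -/
def GlobalGroupLaw.LawHom.comp {X : GlobalGroupLaw.{u}} {Y : GlobalGroupLaw.{v}}
    {Z : GlobalGroupLaw.{w}} (ψ : Y.LawHom Z) (φ : X.LawHom Y) : X.LawHom Z where
  app A := (ψ.app A).comp (φ.app A)
  naturality α x := by
    rw [RingHom.comp_apply, φ.naturality, ψ.naturality, RingHom.comp_apply]
  app_e := by rw [RingHom.comp_apply, φ.app_e, ψ.app_e]

/-- The morphism from the initial law to a global group law in a smaller universe. -/
def InitialLaw.toSmallLaw (Y : GlobalGroupLaw.{u}) : initialLaw.{u, max u v}.LawHom Y :=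
  (GlobalGroupLaw.down.{u, v} Y).comp
    (InitialLaw.toLaw.{u, max u v} (GlobalGroupLaw.ulift.{u, v} Y))

/-- The morphism of global group laws underlying a natural transformation. -/
def GlobalGroupLaw.LawHom.ofNatTrans {X Y : GlobalGroupLaw.{u}} (ψ : X.X ⟶ Y.X)
    (h : (ψ.app (op C₂)).hom X.e = Y.e) : X.LawHom Y where
  app A := (ψ.app (op A)).hom
  naturality {A B} α x :=
    congrArg (fun f => f.hom x) (ψ.naturality (FGModuleCat.ofHom α : B ⟶ A).op)
  app_e := h

/-- The natural transformation underlying a morphism of global group laws. -/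
def GlobalGroupLaw.LawHom.toNatTrans {X Y : GlobalGroupLaw.{u}} (φ : X.LawHom Y) : X.X ⟶ Y.X where
  app A := CommRingCat.ofHom (φ.app A.unop)
  naturality _ _ f := CommRingCat.hom_ext <| RingHom.ext fun x =>
    φ.naturality f.unop.hom.hom x

/-- Elements of this law are families over laws in universe `u + 1`. That covers the laws in
universe `u` after lifting, and also the laws of functions on formal group laws in universe `u`. -/
lemma initialLaw_isInitial : initialLaw.{u, u + 1}.IsInitial := fun Y =>
  ⟨(InitialLaw.toSmallLaw.{u, u + 1} Y).toNatTrans, (InitialLaw.toSmallLaw.{u, u + 1} Y).app_e,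
    fun ψ hψ => NatTrans.ext <| funext fun A => CommRingCat.hom_ext <|
      InitialLaw.hom_ext (.ofNatTrans ψ hψ) (InitialLaw.toSmallLaw.{u, u + 1} Y) A.unop⟩

/-! ### The action of morphisms of formal group laws on points -/

namespace EquivariantFGL

variable {A B C : Type} [AddCommGroup A] [Module (ZMod 2) A] [AddCommGroup B] [Module (ZMod 2) B]
  [AddCommGroup C] [Module (ZMod 2) C]
variable {k k' k'' : Type u} [CommRing k] [CommRing k'] [CommRing k'']

section Hom

variable {T : Type u} [CommRing T] {η : k' →+* T}
variable {α : B →ₗ[ZMod 2] A} {f : k →+* k'} {G : EquivariantFGL A k'} {F : EquivariantFGL B k}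

/-- The image of a point under a morphism. -/
@[simps]
def PreHom.pull (g : PreHom α f F G) (p : G.Pt η) : F.Pt (η.comp f) where
  hom := p.hom.comp g.φ
  hom_algebraMap c := by
    rw [RingHom.comp_apply, g.map_algebraMap, p.hom_algebraMap, RingHom.comp_apply]
  cont := by
    obtain ⟨s, hs⟩ := p.cont
    exact ⟨_, fun a ha => hs (g.I_le_comap s ha)⟩

lemma PreHom.hat_hat (g : PreHom α f F G) (p q : G.Pt η) (x : F.Tensor₂) :
    p.hat q (g.hat x) = (g.pull p).hat (g.pull q) x := by
  unfold PreHom.hat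
  exact Pt.comp_completedLift _ _ _ (Pt.isContOut_hat p q) (g.pull p) (g.pull q)
    (fun a => Pt.hat_inc₁₂ p q _) (fun a => Pt.hat_inc₂₂ p q _) x

/-- The image of points under a morphism, as a homomorphism of groups. -/
@[simps]
def HomOver.pull (g : HomOver α f F G) (η : k' →+* T) : G.Pt η →+ F.Pt (η.comp f) where
  toFun p := g.toPreHom.pull p
  map_zero' := Pt.ext <| RingHom.ext fun x => by
    change η (G.θ 0 (g.φ x)) = η (f (F.θ 0 x))
    rw [g.map_θ, LinearMap.zero_comp]
  map_add' p q := Pt.ext <| RingHom.ext fun x => by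
    change p.hat q (G.Δ (g.φ x)) = _
    rw [g.map_Δ, PreHom.hat_hat]
    rfl

variable (F) in
/-- The identity morphism. -/
def HomOver.id : HomOver (LinearMap.id : B →ₗ[ZMod 2] B) (RingHom.id k) F F where
  φ := RingHom.id _
  map_algebraMap _ := rfl
  map_θ _ _ := rfl
  map_y := rfl
  map_Δ x := F.tensor₂_ext fun T _ η p q => by
    rw [PreHom.hat_hat]
    exact RingHom.congr_fun (Pt.eq_hat (Pt.isContOut_hat p q) (η := η.comp (RingHom.id k))
      _ _ (Pt.hat_inc₁₂ p q) (Pt.hat_inc₂₂ p q)) _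

/-- The composite of morphisms. -/
def HomOver.comp {H : EquivariantFGL C k''} {β : A →ₗ[ZMod 2] C} {γ : B →ₗ[ZMod 2] C}
    {f' : k' →+* k''} (g' : HomOver β f' G H) (g : HomOver α f F G) (hγ : β ∘ₗ α = γ) :
    HomOver γ (f'.comp f) F H where
  φ := g'.φ.comp g.φ
  map_algebraMap c := by
    rw [RingHom.comp_apply, g.map_algebraMap, g'.map_algebraMap, RingHom.comp_apply]
  map_θ V x := by
    rw [RingHom.comp_apply, g'.map_θ, g.map_θ, ← hγ, LinearMap.comp_assoc, RingHom.comp_apply]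
  map_y := by rw [RingHom.comp_apply, g.map_y, g'.map_y]
  map_Δ x := H.tensor₂_ext fun T _ η p q => by
    rw [PreHom.hat_hat, RingHom.comp_apply, g'.map_Δ, g.map_Δ, PreHom.hat_hat, PreHom.hat_hat]
    rfl

/-- The action of a morphism on functions. -/
def HomOver.functionsMap (g : HomOver α f F G) (C : Type) [AddCommGroup C] [Module (ZMod 2) C] :
    F.functions C →+* G.functions C where
  toFun h := ⟨fun p => h.1 ⟨p.T, p.η.comp f, (g.pull p.η).comp p.x⟩, fun p q φ hφ =>
    h.2 ⟨p.T, p.η.comp f, (g.pull p.η).comp p.x⟩ ⟨q.T, q.η.comp f, (g.pull q.η).comp q.x⟩ φ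
      fun W a => hφ W (g.φ a)⟩
  map_one' := rfl
  map_mul' _ _ := rfl
  map_zero' := rfl
  map_add' _ _ := rfl

/-- The action of a morphism on the global group laws of functions. -/
def HomOver.lawHom (g : HomOver α f F G) (hF : F.IsTwoTorsion) (hG : G.IsTwoTorsion) :
    (F.functionsLaw hF).LawHom (G.functionsLaw hG) where
  app C := g.functionsMap C
  naturality _ _ := rfl
  app_e := Subtype.ext <| funext fun p => congrArg (p.x LinearMap.id).hom g.map_y

end Hom

end EquivariantFGL

/-! ### The classifying homomorphism of a formal group law -/

/-- The initial global group law. -/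
abbrev lazard : GlobalGroupLaw.{u} := initialLaw.{u, u + 1}

/-- The values of the initial global group law. -/
abbrev Laz (A : El₂) : Type u := lazard.{u}.X.obj (op A)

namespace EquivariantFGL

section evalPt

variable {A A' : Type} [AddCommGroup A] [Module (ZMod 2) A] [AddCommGroup A'] [Module (ZMod 2) A']
  {k k' : Type u} [CommRing k] [CommRing k']
  {F : EquivariantFGL A k} (hF : F.IsTwoTorsion) {G : EquivariantFGL A' k'} (hG : G.IsTwoTorsion)
  {B C : El₂}
variable {T T' : Type u} [CommRing T] [CommRing T'] {η' : k →+* T'} {η : k →+* T}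

/-- The functions defined by elements of the initial global group law, evaluated at a homomorphism
to the points of a formal group law. -/
def evalPt (x : Character B →+ F.Pt η) : Laz.{u} B →+* T :=
  ((Pi.evalRingHom (fun p : F.TestPt B => p.T) ⟨T, η, x⟩).comp (F.functions B).subtype).comp
    ((InitialLaw.toLaw (F.functionsLaw hF)).app B)

lemma evalPt_over {φ : T →+* T'} {x : Character B →+ F.Pt η} {x' : Character B →+ F.Pt η'}
    (h : ∀ W a, φ ((x W).hom a) = (x' W).hom a) (z : Laz.{u} B) :
    φ (evalPt hF x z) = evalPt hF x' z :=
  Subtype.prop (p := (· ∈ F.functions B)) ((InitialLaw.toLaw (F.functionsLaw hF)).app B z)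
    ⟨T, η, x⟩ ⟨T', η', x'⟩ φ h

lemma evalPt_rs (x : Character B →+ F.Pt η) (β : B →ₗ[ZMod 2] C) (z : Laz.{u} C) :
    evalPt hF x (lazard.X.rs β z) = evalPt hF (x.comp (Character.comap β)) z :=
  congrFun (congrArg (Subtype.val (p := (· ∈ F.functions B)))
    ((InitialLaw.toLaw (F.functionsLaw hF)).naturality β z)) ⟨T, η, x⟩

lemma evalPt_euler (x : Character B →+ F.Pt η) (V : Character B) :
    evalPt hF x (lazard.euler V) = (x V).hom F.y :=
  congrFun (congrArg (Subtype.val (p := (· ∈ F.functions B)))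
    ((InitialLaw.toLaw (F.functionsLaw hF)).app_euler V)) ⟨T, η, x⟩

/-- Both sides come from morphisms of the initial law into the functions on `G`, one of them passing
through the functions on `F`; such morphisms are unique. -/
lemma evalPt_pull {α : A →ₗ[ZMod 2] A'} {f : k →+* k'} (g : HomOver α f F G) {η : k' →+* T}
    (x : Character B →+ G.Pt η) (z : Laz.{u} B) :
    evalPt hF ((g.pull η).comp x) z = evalPt hG x z :=
  congrFun (congrArg (Subtype.val (p := (· ∈ G.functions B)))
    (RingHom.congr_fun (InitialLaw.hom_ext
      ((g.lawHom hF hG).comp (InitialLaw.toLaw (F.functionsLaw hF)))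
      (InitialLaw.toLaw (G.functionsLaw hG)) B) z)) ⟨T, η, x⟩

end evalPt

section classify

variable {A B : El₂} {k k' : Type u} [CommRing k] [CommRing k']
variable {F : EquivariantFGL A k} (hF : F.IsTwoTorsion)
variable {G : EquivariantFGL B k'} (hG : G.IsTwoTorsion)

/-- The homomorphism from the value at `A` of the initial global group law to the ground ring of
a 2-torsion `A`-equivariant formal group law. -/
def classify : Laz.{u} A →+* k := evalPt hF (F.θPt (RingHom.id k))

lemma classify_euler (V : Character A) : classify hF (lazard.euler V) = F.euler V :=
  evalPt_euler hF _ V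

/-- A morphism over `α` and `f` pulls the augmentation of `G` at `V` back to `f` composed with the
augmentation of `F` at `V ∘ α`. So the two evaluations take place at test points related by `f`. -/
lemma classify_homOver {α : A →ₗ[ZMod 2] B} {f : k →+* k'} (g : HomOver α f F G)
    (z : Laz.{u} B) : classify hG z = f (classify hF (lazard.X.rs α z)) := by
  rw [classify, classify, evalPt_rs, ← evalPt_pull hF hG g]
  exact (evalPt_over hF (fun W a => (g.map_θ W a).symm) z).symm

end classify

end EquivariantFGL

/-! ### Completion of augmented algebras with principal augmentation ideals -/

lemma IdealCompletion.IsContOut.exists_factor {R T : Type u} [CommRing R] [CommRing T] {ι : Type}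
    {I : ι → Ideal R} {Φ : Completion I →+* T} (h : IsContOut Φ) :
    ∃ (i : ι) (ψ : R ⧸ I i →+* T), ∀ x, Φ x = ψ (proj I i x) := by
  obtain ⟨i, hi⟩ := h
  refine ⟨i, Ideal.Quotient.lift (I i) (Φ.comp (of I)) (fun a ha => hi ?_), fun x => ?_⟩
  · rw [RingHom.mem_ker, proj_of]
    exact Ideal.Quotient.eq_zero_iff_mem.2 ha
  · obtain ⟨r, hr⟩ := exists_of_sub_mem_ker I i x
    have h1 := hi hr
    rw [RingHom.mem_ker, map_sub, sub_eq_zero] at h1 hr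
    rw [h1, hr]
    rfl

/-- An augmented algebra that is not necessarily complete, with regular generators of the
augmentation ideals and with a 2-torsion group structure on its points that is compatible with the
augmentations. -/
structure FormalLaw (A : Type) [AddCommGroup A] [Module (ZMod 2) A] (k : Type u) [CommRing k]
    extends AugmentedAlgebra A k where
  E : Character A → R
  E_regular : ∀ V, E V ∈ nonZeroDivisors R
  span_E : ∀ V, Ideal.span {E V} = RingHom.ker (θ V)
  add : ∀ {T : Type u} [CommRing T] {η : k →+* T}, toAugmentedAlgebra.Pt η →
    toAugmentedAlgebra.Pt η → toAugmentedAlgebra.Pt η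
  add_over : ∀ {T T' : Type u} [CommRing T] [CommRing T'] {η : k →+* T} {η' : k →+* T'}
    (φ : T →+* T') {p q : toAugmentedAlgebra.Pt η} {p' q' : toAugmentedAlgebra.Pt η'},
    (∀ a, φ (p.hom a) = p'.hom a) → (∀ a, φ (q.hom a) = q'.hom a) →
      ∀ a, φ ((add p q).hom a) = (add p' q').hom a
  add_comm : ∀ {T : Type u} [CommRing T] {η : k →+* T} (p q : toAugmentedAlgebra.Pt η),
    add p q = add q p
  add_assoc : ∀ {T : Type u} [CommRing T] {η : k →+* T} (p q r : toAugmentedAlgebra.Pt η),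
    add (add p q) r = add p (add q r)
  zero_add : ∀ {T : Type u} [CommRing T] {η : k →+* T} (p : toAugmentedAlgebra.Pt η),
    add (Pt.ofθ _ η 0) p = p
  add_self : ∀ {T : Type u} [CommRing T] {η : k →+* T} (p : toAugmentedAlgebra.Pt η),
    add p p = Pt.ofθ _ η 0
  add_ofθ : ∀ {T : Type u} [CommRing T] (η : k →+* T) (V W : Character A),
    add (Pt.ofθ toAugmentedAlgebra η V) (Pt.ofθ toAugmentedAlgebra η W) = Pt.ofθ _ η (V + W)

namespace FormalLaw

variable {A : Type} [AddCommGroup A] [Module (ZMod 2) A] {k : Type u} [CommRing k]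
variable (P : FormalLaw A k)

/-- The generator of the ideal `I s`. -/
def Eprod (s : Multiset (Character A)) : P.R := (s.map P.E).prod

lemma Eprod_cons (V : Character A) (s : Multiset (Character A)) :
    P.Eprod (V ::ₘ s) = P.E V * P.Eprod s := by simp [Eprod]

lemma Eprod_add (s t : Multiset (Character A)) : P.Eprod (s + t) = P.Eprod s * P.Eprod t := by
  simp [Eprod]

lemma span_Eprod (s : Multiset (Character A)) : Ideal.span {P.Eprod s} = P.I s := by
  induction s using Multiset.induction_on with
  | empty => simp [Eprod, AugmentedAlgebra.I]
  | cons V s ih =>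
    rw [Eprod_cons, ← Ideal.span_singleton_mul_span_singleton, ih, P.span_E]
    simp [AugmentedAlgebra.I]

lemma mem_I {s : Multiset (Character A)} {x : P.R} : x ∈ P.I s ↔ ∃ z, x = P.Eprod s * z := by
  rw [← span_Eprod, Ideal.mem_span_singleton]
  rfl

lemma Eprod_regular (s : Multiset (Character A)) : P.Eprod s ∈ nonZeroDivisors P.R := by
  induction s using Multiset.induction_on with
  | empty => simp [Eprod, one_mem]
  | cons V s ih =>
    rw [Eprod_cons]
    exact mul_mem (P.E_regular V) ih

lemma Eprod_cancel {s : Multiset (Character A)} {a b : P.R} (h : P.Eprod s * a = P.Eprod s * b) :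
    a = b :=
  (mul_cancel_left_mem_nonZeroDivisors (P.Eprod_regular s)).1 h

lemma I_add_le_left (s t : Multiset (Character A)) : P.I (s + t) ≤ P.I s :=
  (P.I_add s t).le.trans (Ideal.mul_le_inf.trans inf_le_left)

lemma I_add_le_right (s t : Multiset (Character A)) : P.I (s + t) ≤ P.I t :=
  (P.I_add s t).le.trans (Ideal.mul_le_inf.trans inf_le_right)

lemma mem_I_of_mul_mem {s t : Multiset (Character A)} {a : P.R}
    (h : P.Eprod s * a ∈ P.I (s + t)) : a ∈ P.I t := by
  obtain ⟨z, hz⟩ := P.mem_I.1 h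
  rw [Eprod_add, mul_assoc] at hz
  exact P.mem_I.2 ⟨z, P.Eprod_cancel hz⟩

lemma proj_eq_zero_of_mul {s t : Multiset (Character A)} {x : Completion P.I}
    (h : proj P.I (s + t) (of P.I (P.Eprod s) * x) = 0) : proj P.I t x = 0 := by
  obtain ⟨r, hr⟩ := Ideal.Quotient.mk_surjective (proj P.I (s + t) x)
  rw [map_mul, proj_of, ← hr, ← map_mul, Ideal.Quotient.eq_zero_iff_mem] at h
  rw [← factor_proj P.I (P.I_add_le_right s t), ← hr, Ideal.Quotient.factor_mk,
    Ideal.Quotient.eq_zero_iff_mem]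
  exact P.mem_I_of_mul_mem h

lemma of_Eprod_mul_eq_zero {s : Multiset (Character A)} {x : Completion P.I}
    (h : of P.I (P.Eprod s) * x = 0) : x = 0 :=
  completion_ext fun t => by
    rw [P.proj_eq_zero_of_mul (s := s) (t := t) (by rw [h, map_zero]), map_zero]

/-- At level `s + t` the element is `Eprod s` times some `z t`. Regularity of `Eprod s` determines
`z t` modulo `I t`, so the `z t` form a compatible family, which is the quotient in the completion.
-/
lemma ker_proj (s : Multiset (Character A)) :
    RingHom.ker (proj P.I s) = Ideal.span {of P.I (P.Eprod s)} := by
  refine le_antisymm (fun x hx => ?_) ?_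
  · rw [Ideal.mem_span_singleton]
    have key (t : Multiset (Character A)) :
        ∃ z, proj P.I (s + t) x = Ideal.Quotient.mk _ (P.Eprod s * z) := by
      obtain ⟨r, hr⟩ := Ideal.Quotient.mk_surjective (proj P.I (s + t) x)
      have h := factor_proj P.I (P.I_add_le_left s t) x
      rw [RingHom.mem_ker] at hx
      rw [← hr, Ideal.Quotient.factor_mk, hx, Ideal.Quotient.eq_zero_iff_mem] at h
      obtain ⟨z, rfl⟩ := P.mem_I.1 h
      exact ⟨z, hr.symm⟩
    choose z hz using key
    have hz' {t t' : Multiset (Character A)} (h : P.I t ≤ P.I t') : z t - z t' ∈ P.I t' := by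
      refine P.mem_I_of_mul_mem (s := s) ?_
      have hle : P.I (s + t) ≤ P.I (s + t') := by
        rw [P.I_add, P.I_add]
        exact Ideal.mul_mono_right h
      have h1 := factor_proj P.I hle x
      rw [hz, hz, Ideal.Quotient.factor_mk, Ideal.Quotient.eq, ← mul_sub] at h1
      exact h1
    refine ⟨⟨fun t => Ideal.Quotient.mk _ (z t), fun t t' h => ?_⟩, completion_ext fun t => ?_⟩
    · rw [Ideal.Quotient.factor_mk, Ideal.Quotient.eq]
      exact hz' h
    · have h1 := factor_proj P.I (P.I_add_le_right s t) x
      rw [hz, Ideal.Quotient.factor_mk, map_mul] at h1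
      rw [map_mul, proj_of]
      exact h1.symm
  · rw [Ideal.span_singleton_le_iff_mem, RingHom.mem_ker, proj_of, Ideal.Quotient.eq_zero_iff_mem,
      ← span_Eprod]
    exact Ideal.mem_span_singleton_self _

/-- The augmentations of the completion. -/
def θHat (V : Character A) : Completion P.I →+* k :=
  (Ideal.Quotient.lift (P.I {V}) (P.θ V : P.R →+* k)
    (fun a ha => by rwa [P.I_singleton, RingHom.mem_ker] at ha)).comp (proj P.I {V})

lemma ker_θHat (V : Character A) : RingHom.ker (P.θHat V) = RingHom.ker (proj P.I {V}) := by
  ext x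
  obtain ⟨r, hr⟩ := Ideal.Quotient.mk_surjective (proj P.I {V} x)
  have h : P.θHat V x = P.θ V r := by
    rw [θHat, RingHom.comp_apply, ← hr]
    rfl
  rw [RingHom.mem_ker, RingHom.mem_ker, h, ← hr, Ideal.Quotient.eq_zero_iff_mem, P.I_singleton,
    RingHom.mem_ker]

/-- The algebra structure of the completion. -/
@[reducible]
def hatAlgebra : Algebra k (Completion P.I) := ((of P.I).comp (algebraMap k P.R)).toAlgebra

/-- The completed augmented algebra. -/
def hatAlg : AugmentedAlgebra A k where
  R := Completion P.I
  algebra := P.hatAlgebra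
  θ V :=
    letI := P.hatAlgebra
    { P.θHat V with commutes' := fun c => (P.θ V).commutes c }

/-- The completion map. -/
def toHat : P.R →+* P.hatAlg.R := of P.I

/-- The projections of the completion. -/
def projHat (s : Multiset (Character A)) : P.hatAlg.R →+* P.R ⧸ P.I s := proj P.I s

lemma hatAlg_algebraMap (c : k) :
    algebraMap k P.hatAlg.R c = P.toHat (algebraMap k P.R c) := rfl

lemma projHat_toHat (s : Multiset (Character A)) (x : P.R) :
    P.projHat s (P.toHat x) = Ideal.Quotient.mk _ x := rfl

lemma ker_hatAlg_θ (V : Character A) :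
    RingHom.ker (P.hatAlg.θ V) = Ideal.span {P.toHat (P.E V)} := by
  have h := (P.ker_θHat V).trans (P.ker_proj {V})
  rw [Eprod, Multiset.map_singleton, Multiset.prod_singleton] at h
  exact h

/-- Since the kernels of the projections are principal with multiplicative generators, the intrinsic
topology of the completion is the limit topology. This gives `hatAlg_complete`. -/
lemma hatAlg_I (s : Multiset (Character A)) : P.hatAlg.I s = RingHom.ker (P.projHat s) := by
  refine Eq.trans ?_ (P.ker_proj s).symm
  change _ = Ideal.span {P.toHat (P.Eprod s)}
  induction s using Multiset.induction_on with
  | empty => simp [Eprod, AugmentedAlgebra.I]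
  | cons V s ih =>
    rw [Eprod_cons, map_mul, ← Ideal.span_singleton_mul_span_singleton, ← ih, ← ker_hatAlg_θ]
    simp [AugmentedAlgebra.I]

lemma hatAlg_complete : Function.Bijective (of P.hatAlg.I) := by
  refine ⟨(injective_iff_map_eq_zero _).2 fun x hx => ?_, fun y => ?_⟩
  · refine completion_ext (I := P.I) fun s => ?_
    have h : x ∈ P.hatAlg.I s := by
      rw [← Ideal.Quotient.eq_zero_iff_mem, ← proj_of P.hatAlg.I s, hx, map_zero]
    rw [hatAlg_I] at h
    exact h
  · have hI (s : Multiset (Character A)) (a) (ha : a ∈ P.hatAlg.I s) : P.projHat s a = 0 := by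
      rwa [hatAlg_I, RingHom.mem_ker] at ha
    let x : P.hatAlg.R := ⟨fun s => Ideal.Quotient.lift (P.hatAlg.I s) (P.projHat s) (hI s)
      (proj P.hatAlg.I s y), fun s t h => by
        have hle : P.hatAlg.I s ≤ P.hatAlg.I t := by
          rw [hatAlg_I, hatAlg_I]
          exact ker_proj_mono h
        beta_reduce
        rw [← factor_proj P.hatAlg.I hle]
        obtain ⟨r, hr⟩ := Ideal.Quotient.mk_surjective (proj P.hatAlg.I s y)
        rw [← hr, Ideal.Quotient.lift_mk, Ideal.Quotient.factor_mk, Ideal.Quotient.lift_mk]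
        exact factor_proj P.I h r⟩
    refine ⟨x, completion_ext fun s => ?_⟩
    obtain ⟨r, hr⟩ := Ideal.Quotient.mk_surjective (proj P.hatAlg.I s y)
    rw [proj_of, ← hr, Ideal.Quotient.eq, hatAlg_I, RingHom.mem_ker, map_sub, sub_eq_zero]
    change Ideal.Quotient.lift (P.hatAlg.I s) (P.projHat s) (hI s) (proj P.hatAlg.I s y) = _
    rw [← hr, Ideal.Quotient.lift_mk]

section Points

variable {P} {T : Type u} [CommRing T] {η : k →+* T}

/-- The restriction of a point along the completion map. -/
@[simps]
def ptRes (p : P.hatAlg.Pt η) : P.Pt η where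
  hom := p.hom.comp P.toHat
  hom_algebraMap c := p.hom_algebraMap c
  cont := by
    obtain ⟨s, hs⟩ := p.cont
    refine ⟨s, fun a ha => hs ?_⟩
    rw [hatAlg_I, RingHom.mem_ker, projHat_toHat]
    exact Ideal.Quotient.eq_zero_iff_mem.2 ha

lemma hom_ext_toHat {Φ Ψ : P.hatAlg.R →+* T} (hΦ : ∃ s, P.hatAlg.I s ≤ RingHom.ker Φ)
    (hΨ : ∃ s, P.hatAlg.I s ≤ RingHom.ker Ψ) (h : ∀ x, Φ (P.toHat x) = Ψ (P.toHat x)) :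
    Φ = Ψ := by
  have aux {Φ : P.hatAlg.R →+* T} (hΦ : ∃ s, P.hatAlg.I s ≤ RingHom.ker Φ) :
      IsContOut (I := P.I) Φ := by
    obtain ⟨s, hs⟩ := hΦ
    rw [hatAlg_I] at hs
    exact ⟨s, hs⟩
  exact (aux hΦ).ext P.directed_I (aux hΨ) h

lemma ptRes_injective {p q : P.hatAlg.Pt η} (h : ptRes p = ptRes q) : p = q :=
  Pt.ext (hom_ext_toHat p.cont q.cont fun x => RingHom.congr_fun (congrArg Pt.hom h) x)

lemma ptRes_ofθ (V : Character A) : ptRes (Pt.ofθ P.hatAlg η V) = Pt.ofθ _ η V := rfl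

end Points

/-- The structure map of the universal pair of points. -/
def ηPair (i : Multiset (Character A) × Multiset (Character A)) :
    k →+* (P.hatAlg.R ⊗[k] P.hatAlg.R) ⧸ tensorIdeals k P.hatAlg.I P.hatAlg.I i :=
  ((proj _ i).comp P.hatAlg.inc₁₂).comp (algebraMap k P.hatAlg.R)

/-- The first point of the universal pair of points. -/
def pt₁ (i : Multiset (Character A) × Multiset (Character A)) : P.hatAlg.Pt (P.ηPair i) :=
  ⟨(proj _ i).comp P.hatAlg.inc₁₂, fun _ => rfl, P.hatAlg.isCont_inc₁₂ i⟩

/-- The second point of the universal pair of points. -/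
def pt₂ (i : Multiset (Character A) × Multiset (Character A)) : P.hatAlg.Pt (P.ηPair i) :=
  ⟨(proj _ i).comp P.hatAlg.inc₂₂, fun c => congrArg (proj _ i)
    (P.hatAlg.inc₁₂_algebraMap c).symm, P.hatAlg.isCont_inc₂₂ i⟩

/-- The comultiplication before completion of its source. -/
def Δ₀ : P.R →+* P.hatAlg.Tensor₂ :=
  RingHom.codRestrict (RingHom.pi fun i => (P.add (ptRes (P.pt₁ i)) (ptRes (P.pt₂ i))).hom)
    (Completion _) fun x _ _ h => P.add_over (Ideal.Quotient.factor h)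
      (fun a => factor_proj _ h (P.hatAlg.inc₁₂ (P.toHat a)))
      (fun a => factor_proj _ h (P.hatAlg.inc₂₂ (P.toHat a))) x

lemma proj_Δ₀ (i : Multiset (Character A) × Multiset (Character A)) (x : P.R) :
    proj _ i (P.Δ₀ x) = (P.add (ptRes (P.pt₁ i)) (ptRes (P.pt₂ i))).hom x := rfl

lemma isCont_Δ₀ : IsCont P.I P.Δ₀ := fun i => (P.add (ptRes (P.pt₁ i)) (ptRes (P.pt₂ i))).cont

/-- The comultiplication of the completion. -/
def ΔHat : P.hatAlg.R →+* P.hatAlg.Tensor₂ := extend P.directed_I P.isCont_Δ₀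

lemma ΔHat_toHat (x : P.R) : P.ΔHat (P.toHat x) = P.Δ₀ x := extend_of _ _ x

/-- The completion as an augmented bialgebra. -/
@[reducible]
def hatBialg : AugmentedBialgebra A k where
  toAugmentedAlgebra := P.hatAlg
  Δ := P.ΔHat
  Δ_algebraMap c := by
    rw [hatAlg_algebraMap, ΔHat_toHat]
    exact completion_ext fun i =>
      (P.add (ptRes (P.pt₁ i)) (ptRes (P.pt₂ i))).hom_algebraMap c
  Δ_cont i := by
    obtain ⟨s, hs⟩ := P.isCont_Δ₀ i
    refine ⟨s, fun a ha => ?_⟩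
    rw [hatAlg_I, RingHom.mem_ker] at ha
    refine (proj_extend P.directed_I P.isCont_Δ₀ hs a).trans ?_
    rw [show proj P.I s a = 0 from ha, map_zero]

/-- The comultiplication was built as the sum of the universal pair of points. Any pair of points
factors through one of these, so `Δ` induces the prescribed addition, and the axioms of a formal
group law become the axioms on `add`. -/
lemma ptRes_star {T : Type u} [CommRing T] {η : k →+* T} (p q : P.hatAlg.Pt η) :
    ptRes (P.hatBialg.star p q) = P.add (ptRes p) (ptRes q) := by
  refine Pt.ext (RingHom.ext fun x => ?_)
  change p.hat q (P.ΔHat (P.toHat x)) = _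
  rw [ΔHat_toHat]
  obtain ⟨i, ψ, h⟩ := (Pt.isContOut_hat p q).exists_factor
  rw [h, proj_Δ₀]
  refine P.add_over ψ (fun a => ?_) (fun a => ?_) x
  · exact (h _).symm.trans (Pt.hat_inc₁₂ p q (P.toHat a))
  · exact (h _).symm.trans (Pt.hat_inc₂₂ p q (P.toHat a))

lemma hat_ΔHat {T : Type u} [CommRing T] {η : k →+* T} (p q r : P.hatAlg.Pt η)
    (h : P.add (ptRes p) (ptRes q) = ptRes r) (x : P.hatAlg.R) : p.hat q (P.ΔHat x) = r.hom x :=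
  RingHom.congr_fun (congrArg Pt.hom (ptRes_injective ((P.ptRes_star p q).trans h))) x

/-- The formal group law obtained by completion. -/
def completed : EquivariantFGL A k where
  toAugmentedBialgebra := P.hatBialg
  y := P.toHat (P.E 0)
  complete := P.hatAlg_complete
  cocomm x := P.hatAlg.tensor₂_ext fun T _ η p q => by
    refine (Pt.hat_swapHat p q _).trans (P.hat_ΔHat q p (P.hatBialg.star p q) ?_ x)
    rw [ptRes_star, P.add_comm]
  coassoc x := P.hatAlg.tensor₃_ext fun T _ η p q r => by
    refine (P.hatBialg.hat₃_ΔHatId p q r _).trans (Eq.trans ?_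
      (P.hatBialg.hat₃_idHatΔ p q r _).symm)
    refine P.hat_ΔHat _ _ (P.hatBialg.star p (P.hatBialg.star q r)) ?_ x
    rw [ptRes_star, ptRes_star, ptRes_star, P.add_assoc]
  counit x := P.hatAlg.completion_I_ext fun T _ η p => by
    refine (Pt.hat₁_θHatId p 0 _).trans (P.hat_ΔHat _ p p ?_ x)
    rw [ptRes_ofθ, P.zero_add]
  θ_Δ V W x := completion_ext fun _ => by
    refine (Pt.proj_θHatθ V W _).trans
      (P.hat_ΔHat _ _ (Pt.ofθ P.hatAlg (Ideal.Quotient.mk _) (V + W)) ?_ x)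
    rw [ptRes_ofθ, ptRes_ofθ, ptRes_ofθ, P.add_ofθ]
  y_regular := by
    rw [mem_nonZeroDivisors_iff_right]
    intro x hx
    refine P.of_Eprod_mul_eq_zero (s := {0}) ?_
    rw [Eprod, Multiset.map_singleton, Multiset.prod_singleton]
    exact (mul_comm _ _).trans hx
  span_y := (P.ker_hatAlg_θ 0).symm

lemma completed_isTwoTorsion : P.completed.IsTwoTorsion := by
  refine P.hatAlg.completion_I_ext fun T _ η p => ?_
  refine (Pt.hat₁_mulHat p _).trans
    ((P.hat_ΔHat p p (Pt.ofθ P.hatAlg η 0) ?_ _).trans ?_)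
  · rw [ptRes_ofθ, P.add_self]
  · have h : P.θ 0 (P.E 0) = 0 := by
      have : P.E 0 ∈ RingHom.ker (P.θ 0) := P.span_E 0 ▸ Ideal.mem_span_singleton_self _
      exact this
    exact (congrArg η h).trans ((map_zero η).trans (map_zero p.hat₁).symm)

lemma ptRes_add {T : Type u} [CommRing T] {η : k →+* T} (p q : P.completed.Pt η) :
    ptRes (p + q) = P.add (ptRes p) (ptRes q) := P.ptRes_star p q

end FormalLaw

/-! ### Translations and the uniqueness of morphisms -/

namespace EquivariantFGL

variable {A B : Type} [AddCommGroup A] [Module (ZMod 2) A] [AddCommGroup B] [Module (ZMod 2) B]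
variable {k' k : Type u} [CommRing k'] [CommRing k]

/-- The inverse of the completion map of a complete algebra. -/
def unhat (F : EquivariantFGL A k) : Completion F.I →+* F.R :=
  (RingEquiv.ofBijective (of F.I) F.complete).symm.toRingHom

lemma of_unhat (F : EquivariantFGL A k) (x : Completion F.I) : of F.I (F.unhat x) = x :=
  (RingEquiv.ofBijective (of F.I) F.complete).apply_symm_apply x

lemma unhat_of (F : EquivariantFGL A k) (x : F.R) : F.unhat (of F.I x) = x :=
  (RingEquiv.ofBijective (of F.I) F.complete).symm_apply_apply x

variable {F : EquivariantFGL A k}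

lemma hom_unhat {T : Type u} [CommRing T] {η : k →+* T} (p : F.Pt η) (x : Completion F.I) :
    p.hom (F.unhat x) = p.hat₁ x := by
  rw [← Pt.hat₁_of, of_unhat]

lemma eq_of_points {x y : F.R}
    (h : ∀ (T : Type u) [CommRing T] (η : k →+* T) (p : F.Pt η), p.hom x = p.hom y) : x = y :=
  F.complete.1 (F.completion_I_ext fun T _ η p => h T η p)

/-- The translation by the point `θ(V)`. -/
def translate (F : EquivariantFGL A k) (V : Character A) : F.R →+* F.R :=
  F.unhat.comp ((F.θHatId V).comp F.Δ)

lemma hom_translate {T : Type u} [CommRing T] {η : k →+* T} (p : F.Pt η) (V : Character A)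
    (x : F.R) : p.hom (F.translate V x) = (F.θPt η V + p).hom x :=
  (hom_unhat p _).trans (Pt.hat₁_θHatId p V _)

lemma translate_translate (hF : F.IsTwoTorsion) (V : Character A) (x : F.R) :
    F.translate V (F.translate V x) = x :=
  eq_of_points fun T _ η p => by
    rw [hom_translate, hom_translate, ← add_assoc, F.add_self hF, zero_add]

lemma θ_zero_translate (V : Character A) (x : F.R) : F.θ 0 (F.translate V x) = F.θ V x := by
  have h := hom_translate (F.θPt (RingHom.id k) 0) V x
  rw [← _root_.map_add, add_zero] at h
  exact h

/-- Translation by `θ(V)` is an involution carrying `ker θ(V)` to `ker θ(ε)`, so the translate of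
`y(ε)` generates `ker θ(V)`. -/
lemma exists_eq_add_translate_mul (hF : F.IsTwoTorsion) (V : Character A) (x : F.R) :
    ∃ q, x = algebraMap k F.R (F.θ V x) + F.translate V F.y * q := by
  have hx : F.translate V (x - algebraMap k F.R (F.θ V x)) ∈ RingHom.ker (F.θ 0) := by
    rw [RingHom.mem_ker, θ_zero_translate, _root_.map_sub, AlgHom.commutes, Algebra.algebraMap_self,
      RingHom.id_apply, sub_self]
  rw [← F.span_y, Ideal.mem_span_singleton] at hx
  obtain ⟨z, hz⟩ := hx
  refine ⟨F.translate V z, ?_⟩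
  rw [← _root_.map_mul, ← hz, translate_translate hF, add_sub_cancel]

lemma translate_mem (hF : F.IsTwoTorsion) (V : Character A) :
    F.translate V F.y ∈ RingHom.ker (F.θ V) := by
  have h := θ_zero_translate (F := F) V (F.translate V F.y)
  rw [translate_translate hF, F.θ_y] at h
  exact h.symm

/-- Repeated division with remainder writes any element, modulo `I s`, as a polynomial over `k` in
the translates of `y(ε)`. The hypothesis says that the two points agree on these translates, and
both points factor through some `R ⧸ I s`. -/
lemma eq_of_add_y (hF : F.IsTwoTorsion) {T : Type u} [CommRing T] {η : k →+* T} {p q : F.Pt η}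
    (h : ∀ V, (F.θPt η V + p).hom F.y = (F.θPt η V + q).hom F.y) : p = q := by
  obtain ⟨s₁, h₁⟩ := p.cont
  obtain ⟨s₂, h₂⟩ := q.cont
  obtain ⟨s, hs₁, hs₂⟩ := F.directed_I s₁ s₂
  have key (s : Multiset (Character A)) : ∀ r : F.R, ∃ z, p.hom z = q.hom z ∧ r - z ∈ F.I s := by
    induction s using Multiset.induction_on with
    | empty => exact fun r => ⟨0, by simp [AugmentedAlgebra.I]⟩
    | cons V s ih =>
      intro r
      obtain ⟨r₁, hr₁⟩ := exists_eq_add_translate_mul hF V r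
      obtain ⟨z, hz, hmem⟩ := ih r₁
      refine ⟨algebraMap k F.R (F.θ V r) + F.translate V F.y * z, ?_, ?_⟩
      · rw [_root_.map_add, _root_.map_add, _root_.map_mul, _root_.map_mul, hz, hom_translate,
          hom_translate, h, p.agree q]
      · have h2 : r - (algebraMap k F.R (F.θ V r) + F.translate V F.y * z) =
            F.translate V F.y * (r₁ - z) := by linear_combination hr₁
        have h3 : F.I (V ::ₘ s) = RingHom.ker (F.θ V) * F.I s := by simp [AugmentedAlgebra.I]
        rw [h2, h3]
        exact Ideal.mul_mem_mul (translate_mem hF V) hmem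
  refine Pt.ext (RingHom.ext fun r => ?_)
  obtain ⟨z, hz, hmem⟩ := key s r
  have h3 : p.hom (r - z) = 0 := h₁ (hs₁ hmem)
  have h4 : q.hom (r - z) = 0 := h₂ (hs₂ hmem)
  rw [_root_.map_sub, sub_eq_zero] at h3 h4
  rw [h3, h4, hz]

/-- Pulling points back along a morphism preserves sums, the points `θ(V)` and the orientation. The
pulled-back point therefore has translates with prescribed coordinates, which determine it. -/
lemma homOver_ext (hF : F.IsTwoTorsion) {G : EquivariantFGL A k'} {f : k →+* k'}
    (g g' : HomOver (LinearMap.id : A →ₗ[ZMod 2] A) f F G) : g = g' := by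
  have hφ : g.φ = g'.φ := by
    refine RingHom.ext fun x => eq_of_points fun T _ η p => ?_
    have aux (g : HomOver (LinearMap.id : A →ₗ[ZMod 2] A) f F G) (V : Character A) :
        (F.θPt (η.comp f) V + g.pull η p).hom F.y = (G.θPt η V + p).hom G.y := by
      have h1 : g.pull η (G.θPt η V) = F.θPt (η.comp f) V :=
        Pt.ext (RingHom.ext fun x => congrArg η (g.map_θ V x))
      rw [← h1, ← _root_.map_add]
      exact congrArg (G.θPt η V + p).hom g.map_y
    have h := eq_of_add_y hF (p := g.pull η p) (q := g'.pull η p) fun V => by rw [aux, aux]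
    exact RingHom.congr_fun (congrArg Pt.hom h) x
  obtain ⟨⟨φ, _, _, _⟩, _⟩ := g
  obtain ⟨⟨φ', _, _, _⟩, _⟩ := g'
  obtain rfl : φ = φ' := hφ
  rfl

end EquivariantFGL

/-! ### Morphisms out of completions -/

namespace FormalLaw

variable {A B : Type} [AddCommGroup A] [Module (ZMod 2) A] [AddCommGroup B] [Module (ZMod 2) B]
variable {k' k : Type u} [CommRing k'] [CommRing k]

/-- A homomorphism to the algebra of a formal group law that is compatible with the augmentations
and the orientations. -/
structure PreMap (P : FormalLaw B k) (G : EquivariantFGL A k') (δ : B →ₗ[ZMod 2] A)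
    (f : k →+* k') where
  φ : P.R →+* G.R
  map_algebraMap : ∀ c, φ (algebraMap k P.R c) = algebraMap k' G.R (f c)
  map_θ : ∀ (V : Character A) (x : P.R), G.θ V (φ x) = f (P.θ (V ∘ₗ δ) x)
  map_E : φ (P.E 0) = G.y

namespace PreMap

variable {P : FormalLaw B k} {G : EquivariantFGL A k'} {δ : B →ₗ[ZMod 2] A} {f : k →+* k'}
variable (g : PreMap P G δ f)

lemma I_le_comap (s : Multiset (Character A)) :
    P.I (s.map fun V => V ∘ₗ δ) ≤ (G.I s).comap g.φ := by
  induction s using Multiset.induction_on with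
  | empty => simp [AugmentedAlgebra.I]
  | cons V s ih =>
    have h1 : P.I ((V ::ₘ s).map fun V => V ∘ₗ δ) =
        RingHom.ker (P.θ (V ∘ₗ δ)) * P.I (s.map fun V => V ∘ₗ δ) := by
      simp [AugmentedAlgebra.I]
    have h2 : G.I (V ::ₘ s) = RingHom.ker (G.θ V) * G.I s := by simp [AugmentedAlgebra.I]
    rw [h1, h2, Ideal.mul_le]
    intro a ha b hb
    rw [Ideal.mem_comap, map_mul]
    refine Ideal.mul_mem_mul ?_ (ih hb)
    rw [RingHom.mem_ker] at ha ⊢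
    rw [g.map_θ, ha, map_zero]

lemma isCont : IsCont P.I ((of G.I).comp g.φ) :=
  IsCont.of_comp (fun s => ⟨_, g.I_le_comap s⟩) (isCont_of G.I)

/-- The image of a point. -/
@[simps]
def pull {T : Type u} [CommRing T] {η : k' →+* T} (p : G.Pt η) : P.Pt (η.comp f) where
  hom := p.hom.comp g.φ
  hom_algebraMap c := by
    rw [RingHom.comp_apply, g.map_algebraMap, p.hom_algebraMap, RingHom.comp_apply]
  cont := by
    obtain ⟨s, hs⟩ := p.cont
    exact ⟨_, fun a ha => hs (g.I_le_comap s ha)⟩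

/-- The continuous extension to the completion. -/
def extendφ : P.completed.R →+* G.R := G.unhat.comp (extend P.directed_I g.isCont)

lemma extendφ_toHat (x : P.R) : g.extendφ (P.toHat x) = g.φ x :=
  (congrArg G.unhat (extend_of P.directed_I g.isCont x)).trans (G.unhat_of _)

lemma completed_I_le_comap (s : Multiset (Character A)) :
    P.completed.I (s.map fun V => V ∘ₗ δ) ≤ (G.I s).comap g.extendφ := by
  intro x hx
  have hx' : proj P.I (s.map fun V => V ∘ₗ δ) x = 0 := by
    have := P.hatAlg_I (s.map fun V => V ∘ₗ δ) ▸ hx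
    exact this
  have hs : P.I (s.map fun V => V ∘ₗ δ) ≤ RingHom.ker ((proj G.I s).comp ((of G.I).comp g.φ)) :=
    fun a ha => Ideal.Quotient.eq_zero_iff_mem.2 (g.I_le_comap s ha)
  rw [Ideal.mem_comap, ← Ideal.Quotient.eq_zero_iff_mem, ← proj_of]
  refine (congrArg (proj G.I s) (G.of_unhat _)).trans
    ((proj_extend P.directed_I g.isCont hs x).trans ?_)
  rw [hx', map_zero]

/-- The extension to the completion is compatible with augmentations and orientations. -/
def preHom : EquivariantFGL.PreHom δ f P.completed G where
  φ := g.extendφ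
  map_algebraMap c := (g.extendφ_toHat _).trans (g.map_algebraMap c)
  map_θ V x := by
    refine RingHom.congr_fun (hom_ext_toHat (Φ := (G.θ V : G.R →+* k').comp g.extendφ)
      (Ψ := f.comp (P.completed.θ (V ∘ₗ δ) : P.completed.R →+* k))
      ⟨({V} : Multiset (Character A)).map fun V => V ∘ₗ δ, fun a ha => ?_⟩
      ⟨{V ∘ₗ δ}, fun a ha => ?_⟩ fun x => ?_) x
    · have h : g.extendφ a ∈ G.I {V} := g.completed_I_le_comap {V} ha
      rw [G.I_singleton] at h
      exact h
    · have h : a ∈ RingHom.ker (P.hatAlg.θ (V ∘ₗ δ)) := P.hatAlg.I_singleton _ ▸ ha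
      exact (congrArg f h).trans (map_zero f)
    · exact (congrArg (G.θ V) (g.extendφ_toHat x)).trans (g.map_θ V x)
  map_y := (g.extendφ_toHat _).trans g.map_E

/-- The extension to the completion is a morphism if it is compatible with the addition of
points. -/
def homOver (hadd : ∀ {T : Type u} [CommRing T] {η : k' →+* T} (p q : G.Pt η),
    g.pull (p + q) = P.add (g.pull p) (g.pull q)) :
    EquivariantFGL.HomOver δ f P.completed G where
  toPreHom := g.preHom
  map_Δ x := G.tensor₂_ext fun T _ η p q => by
    have aux (p : G.Pt η) : ptRes (g.preHom.pull p) = g.pull p :=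
      Pt.ext (RingHom.ext fun x => congrArg p.hom (g.extendφ_toHat x))
    rw [EquivariantFGL.PreHom.hat_hat]
    refine (P.hat_ΔHat _ _ (g.preHom.pull (p + q)) ?_ x).symm
    rw [aux, aux, aux, hadd]

end PreMap

end FormalLaw

/-! ### Base change for algebras with principal augmentation ideals -/

namespace BaseChange

variable {k k' S S' : Type u} [CommRing k] [CommRing k'] [CommRing S] [CommRing S']
  [Algebra k k'] [Algebra k S] {ι : Type}

/-- A commutative square of rings `k → k'`, `S → S'` in which both vertical maps are equipped with
a family of retractions, whose kernels are generated by compatible elements that are regular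
in `S'`. -/
structure Datum (k k' S S' : Type u) [CommRing k] [CommRing k'] [CommRing S] [CommRing S']
    [Algebra k k'] [Algebra k S] (ι : Type) where
  E : ι → S
  θ : ι → S →+* k
  θ_E : ∀ i, θ i (E i) = 0
  exists_eq : ∀ i x, ∃ q, x = algebraMap k S (θ i x) + E i * q
  a : k' →+* S'
  b : S →+* S'
  agree : ∀ c, a (algebraMap k k' c) = b (algebraMap k S c)
  θ' : ι → S' →+* k'
  θ'_a : ∀ i c, θ' i (a c) = c
  θ'_b : ∀ i x, θ' i (b x) = algebraMap k k' (θ i x)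
  exists_eq' : ∀ i x, ∃ q, x = a (θ' i x) + b (E i) * q
  cancel : ∀ i x y, b (E i) * x = b (E i) * y → x = y

namespace Datum

variable (d : Datum k k' S S' ι) {T : Type u} [CommRing T]

/-- The comparison of the base change with `S'`. -/
def μ : k' ⊗[k] S →+* S' := tensorLift d.a d.b d.agree

lemma μ_inl (c : k') : d.μ (inl k k' S c) = d.a c := tensorLift_inl _ _ _ _

lemma μ_inr (x : S) : d.μ (inr k k' S x) = d.b x := tensorLift_inr _ _ _ _

/-- The product of the generators belonging to a multiset of indices. -/
def Eprod (s : Multiset ι) : S := (s.map d.E).prod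

lemma Eprod_cons (i : ι) (s : Multiset ι) : d.Eprod (i ::ₘ s) = d.E i * d.Eprod s := by
  simp [Eprod]

lemma exists_eq_inl_add (i : ι) (x : k' ⊗[k] S) :
    ∃ c q, x = inl k k' S c + inr k k' S (d.E i) * q := by
  induction x using TensorProduct.induction_on with
  | zero => exact ⟨0, 0, by simp⟩
  | tmul c x =>
    obtain ⟨q, hq⟩ := d.exists_eq i x
    refine ⟨c * algebraMap k k' (d.θ i x), inl k k' S c * inr k k' S q, ?_⟩
    rw [tmul_eq_inl_mul_inr, map_mul, inl_algebraMap]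
    nth_rewrite 1 [hq]
    rw [map_add, map_mul]
    ring
  | add x y hx hy =>
    obtain ⟨c, q, rfl⟩ := hx
    obtain ⟨c', q', rfl⟩ := hy
    exact ⟨c + c', q + q', by rw [map_add]; ring⟩

/-- Successive approximation: peel off the value under one retraction after another. Together with
`exists_inr_mul` this says that `μ` is an isomorphism modulo `Eprod s`. -/
lemma exists_μ_add (s : Multiset ι) (z : S') : ∃ x w, z = d.μ x + d.b (d.Eprod s) * w := by
  induction s using Multiset.induction_on generalizing z with
  | empty => exact ⟨0, z, by simp [Eprod]⟩
  | cons i s ih =>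
    obtain ⟨q, hq⟩ := d.exists_eq' i z
    obtain ⟨x, w, rfl⟩ := ih q
    refine ⟨inl k k' S (d.θ' i z) + inr k k' S (d.E i) * x, w, ?_⟩
    nth_rewrite 1 [hq]
    rw [map_add, map_mul, μ_inl, μ_inr, Eprod_cons, map_mul]
    ring

/-- Writing `x = c + E i * q`, the retraction at `i` sends the equation to `c = 0`; the regular
factor `E i` is then cancelled in `S'`, leaving the same problem for a shorter product. -/
lemma exists_inr_mul (s : Multiset ι) {x : k' ⊗[k] S} {w : S'}
    (h : d.μ x = d.b (d.Eprod s) * w) : ∃ z, x = inr k k' S (d.Eprod s) * z := by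
  induction s using Multiset.induction_on generalizing x w with
  | empty => exact ⟨x, by simp [Eprod]⟩
  | cons i s ih =>
    obtain ⟨c, q, rfl⟩ := d.exists_eq_inl_add i x
    have hE : d.θ' i (d.b (d.E i)) = 0 := by rw [d.θ'_b, d.θ_E, map_zero]
    have h1 := congrArg (d.θ' i) h
    rw [Eprod_cons, map_add, map_mul, map_add, map_mul, map_mul, map_mul, map_mul, μ_inl, μ_inr,
      hE, d.θ'_a, zero_mul, zero_mul, zero_mul, add_zero] at h1
    subst h1
    rw [map_zero, zero_add, map_mul, μ_inr, Eprod_cons, map_mul, mul_assoc] at h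
    obtain ⟨z, rfl⟩ := ih (d.cancel i _ _ h)
    exact ⟨z, by rw [Eprod_cons, map_zero, map_mul]; ring⟩

/-- Modulo `Eprod s` the ring `S'` is the tensor product, so a pair of compatible maps extends as
soon as `f` kills `Eprod s`. -/
lemma exists_lift {g : k' →+* T} {f : S →+* T}
    (h : ∀ c, g (algebraMap k k' c) = f (algebraMap k S c)) {s : Multiset ι}
    (hs : f (d.Eprod s) = 0) :
    ∃ Φ : S' →+* T, (∀ c, Φ (d.a c) = g c) ∧ ∀ x, Φ (d.b x) = f x := by
  let J : Ideal S' := Ideal.span {d.b (d.Eprod s)}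
  let π : k' ⊗[k] S →+* S' ⧸ J := (Ideal.Quotient.mk J).comp d.μ
  have hπ : Function.Surjective π := by
    intro y
    obtain ⟨z, rfl⟩ := Ideal.Quotient.mk_surjective y
    obtain ⟨x, w, rfl⟩ := d.exists_μ_add s z
    refine ⟨x, (Ideal.Quotient.eq.2 ?_).symm⟩
    rw [add_sub_cancel_left]
    exact Ideal.mul_mem_right _ _ (Ideal.mem_span_singleton_self _)
  have hker : RingHom.ker π ≤ RingHom.ker (tensorLift g f h) := by
    intro x hx
    have hx' : d.μ x ∈ J := Ideal.Quotient.eq_zero_iff_mem.1 hx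
    obtain ⟨w, hw⟩ := Ideal.mem_span_singleton.1 hx'
    obtain ⟨z, rfl⟩ := d.exists_inr_mul s hw
    rw [RingHom.mem_ker, map_mul, tensorLift_inr, hs, zero_mul]
  let Ψ : S' ⧸ J →+* T := π.liftOfSurjective hπ ⟨tensorLift g f h, hker⟩
  have hΨ (x) : Ψ (π x) = tensorLift g f h x :=
    π.liftOfRightInverse_comp_apply _ _ ⟨tensorLift g f h, hker⟩ x
  refine ⟨Ψ.comp (Ideal.Quotient.mk J), fun c => ?_, fun x => ?_⟩
  · rw [RingHom.comp_apply, ← d.μ_inl]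
    exact (hΨ _).trans (tensorLift_inl _ _ _ _)
  · rw [RingHom.comp_apply, ← d.μ_inr]
    exact (hΨ _).trans (tensorLift_inr _ _ _ _)

lemma lift_ext {Φ Ψ : S' →+* T} (ha : ∀ c, Φ (d.a c) = Ψ (d.a c))
    (hb : ∀ x, Φ (d.b x) = Ψ (d.b x)) {s : Multiset ι} (hs : Φ (d.b (d.Eprod s)) = 0) :
    Φ = Ψ := by
  ext z
  obtain ⟨x, w, rfl⟩ := d.exists_μ_add s z
  have h := RingHom.congr_fun (tensor_hom_ext (f := Φ.comp d.μ) (g := Ψ.comp d.μ)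
    (fun c => by rw [RingHom.comp_apply, RingHom.comp_apply, μ_inl, ha])
    (fun x => by rw [RingHom.comp_apply, RingHom.comp_apply, μ_inr, hb])) x
  rw [RingHom.comp_apply, RingHom.comp_apply] at h
  rw [map_add, map_add, map_mul, map_mul, ← hb, hs, h, zero_mul, zero_mul]

end Datum

end BaseChange

/-! ### The value of a global group law at `B × C₂` -/

/-- The product of an elementary abelian 2-group with `C₂`. -/
abbrev El₂.plus (B : El₂) : El₂ := FGModuleCat.of (ZMod 2) (B × ZMod 2)

namespace El₂

variable {A B C : El₂}

/-- The projection `B × C₂ → B`. -/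
def fst (B : El₂) : B.plus →ₗ[ZMod 2] B := LinearMap.fst (ZMod 2) B (ZMod 2)

/-- The projection `B × C₂ → C₂`. -/
def snd (B : El₂) : Character B.plus := LinearMap.snd (ZMod 2) B (ZMod 2)

/-- The homomorphism to `B × C₂` with the given components. -/
def pair (β : C →ₗ[ZMod 2] B) (U : Character C) : C →ₗ[ZMod 2] B.plus := LinearMap.prod β U

@[simp] lemma fst_pair (β : C →ₗ[ZMod 2] B) (U : Character C) : B.fst ∘ₗ pair β U = β := rfl

/-- The graph of a character. -/
def graph (U : Character B) : B →ₗ[ZMod 2] B.plus := pair LinearMap.id U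

/-- The homomorphism `α × id`. -/
def plusMap (α : C →ₗ[ZMod 2] B) : C.plus →ₗ[ZMod 2] B.plus := pair (α ∘ₗ C.fst) C.snd

/-- The character with kernel the graph of `U`. -/
def shift (U : Character B) : Character B.plus := U ∘ₗ B.fst + B.snd

end El₂

lemma Character.add_self {B : Type} [AddCommGroup B] [Module (ZMod 2) B] (U : Character B) :
    U + U = 0 := by
  ext b
  exact CharTwo.add_self_eq_zero (U b)

namespace GlobalGroupLaw

open El₂

variable (X : GlobalGroupLaw.{u}) {A B C : El₂}

/-- The generator of the kernel of the restriction along the graph of `U`. -/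
def E (U : Character B) : X.X.obj (op B.plus) := X.euler (shift U)

lemma rs_pair_E (U : Character B) (β : C →ₗ[ZMod 2] B) (W : Character C) :
    X.X.rs (pair β W) (X.E U) = X.euler (U ∘ₗ β + W) := X.rs_euler _ _

lemma rs_plusMap_E (U : Character B) (α : C →ₗ[ZMod 2] B) :
    X.X.rs (plusMap α) (X.E U) = X.E (U ∘ₗ α) := X.rs_euler _ _

lemma rs_graph_E (U : Character B) : X.X.rs (graph U) (X.E U) = 0 := by
  rw [graph, rs_pair_E, LinearMap.comp_id, Character.add_self, X.euler_zero]

lemma shift_apply_one (U : Character B) : shift U ((0, 1) : B × ZMod 2) = 1 := by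
  simp [shift, El₂.fst, El₂.snd]

lemma E_cancel (U : Character B) {x y : X.X.obj (op B.plus)} (h : X.E U * x = X.E U * y) : x = y :=
  X.euler_mul_cancel (A := B.plus) (shift_apply_one U) h

lemma exists_eq_rs_add (U : Character B) (x : X.X.obj (op B.plus)) :
    ∃ q, x = X.X.rs B.fst (X.X.rs (graph U) x) + X.E U * q := by
  obtain ⟨q, hq⟩ := X.exists_divDiff (A := B.plus) (shift U) _ (shift_apply_one U) x
  refine ⟨q, ?_⟩
  -- The kernel of `shift U` is the graph of `U`, and projecting onto it along the last coordinate
  -- vector first forgets that coordinate and then applies the graph.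
  have h : Character.projKer (shift U) ((0, 1) : B × ZMod 2) = graph U ∘ₗ B.fst := by
    refine LinearMap.ext fun c => ?_
    refine Prod.ext ?_ ?_
    · change c.1 - (U c.1 + c.2) • (0 : B) = c.1
      rw [smul_zero, sub_zero]
    · change c.2 - (U c.1 + c.2) • (1 : ZMod 2) = U c.1
      rw [smul_eq_mul, mul_one, CharTwo.sub_eq_add]
      rw [add_comm (U c.1), ← add_assoc, CharTwo.add_self_eq_zero, zero_add]
  rw [h, ← X.X.rs_rs] at hq
  rw [E, hq, add_sub_cancel]

/-- `U + W` and `W` agree on the kernel of `U`, so the difference of their Euler classes is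
divisible by that of `U`. This replaces a power series formula for the sum and yields continuity of
addition. -/
lemma euler_add_mem (U W : Character B) : ∃ g, X.euler (U + W) = X.euler W + X.euler U * g := by
  by_cases hU : U = 0
  · exact ⟨0, by rw [hU, zero_add, mul_zero, add_zero]⟩
  · obtain ⟨b, hb⟩ := Character.exists_eq_one hU
    obtain ⟨g, hg⟩ := X.exists_eq_euler_mul hb (x := X.euler (U + W) - X.euler W) (by
      have h : U ∘ₗ U.projKer b = 0 := by
        ext a
        simp [Character.projKer_apply, hb]
      rw [map_sub, X.rs_euler, X.rs_euler, LinearMap.add_comp, h, zero_add, sub_self])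
    exact ⟨g, by rw [← hg, add_sub_cancel]⟩

/-- The product of the classes `E U`. -/
def Eprod (s : Multiset (Character B)) : X.X.obj (op B.plus) := (s.map X.E).prod

/-- The base change datum for the restriction along `α × id`. -/
def baseChange (α : C →ₗ[ZMod 2] B) :
    letI := (X.X.rs α).toAlgebra
    letI := (X.X.rs B.fst).toAlgebra
    BaseChange.Datum (X.X.obj (op B)) (X.X.obj (op C)) (X.X.obj (op B.plus)) (X.X.obj (op C.plus))
      (Character B) :=
  letI := (X.X.rs α).toAlgebra
  letI := (X.X.rs B.fst).toAlgebra
  { E := X.E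
    θ := fun U => X.X.rs (graph U)
    θ_E := X.rs_graph_E
    exists_eq := X.exists_eq_rs_add
    a := X.X.rs C.fst
    b := X.X.rs (plusMap α)
    agree := fun c => (X.X.rs_rs _ _ _).trans (X.X.rs_rs B.fst (plusMap α) c).symm
    θ' := fun U => X.X.rs (graph (U ∘ₗ α))
    θ'_a := fun U c => (X.X.rs_rs _ _ _).trans (X.X.rs_id c)
    θ'_b := fun U x => (X.X.rs_rs _ _ _).trans (X.X.rs_rs (graph U) α x).symm
    exists_eq' := fun U x => by
      rw [rs_plusMap_E]
      exact X.exists_eq_rs_add (U ∘ₗ α) x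
    cancel := fun U x y h => by
      rw [rs_plusMap_E] at h
      exact X.E_cancel _ h }

variable {T : Type u} [CommRing T]

lemma exists_join (α : C →ₗ[ZMod 2] B) {g : X.X.obj (op C) →+* T} {f : X.X.obj (op B.plus) →+* T}
    (h : ∀ c, g (X.X.rs α c) = f (X.X.rs B.fst c)) {s : Multiset (Character B)}
    (hs : f (X.Eprod s) = 0) :
    ∃ Φ : X.X.obj (op C.plus) →+* T,
      (∀ c, Φ (X.X.rs C.fst c) = g c) ∧ ∀ x, Φ (X.X.rs (plusMap α) x) = f x :=
  letI := (X.X.rs α).toAlgebra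
  letI := (X.X.rs B.fst).toAlgebra
  (X.baseChange α).exists_lift h hs

lemma join_ext (α : C →ₗ[ZMod 2] B) {Φ Ψ : X.X.obj (op C.plus) →+* T}
    (h₁ : ∀ c, Φ (X.X.rs C.fst c) = Ψ (X.X.rs C.fst c))
    (h₂ : ∀ x, Φ (X.X.rs (plusMap α) x) = Ψ (X.X.rs (plusMap α) x))
    {s : Multiset (Character B)} (hs : Φ (X.X.rs (plusMap α) (X.Eprod s)) = 0) : Φ = Ψ :=
  letI := (X.X.rs α).toAlgebra
  letI := (X.X.rs B.fst).toAlgebra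
  (X.baseChange α).lift_ext h₁ h₂ hs

end GlobalGroupLaw

/-! ### The formal group laws associated with a global group law -/

/-- For fixed `i` the product of the `z i j` over `j` is congruent modulo `x i` to the product of
the `y j`, which is zero. So `x i` divides it, and the product of the `x i`, also zero, divides
everything. -/
lemma Multiset.prod_bind_eq_zero {ι κ R : Type*} [CommRing R] {x : ι → R} {y : κ → R}
    {z : ι → κ → R} {s : Multiset ι} {t : Multiset κ} (h : ∀ i j, ∃ g, z i j = y j + x i * g)
    (hx : (s.map x).prod = 0) (hy : (t.map y).prod = 0) :
    (s.bind fun i => t.map (z i)).prod = 0 := by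
  have h₁ (i : ι) (t : Multiset κ) : ∃ g, (t.map (z i)).prod = (t.map y).prod + x i * g := by
    induction t using Multiset.induction_on with
    | empty => exact ⟨0, by simp⟩
    | cons j t ih =>
      obtain ⟨g, hg⟩ := ih
      obtain ⟨g', hg'⟩ := h i j
      refine ⟨y j * g + g' * (t.map (z i)).prod, ?_⟩
      rw [Multiset.map_cons, Multiset.prod_cons, Multiset.map_cons, Multiset.prod_cons, hg']
      linear_combination y j * hg
  have h₂ (i : ι) : x i ∣ (t.map (z i)).prod := by
    obtain ⟨g, hg⟩ := h₁ i t
    exact ⟨g, by rw [hg, hy, zero_add]⟩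
  have h₃ (s : Multiset ι) : (s.map x).prod ∣ (s.bind fun i => t.map (z i)).prod := by
    rw [Multiset.prod_bind]
    induction s using Multiset.induction_on with
    | empty => simp
    | cons i s ih => simpa using mul_dvd_mul (h₂ i) ih
  exact zero_dvd_iff.1 (hx ▸ h₃ s)

namespace El₂

/-- The homomorphism `B × C₂ × C₂ → B × C₂` given by the addition of `C₂`. -/
def sumMap (B : El₂) : B.plus.plus →ₗ[ZMod 2] B.plus :=
  pair (B.fst ∘ₗ B.plus.fst) (B.snd ∘ₗ B.plus.fst + B.plus.snd)

end El₂

namespace GlobalGroupLaw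

open El₂

variable (X : GlobalGroupLaw.{u}) {A B : El₂} (α : B →ₗ[ZMod 2] A)

/-- The augmented algebra with underlying ring the value at `B × C₂` of a global group law and with
augmentations the restrictions along the graphs of the characters that factor through `α`. -/
@[reducible]
def augAlg : AugmentedAlgebra A (X.X.obj (op B)) where
  R := X.X.obj (op B.plus)
  algebra := (X.X.rs B.fst).toAlgebra
  θ V :=
    letI := (X.X.rs B.fst).toAlgebra
    { X.X.rs (graph (V ∘ₗ α)) with
      commutes' := fun c => (X.X.rs_rs _ _ _).trans (X.X.rs_id c) }

lemma span_E (V : Character A) :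
    Ideal.span {X.E (V ∘ₗ α)} = RingHom.ker ((X.augAlg α).θ V) := by
  refine le_antisymm ((Ideal.span_singleton_le_iff_mem _).2 (X.rs_graph_E _)) fun x hx => ?_
  obtain ⟨q, hq⟩ := X.exists_eq_rs_add (V ∘ₗ α) x
  have hx' : X.X.rs (graph (V ∘ₗ α)) x = 0 := hx
  rw [hx', map_zero, zero_add] at hq
  exact Ideal.mem_span_singleton.2 ⟨q, hq⟩

lemma augAlg_I (s : Multiset (Character A)) :
    (X.augAlg α).I s = Ideal.span {X.Eprod (s.map fun V => V ∘ₗ α)} := by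
  induction s using Multiset.induction_on with
  | empty => simp [Eprod, AugmentedAlgebra.I]
  | cons V s ih =>
    rw [Eprod, Multiset.map_cons, Multiset.map_cons, Multiset.prod_cons,
      ← Ideal.span_singleton_mul_span_singleton, span_E]
    change _ = _ * Ideal.span {X.Eprod _}
    rw [← ih]
    simp [AugmentedAlgebra.I]

variable {X α}
variable {T T' : Type u} [CommRing T] [CommRing T'] {η : X.X.obj (op B) →+* T}
  {η' : X.X.obj (op B) →+* T'}

lemma I_le_ker_iff {f : X.X.obj (op B.plus) →+* T} {s : Multiset (Character A)} :
    (X.augAlg α).I s ≤ RingHom.ker f ↔ f (X.Eprod (s.map fun V => V ∘ₗ α)) = 0 := by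
  rw [augAlg_I, Ideal.span_singleton_le_iff_mem, RingHom.mem_ker]

lemma pt_rs_fst (p : (X.augAlg α).Pt η) (c : X.X.obj (op B)) :
    p.hom (X.X.rs B.fst c) = η c := p.hom_algebraMap c

/-- Base change along `B × C₂ → B`: up to completion `X(B × C₂ × C₂)` is the tensor square of `X(B ×
C₂)` over `X(B)`. Here `plusMap B.fst` forgets the middle factor. -/
lemma exists_join_pt (p q : (X.augAlg α).Pt η) : ∃ Φ : X.X.obj (op B.plus.plus) →+* T,
    (∀ c, Φ (X.X.rs B.plus.fst c) = p.hom c) ∧ ∀ x, Φ (X.X.rs (plusMap B.fst) x) = q.hom x := by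
  obtain ⟨s, hs⟩ := q.cont
  exact X.exists_join B.fst (g := p.hom) (f := q.hom)
    (fun c => (pt_rs_fst p c).trans (pt_rs_fst q c).symm) (I_le_ker_iff.1 hs)

/-- The homomorphism determined by two points. -/
def join (p q : (X.augAlg α).Pt η) : X.X.obj (op B.plus.plus) →+* T :=
  (exists_join_pt p q).choose

lemma join_fst (p q : (X.augAlg α).Pt η) (c : X.X.obj (op B.plus)) :
    join p q (X.X.rs B.plus.fst c) = p.hom c := (exists_join_pt p q).choose_spec.1 c

lemma join_plusMap (p q : (X.augAlg α).Pt η) (x : X.X.obj (op B.plus)) :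
    join p q (X.X.rs (plusMap B.fst) x) = q.hom x := (exists_join_pt p q).choose_spec.2 x

lemma eq_join {p q : (X.augAlg α).Pt η} {Φ : X.X.obj (op B.plus.plus) →+* T}
    (h₁ : ∀ c, Φ (X.X.rs B.plus.fst c) = p.hom c)
    (h₂ : ∀ x, Φ (X.X.rs (plusMap B.fst) x) = q.hom x) : Φ = join p q := by
  obtain ⟨s, hs⟩ := q.cont
  refine X.join_ext B.fst (fun c => ?_) (fun x => ?_) (s := s.map fun V => V ∘ₗ α) ?_
  · rw [h₁, join_fst]
  · rw [h₂, join_plusMap]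
  · rw [h₂]
    exact I_le_ker_iff.1 hs

lemma exists_join_sumMap_E (p q : (X.augAlg α).Pt η) (V W : Character A) :
    ∃ g, join p q (X.X.rs B.sumMap (X.E ((V + W) ∘ₗ α))) =
      q.hom (X.E (W ∘ₗ α)) + p.hom (X.E (V ∘ₗ α)) * g := by
  have h : shift ((V + W) ∘ₗ α) ∘ₗ B.sumMap =
      shift (V ∘ₗ α) ∘ₗ B.plus.fst + shift (W ∘ₗ α) ∘ₗ plusMap B.fst := by
    refine LinearMap.ext fun c => ?_
    change V (α c.1.1) + W (α c.1.1) + (c.1.2 + c.2) =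
      (V (α c.1.1) + c.1.2) + (W (α c.1.1) + c.2)
    abel
  obtain ⟨g, hg⟩ := X.euler_add_mem (shift (V ∘ₗ α) ∘ₗ B.plus.fst)
    (shift (W ∘ₗ α) ∘ₗ plusMap B.fst)
  refine ⟨join p q g, ?_⟩
  rw [E, X.rs_euler, h, hg, map_add, map_mul, ← X.rs_euler, ← X.rs_euler, join_fst, join_plusMap]
  rfl

/-- The sum of two points. -/
def addPt (p q : (X.augAlg α).Pt η) : (X.augAlg α).Pt η where
  hom := (join p q).comp (X.X.rs B.sumMap)
  hom_algebraMap c := by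
    change join p q (X.X.rs B.sumMap (X.X.rs B.fst c)) = _
    rw [X.X.rs_rs, sumMap, fst_pair, ← X.X.rs_rs, join_fst, pt_rs_fst]
  cont := by
    obtain ⟨s, hs⟩ := p.cont
    obtain ⟨t, ht⟩ := q.cont
    -- By the congruence for sums of characters, if `p` kills the product over `s` and `q` the
    -- product over `t`, then their sum kills the product over all `V + W`.
    refine ⟨s.bind fun V => t.map fun W => V + W, I_le_ker_iff.2 ?_⟩
    have hs' := I_le_ker_iff.1 hs
    have ht' := I_le_ker_iff.1 ht
    rw [Eprod, Multiset.map_map, map_multiset_prod, Multiset.map_map] at hs' ht'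
    have h := Multiset.prod_bind_eq_zero (exists_join_sumMap_E p q) hs' ht'
    rw [Eprod, Multiset.map_map, map_multiset_prod, Multiset.map_map, Multiset.map_bind]
    simp only [Multiset.map_map]
    exact h

lemma addPt_hom (p q : (X.augAlg α).Pt η) (x : X.X.obj (op B.plus)) :
    (addPt p q).hom x = join p q (X.X.rs B.sumMap x) := rfl

/-- A joined map is determined by its two restrictions, so any `Φ` with these restrictions computes
the sum. The group laws then reduce to identities of linear maps between groups `B × C₂ⁿ`. -/
lemma addPt_eq {p q r : (X.augAlg α).Pt η} {Φ : X.X.obj (op B.plus.plus) →+* T}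
    (h₁ : ∀ c, Φ (X.X.rs B.plus.fst c) = p.hom c)
    (h₂ : ∀ x, Φ (X.X.rs (plusMap B.fst) x) = q.hom x)
    (h₃ : ∀ x, Φ (X.X.rs B.sumMap x) = r.hom x) : addPt p q = r := by
  refine Pt.ext (RingHom.ext fun x => ?_)
  rw [addPt_hom, ← eq_join h₁ h₂]
  exact h₃ x

lemma addPt_over (φ : T →+* T') {p q : (X.augAlg α).Pt η} {p' q' : (X.augAlg α).Pt η'}
    (hp : ∀ a, φ (p.hom a) = p'.hom a) (hq : ∀ a, φ (q.hom a) = q'.hom a)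
    (a : X.X.obj (op B.plus)) : φ ((addPt p q).hom a) = (addPt p' q').hom a := by
  have h : φ.comp (join p q) = join p' q' := eq_join
    (fun c => by rw [RingHom.comp_apply, join_fst, hp])
    (fun c => by rw [RingHom.comp_apply, join_plusMap, hq])
  rw [addPt_hom, addPt_hom, ← h, RingHom.comp_apply]

lemma addPt_comm (p q : (X.augAlg α).Pt η) : addPt p q = addPt q p := by
  let swap : B.plus.plus →ₗ[ZMod 2] B.plus.plus :=
    pair (plusMap B.fst) (B.snd ∘ₗ B.plus.fst)
  refine addPt_eq (Φ := (join q p).comp (X.X.rs swap)) (fun c => ?_) (fun x => ?_) fun x => ?_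
  · rw [RingHom.comp_apply, X.X.rs_rs]
    exact join_plusMap q p c
  · rw [RingHom.comp_apply, X.X.rs_rs]
    exact join_fst q p x
  · rw [RingHom.comp_apply, X.X.rs_rs, addPt_hom]
    have h : B.sumMap ∘ₗ swap = B.sumMap := LinearMap.ext fun (c : (B × ZMod 2) × ZMod 2) =>
      Prod.ext rfl (add_comm c.2 c.1.2)
    rw [h]

lemma addPt_assoc (p q r : (X.augAlg α).Pt η) :
    addPt (addPt p q) r = addPt p (addPt q r) := by
  obtain ⟨s, hs⟩ := r.cont
  -- `Ψ` is the map from `X(B × C₂ × C₂ × C₂)` determined by all three points; restricting it along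
  -- the two ways of adding neighbouring factors gives the two bracketings.
  obtain ⟨Ψ, h₁, h₂⟩ := X.exists_join (B.fst ∘ₗ B.plus.fst) (g := join p q) (f := r.hom)
    (fun c => by rw [← X.X.rs_rs, join_fst, pt_rs_fst, pt_rs_fst]) (I_le_ker_iff.1 hs)
  let drop₁ : B.plus.plus.plus →ₗ[ZMod 2] B.plus.plus :=
    pair (plusMap B.fst ∘ₗ B.plus.plus.fst) B.plus.plus.snd
  let add₂₃ : B.plus.plus.plus →ₗ[ZMod 2] B.plus.plus :=
    pair (B.plus.fst ∘ₗ B.plus.plus.fst) (B.plus.snd ∘ₗ B.plus.plus.fst + B.plus.plus.snd)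
  have hqr : Ψ.comp (X.X.rs drop₁) = join q r := eq_join
    (fun c => by
      rw [RingHom.comp_apply, X.X.rs_rs]
      refine Eq.trans ?_ (join_plusMap p q c)
      rw [← h₁, X.X.rs_rs]
      rfl)
    (fun x => by
      rw [RingHom.comp_apply, X.X.rs_rs]
      exact h₂ x)
  refine addPt_eq (Φ := Ψ.comp (X.X.rs (plusMap B.sumMap))) (fun c => ?_) (fun x => ?_) fun x => ?_
  · rw [RingHom.comp_apply, X.X.rs_rs, addPt_hom, ← h₁, X.X.rs_rs]
    rfl
  · rw [RingHom.comp_apply, X.X.rs_rs]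
    exact h₂ x
  · have h : Ψ.comp (X.X.rs add₂₃) = join p (addPt q r) := eq_join
      (fun c => by
        rw [RingHom.comp_apply, X.X.rs_rs, ← join_fst p q, ← h₁, X.X.rs_rs]
        rfl)
      (fun x => by
        rw [RingHom.comp_apply, X.X.rs_rs, addPt_hom, ← hqr, RingHom.comp_apply, X.X.rs_rs]
        rfl)
    rw [addPt_hom, ← h, RingHom.comp_apply, RingHom.comp_apply, X.X.rs_rs, X.X.rs_rs]
    have h : B.sumMap ∘ₗ plusMap B.sumMap = B.sumMap ∘ₗ add₂₃ :=
      LinearMap.ext fun (c : ((B × ZMod 2) × ZMod 2) × ZMod 2) =>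
        Prod.ext rfl (add_assoc c.1.1.2 c.1.2 c.2)
    rw [h]

lemma zero_addPt (p : (X.augAlg α).Pt η) : addPt (Pt.ofθ _ η 0) p = p := by
  let j : B.plus →ₗ[ZMod 2] B.plus.plus := pair (pair B.fst 0) B.snd
  refine addPt_eq (Φ := p.hom.comp (X.X.rs j)) (fun c => ?_) (fun x => ?_) fun x => ?_
  · change p.hom (X.X.rs j (X.X.rs B.plus.fst c)) = η (X.X.rs (graph ((0 : Character A) ∘ₗ α)) c)
    rw [X.X.rs_rs, ← pt_rs_fst p, X.X.rs_rs]
    rfl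
  · change p.hom (X.X.rs j (X.X.rs (plusMap B.fst) x)) = _
    rw [X.X.rs_rs]
    exact congrArg p.hom (X.X.rs_id x)
  · change p.hom (X.X.rs j (X.X.rs B.sumMap x)) = _
    rw [X.X.rs_rs]
    have h : B.sumMap ∘ₗ j = LinearMap.id :=
      LinearMap.ext fun c => Prod.ext rfl (zero_add c.2)
    rw [h, X.X.rs_id]

lemma addPt_self (p : (X.augAlg α).Pt η) : addPt p p = Pt.ofθ _ η 0 := by
  let j : B.plus →ₗ[ZMod 2] B.plus.plus := pair LinearMap.id B.snd
  refine addPt_eq (Φ := p.hom.comp (X.X.rs j)) (fun c => ?_) (fun x => ?_) fun x => ?_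
  · change p.hom (X.X.rs j (X.X.rs B.plus.fst c)) = _
    rw [X.X.rs_rs]
    exact congrArg p.hom (X.X.rs_id c)
  · change p.hom (X.X.rs j (X.X.rs (plusMap B.fst) x)) = _
    rw [X.X.rs_rs]
    exact congrArg p.hom (X.X.rs_id x)
  · change p.hom (X.X.rs j (X.X.rs B.sumMap x)) = η (X.X.rs (graph ((0 : Character A) ∘ₗ α)) x)
    rw [X.X.rs_rs, ← pt_rs_fst p, X.X.rs_rs]
    have h : B.sumMap ∘ₗ j = graph ((0 : Character A) ∘ₗ α) ∘ₗ B.fst :=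
      LinearMap.ext fun (c : B × ZMod 2) => Prod.ext rfl (CharTwo.add_self_eq_zero c.2)
    rw [h]

lemma addPt_ofθ (η : X.X.obj (op B) →+* T) (V W : Character A) :
    addPt (Pt.ofθ (X.augAlg α) η V) (Pt.ofθ (X.augAlg α) η W) = Pt.ofθ _ η (V + W) := by
  let j : B →ₗ[ZMod 2] B.plus.plus := pair (graph (V ∘ₗ α)) (W ∘ₗ α)
  refine addPt_eq (Φ := η.comp (X.X.rs j)) (fun c => ?_) (fun x => ?_) fun x => ?_
  · change η (X.X.rs j (X.X.rs B.plus.fst c)) = η (X.X.rs (graph (V ∘ₗ α)) c)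
    rw [X.X.rs_rs]
    rfl
  · change η (X.X.rs j (X.X.rs (plusMap B.fst) x)) = η (X.X.rs (graph (W ∘ₗ α)) x)
    rw [X.X.rs_rs]
    rfl
  · change η (X.X.rs j (X.X.rs B.sumMap x)) = η (X.X.rs (graph ((V + W) ∘ₗ α)) x)
    rw [X.X.rs_rs]
    rfl

variable (X α)

/-- The formal law at `B × C₂` of a global group law. -/
@[reducible]
def formalLaw : FormalLaw A (X.X.obj (op B)) where
  toAugmentedAlgebra := X.augAlg α
  E V := X.E (V ∘ₗ α)
  E_regular V := mem_nonZeroDivisors_iff_right.2 fun x hx => X.E_cancel (V ∘ₗ α) (by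
    rw [mul_zero, mul_comm]
    exact hx)
  span_E := X.span_E α
  add := addPt
  add_over := addPt_over
  add_comm := addPt_comm
  add_assoc := addPt_assoc
  zero_add := zero_addPt
  add_self := addPt_self
  add_ofθ := addPt_ofθ

/-- The `A`-equivariant formal group law over `X(B)` associated with a global group law `X` and a
homomorphism `α : B → A`. -/
def fgl : EquivariantFGL A (X.X.obj (op B)) := (X.formalLaw α).completed

lemma fgl_isTwoTorsion : (X.fgl α).IsTwoTorsion := (X.formalLaw α).completed_isTwoTorsion

lemma fgl_euler (V : Character A) : (X.fgl α).euler V = X.euler (V ∘ₗ α) := by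
  change X.X.rs (graph (V ∘ₗ α)) (X.E ((0 : Character A) ∘ₗ α)) = _
  rw [graph, rs_pair_E, LinearMap.zero_comp, LinearMap.zero_comp, zero_add]

end GlobalGroupLaw

/-! ### Functoriality of the associated formal group laws -/

namespace GlobalGroupLaw

open El₂

variable (X : GlobalGroupLaw.{u}) {A A' B B' : El₂}

section Map

variable {α : B →ₗ[ZMod 2] A} {α' : B' →ₗ[ZMod 2] A'} {γ : B' →ₗ[ZMod 2] B} {δ : A →ₗ[ZMod 2] A'}
  {f : X.X.obj (op B) →+* X.X.obj (op B')} (hα : δ ∘ₗ α ∘ₗ γ = α') (hf : ∀ c, f c = X.X.rs γ c)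

/-- The restriction along `γ × id` as a map of formal laws. -/
def preMap : FormalLaw.PreMap (X.formalLaw α) (X.fgl α') δ f where
  φ := (X.formalLaw α').toHat.comp (X.X.rs (plusMap γ))
  map_algebraMap c := by
    rw [hf]
    exact congrArg (X.formalLaw α').toHat
      ((X.X.rs_rs B.fst (plusMap γ) c).trans (X.X.rs_rs γ B'.fst c).symm)
  map_θ V x := by
    rw [hf]
    subst hα
    exact (X.X.rs_rs (plusMap γ) (graph (V ∘ₗ δ ∘ₗ α ∘ₗ γ)) x).trans
      (X.X.rs_rs (graph ((V ∘ₗ δ) ∘ₗ α)) γ x).symm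
  map_E := congrArg (X.formalLaw α').toHat (X.rs_plusMap_E ((0 : Character A) ∘ₗ α) γ)

/-- The addition map of `C₂` commutes with `γ`, so the map joined from `p` and `q`, restricted along
`γ × id × id`, joins the pulled-back points. -/
lemma preMap_pull_add {T : Type u} [CommRing T] {η : X.X.obj (op B') →+* T}
    (p q : (X.fgl α').Pt η) :
    (X.preMap hα hf).pull (p + q) =
      addPt ((X.preMap hα hf).pull p) ((X.preMap hα hf).pull q) := by
  have hpq : FormalLaw.ptRes (p + q) = addPt (FormalLaw.ptRes p) (FormalLaw.ptRes q) :=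
    (X.formalLaw α').ptRes_add p q
  refine (addPt_eq (Φ := (join (FormalLaw.ptRes p) (FormalLaw.ptRes q)).comp
    (X.X.rs (plusMap (plusMap γ)))) (fun c => ?_) (fun x => ?_) fun x => ?_).symm
  · rw [RingHom.comp_apply, X.X.rs_rs]
    refine Eq.trans ?_ (join_fst (FormalLaw.ptRes p) (FormalLaw.ptRes q) (X.X.rs (plusMap γ) c))
    rw [X.X.rs_rs]
    rfl
  · rw [RingHom.comp_apply, X.X.rs_rs]
    refine Eq.trans ?_
      (join_plusMap (FormalLaw.ptRes p) (FormalLaw.ptRes q) (X.X.rs (plusMap γ) x))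
    rw [X.X.rs_rs]
    rfl
  · refine Eq.trans ?_ (RingHom.congr_fun (congrArg Pt.hom hpq) (X.X.rs (plusMap γ) x)).symm
    rw [addPt_hom, RingHom.comp_apply, X.X.rs_rs, X.X.rs_rs]
    rfl

/-- The morphism of formal group laws given by restriction. -/
def fglMap : EquivariantFGL.HomOver δ f (X.fgl α) (X.fgl α') :=
  (X.preMap hα hf).homOver (X.preMap_pull_add hα hf)

lemma fglMap_toHat (x : X.X.obj (op B.plus)) :
    (X.fglMap hα hf).φ ((X.formalLaw α).toHat x) =
      (X.formalLaw α').toHat (X.X.rs (plusMap γ) x) :=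
  (X.preMap hα hf).extendφ_toHat x

end Map

section Pushforward

variable (α : B →ₗ[ZMod 2] A)

/-- The completion map from `X(B × C₂)`. -/
def toFGL : X.X.obj (op B.plus) →+* (X.fgl α).R := (X.formalLaw α).toHat

/-- The morphism of formal group laws over `X(B)` induced by `α`. -/
def fglPush : EquivariantFGL.HomOver α (RingHom.id _) (X.fgl (LinearMap.id : B →ₗ[ZMod 2] B))
    (X.fgl α) :=
  X.fglMap (γ := LinearMap.id) rfl fun c => (X.X.rs_id c).symm

lemma fglPush_toFGL (x : X.X.obj (op B.plus)) :
    (X.fglPush α).φ (X.toFGL LinearMap.id x) = X.toFGL α x :=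
  (X.fglMap_toHat _ _ x).trans (congrArg (X.formalLaw α).toHat (X.X.rs_id x))

lemma toFGL_mem_I {s : Multiset (Character A)} {x : X.X.obj (op B.plus)} :
    X.toFGL α x ∈ (X.fgl α).I s ↔ x ∈ Ideal.span {X.Eprod (s.map fun V => V ∘ₗ α)} := by
  change (X.formalLaw α).toHat x ∈ (X.formalLaw α).hatAlg.I s ↔ _
  rw [FormalLaw.hatAlg_I, RingHom.mem_ker, FormalLaw.projHat_toHat, Ideal.Quotient.eq_zero_iff_mem,
    ← augAlg_I]

lemma exists_sub_toFGL_mem (s : Multiset (Character A)) (y : (X.fgl α).R) :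
    ∃ r, y - X.toFGL α r ∈ (X.fgl α).I s := by
  obtain ⟨r, hr⟩ := Ideal.Quotient.mk_surjective ((X.formalLaw α).projHat s y)
  refine ⟨r, ?_⟩
  have h : y - X.toFGL α r ∈ RingHom.ker ((X.formalLaw α).projHat s) :=
    (map_sub ((X.formalLaw α).projHat s) y ((X.formalLaw α).toHat r)).trans
      (sub_eq_zero.2 hr.symm)
  rw [← FormalLaw.hatAlg_I] at h
  exact h

/-- Both algebras are completions of `X(B × C₂)`, and the quotients to be compared are both
quotients of that ring by the same principal ideal. -/
lemma fgl_isPushforward :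
    EquivariantFGL.IsPushforward α (X.fgl (LinearMap.id : B →ₗ[ZMod 2] B)) (X.fgl α) := by
  refine ⟨X.fglPush α, fun s => ⟨?_, fun y => ?_⟩⟩
  · refine (injective_iff_map_eq_zero _).2 fun x hx => ?_
    obtain ⟨x, rfl⟩ := Ideal.Quotient.mk_surjective x
    obtain ⟨r, hr⟩ := X.exists_sub_toFGL_mem LinearMap.id (s.map fun V => V ∘ₗ α) x
    rw [Ideal.quotientMap_mk, Ideal.Quotient.eq_zero_iff_mem] at hx
    have h1 := (X.fglPush α).I_le_comap s hr
    rw [Ideal.mem_comap, map_sub (X.fglPush α).φ, fglPush_toFGL] at h1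
    have h2 := (Submodule.sub_mem_iff_right _ hx).1 h1
    rw [toFGL_mem_I] at h2
    have h3 : X.toFGL LinearMap.id r ∈
        (X.fgl (LinearMap.id : B →ₗ[ZMod 2] B)).I (s.map fun V => V ∘ₗ α) := by
      rw [toFGL_mem_I, Multiset.map_map]
      exact h2
    rw [Ideal.Quotient.eq_zero_iff_mem]
    exact (Submodule.sub_mem_iff_left _ h3).1 hr
  · obtain ⟨y, rfl⟩ := Ideal.Quotient.mk_surjective y
    obtain ⟨r, hr⟩ := X.exists_sub_toFGL_mem α s y
    refine ⟨Ideal.Quotient.mk _ (X.toFGL LinearMap.id r), ?_⟩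
    rw [Ideal.quotientMap_mk, fglPush_toFGL]
    exact (Ideal.Quotient.eq.2 hr).symm

/-- The morphism of `A`-equivariant formal group laws over the restriction along `α`. -/
def fglRes : EquivariantFGL.HomOver (LinearMap.id : A →ₗ[ZMod 2] A) (X.X.rs α)
    (X.fgl (LinearMap.id : A →ₗ[ZMod 2] A)) (X.fgl α) :=
  X.fglMap (γ := α) rfl fun _ => rfl

end Pushforward

end GlobalGroupLaw

/-! ### The universal formal group laws -/

/-- The 2-torsion `A`-equivariant formal group law over the value at `A` of the initial global group
law. -/
def lazardFGL (A : El₂) : EquivariantFGL A (Laz.{u} A) := lazard.{u}.fgl LinearMap.id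

lemma lazardFGL_isTwoTorsion (A : El₂) : (lazardFGL.{u} A).IsTwoTorsion :=
  lazard.fgl_isTwoTorsion _

/-- The law `fgl α` receives a morphism from the one at `B` over the identity and one from the one
at `A` over restriction. Its classifying map, computed through each, gives the two sides. -/
lemma classify_lazardFGL_rs {A B : El₂} (α : B →ₗ[ZMod 2] A) (z : Laz.{u} A) :
    EquivariantFGL.classify (lazardFGL_isTwoTorsion B) (lazard.X.rs α z) =
      lazard.X.rs α (EquivariantFGL.classify (lazardFGL_isTwoTorsion A) z) := by
  have h₁ := EquivariantFGL.classify_homOver (lazardFGL_isTwoTorsion B)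
    (lazard.{u}.fgl_isTwoTorsion α) (lazard.{u}.fglPush α) z
  have h₂ := EquivariantFGL.classify_homOver (lazardFGL_isTwoTorsion A)
    (lazard.{u}.fgl_isTwoTorsion α) (lazard.{u}.fglRes α) z
  rw [lazard.X.rs_id] at h₂
  exact h₁.symm.trans h₂

/-- The classifying homomorphisms of the universal formal group laws as an endomorphism of the
initial global group law. -/
def classifyLazardFGL : lazard.{u}.LawHom lazard.{u} where
  app A := EquivariantFGL.classify (lazardFGL_isTwoTorsion A)
  naturality α z := classify_lazardFGL_rs α z
  app_e := by
    have h := EquivariantFGL.classify_euler (A := C₂) (lazardFGL_isTwoTorsion.{u} C₂)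
      (LinearMap.id : ZMod 2 →ₗ[ZMod 2] ZMod 2)
    rw [lazard.{u}.euler_id] at h
    exact h.trans ((lazard.{u}.fgl_euler (A := C₂) LinearMap.id LinearMap.id).trans lazard.euler_id)

/-- The identity of a global group law. -/
def GlobalGroupLaw.LawHom.id (X : GlobalGroupLaw.{u}) : X.LawHom X where
  app _ := RingHom.id _
  naturality _ _ := rfl
  app_e := rfl

/-- The classifying maps for varying `A` form an endomorphism of the initial law, and the identity
is the only one. -/
lemma classify_lazardFGL (A : El₂) (z : Laz.{u} A) :
    EquivariantFGL.classify (lazardFGL_isTwoTorsion A) z = z :=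
  RingHom.congr_fun (InitialLaw.hom_ext classifyLazardFGL (LawHom.id lazard.{u}) A) z

/-! ### Universality of the formal group law over the initial law -/

namespace EquivariantFGL

open El₂

section Extend

variable {A : Type} [AddCommGroup A] [Module (ZMod 2) A] {k : Type u} [CommRing k]
  {G : EquivariantFGL A k} (hG : G.IsTwoTorsion) {B : El₂}
  {T T' : Type u} [CommRing T] [CommRing T'] {η' : k →+* T'} {η : k →+* T}

/-- The extension of a homomorphism from the characters of `B` to the characters of `B × C₂`, with
the given value at the second projection. -/
def extendPt (x : Character B →+ G.Pt η) (p : G.Pt η) : Character B.plus →+ G.Pt η :=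
  Character.twist ((0, 1) : B × ZMod 2) (x.comp (Character.comap (graph (0 : Character B)))) p
    (G.add_self hG p)

lemma extendPt_fst (x : Character B →+ G.Pt η) (p : G.Pt η) (V : Character B) :
    extendPt hG x p (V ∘ₗ B.fst) = x V := by
  change x V + ite (V 0 = 0) 0 p = x V
  rw [if_pos (_root_.map_zero V), add_zero]

lemma extendPt_snd (x : Character B →+ G.Pt η) (p : G.Pt η) : extendPt hG x p B.snd = p := by
  change x 0 + ite ((1 : ZMod 2) = 0) 0 p = p
  rw [if_neg one_ne_zero, _root_.map_zero, zero_add]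

/-- Every character of `B × C₂` is one pulled back from `B` plus a multiple of the second
projection. -/
lemma plus_hom_ext {M : Type*} [AddCommMonoid M] {x x' : Character B.plus →+ M}
    (h₁ : ∀ V : Character B, x (V ∘ₗ B.fst) = x' (V ∘ₗ B.fst)) (h₂ : x B.snd = x' B.snd) :
    x = x' := by
  refine AddMonoidHom.ext fun W => ?_
  have hW : W = (W ∘ₗ graph (0 : Character B)) ∘ₗ B.fst + W ((0, 1) : B × ZMod 2) • B.snd := by
    refine LinearMap.ext fun (c : B × ZMod 2) => ?_
    change W c = W ((c.1, 0) : B × ZMod 2) + W ((0, 1) : B × ZMod 2) * c.2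
    rw [mul_comm, ← smul_eq_mul, ← _root_.map_smul, ← _root_.map_add]
    congr 1
    refine Prod.ext ?_ ?_
    · change c.1 = c.1 + c.2 • (0 : B)
      rw [smul_zero, add_zero]
    · change c.2 = 0 + c.2 * 1
      rw [mul_one, zero_add]
  rw [hW, _root_.map_add, _root_.map_add, h₁]
  congr 1
  rcases ZMod.eq_zero_or_one (W ((0, 1) : B × ZMod 2)) with h | h
  · rw [h, zero_smul, _root_.map_zero, _root_.map_zero]
  · rw [h, one_smul, h₂]

lemma extendPt_comap_fst (x : Character B →+ G.Pt η) (p : G.Pt η) :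
    (extendPt hG x p).comp (Character.comap B.fst) = x :=
  AddMonoidHom.ext fun V => extendPt_fst hG x p V

lemma extendPt_comap_plusMap (x : Character B →+ G.Pt η) (p q : G.Pt η) :
    (extendPt hG (extendPt hG x p) q).comp (Character.comap (plusMap B.fst)) =
      extendPt hG x q := by
  refine plus_hom_ext (fun V => ?_) ?_
  · change extendPt hG (extendPt hG x p) q ((V ∘ₗ B.fst) ∘ₗ B.plus.fst) = _
    rw [extendPt_fst, extendPt_fst, extendPt_fst]
  · change extendPt hG (extendPt hG x p) q B.plus.snd = _
    rw [extendPt_snd, extendPt_snd]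

/-- Pulling the last coordinate back along the addition of `C₂` gives the sum of the last two
coordinates, hence the sum of the points adjoined there. This makes the classifying map compatible
with addition of points. -/
lemma extendPt_comap_sumMap (x : Character B →+ G.Pt η) (p q : G.Pt η) :
    (extendPt hG (extendPt hG x p) q).comp (Character.comap B.sumMap) =
      extendPt hG x (p + q) := by
  refine plus_hom_ext (fun V => ?_) ?_
  · change extendPt hG (extendPt hG x p) q ((V ∘ₗ B.fst) ∘ₗ B.plus.fst) = _
    rw [extendPt_fst, extendPt_fst, extendPt_fst]
  · change extendPt hG (extendPt hG x p) q (B.snd ∘ₗ B.plus.fst + B.plus.snd) = _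
    rw [_root_.map_add, extendPt_fst, extendPt_snd, extendPt_snd, extendPt_snd]

lemma extendPt_over {φ : T →+* T'} {x : Character B →+ G.Pt η} {x' : Character B →+ G.Pt η'}
    {p : G.Pt η} {p' : G.Pt η'} (hx : ∀ W a, φ ((x W).hom a) = (x' W).hom a)
    (hp : ∀ a, φ (p.hom a) = p'.hom a) (W : Character B.plus) (a : G.R) :
    φ ((extendPt hG x p W).hom a) = (extendPt hG x' p' W).hom a :=
  over_twist (x := x.comp (Character.comap (graph (0 : Character B))))
    (x' := x'.comp (Character.comap (graph (0 : Character B)))) (ht := G.add_self hG p)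
    (ht' := G.add_self hG p') (fun W a => hx (W ∘ₗ graph (0 : Character B)) a) hp W a

end Extend

section Universal

variable {A : El₂} {k : Type u} [CommRing k] {G : EquivariantFGL A k} (hG : G.IsTwoTorsion)
variable {T T' : Type u} [CommRing T] [CommRing T'] {η' : k →+* T'} {η : k →+* T}

/-- The function on points defined by an element of the value at `A × C₂` of the initial global
group law. -/
def lazAt (p : G.Pt η) : Laz.{u} A.plus →+* T := evalPt hG (extendPt hG (G.θPt η) p)

lemma lazAt_over {φ : T →+* T'} {p : G.Pt η} {p' : G.Pt η'} (h : ∀ a, φ (p.hom a) = p'.hom a)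
    (z : Laz.{u} A.plus) : φ (lazAt hG p z) = lazAt hG p' z := by
  have hη := comp_eq_of_over h
  subst hη
  exact evalPt_over hG (extendPt_over hG (fun W a => rfl) h) z

/-- The homomorphism to the algebra of a formal group law classifying the universal point. -/
def lazHat : Laz.{u} A.plus →+* Completion G.I :=
  RingHom.codRestrict (RingHom.pi fun s => lazAt hG (G.tautPt s)) (Completion G.I)
    fun z _ _ h => lazAt_over hG (φ := Ideal.Quotient.factor h) (fun _ => rfl) z

lemma hom_unhat_lazHat (p : G.Pt η) (z : Laz.{u} A.plus) :
    p.hom (G.unhat (lazHat hG z)) = lazAt hG p z := by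
  rw [hom_unhat]
  exact lazAt_over hG (p := G.tautPt p.cont.choose) (p' := p)
    (φ := Ideal.Quotient.lift _ p.hom fun _ ha => p.cont.choose_spec ha) (fun _ => rfl) z

lemma lazAt_fst (p : G.Pt η) (c : Laz.{u} A) :
    lazAt hG p (lazard.X.rs A.fst c) = η (classify hG c) := by
  rw [lazAt, evalPt_rs, extendPt_comap_fst, classify]
  exact (evalPt_over hG (fun _ _ => rfl) c).symm

/-- Adjoining the point `θ(V)` to the augmentation homomorphism is the same as restricting that
homomorphism along the graph of `V`. -/
lemma lazAt_θPt (V : Character A) (z : Laz.{u} A.plus) :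
    lazAt hG (G.θPt (RingHom.id k) V) z = classify hG (lazard.X.rs (graph V) z) := by
  have h : extendPt hG (G.θPt (RingHom.id k)) (G.θPt (RingHom.id k) V) =
      (G.θPt (RingHom.id k)).comp (Character.comap (graph V)) :=
    plus_hom_ext (fun W => extendPt_fst hG _ _ W) (extendPt_snd hG _ _)
  rw [lazAt, classify, evalPt_rs, h]

lemma lazAt_E_zero (p : G.Pt η) : lazAt hG p (lazard.E 0) = p.hom G.y := by
  have h : extendPt hG (G.θPt η) p (shift (0 : Character A)) = p := by
    rw [shift, _root_.map_add, extendPt_fst, extendPt_snd, _root_.map_zero, zero_add]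
  rw [lazAt, E, evalPt_euler, h]

/-- The homomorphism from the value at `A × C₂` of the initial global group law to the algebra of
a 2-torsion `A`-equivariant formal group law. -/
def lazPreMap : FormalLaw.PreMap (lazard.{u}.formalLaw (LinearMap.id : A →ₗ[ZMod 2] A)) G
    LinearMap.id (classify hG) where
  φ := G.unhat.comp (lazHat hG)
  map_algebraMap c := eq_of_points fun T _ η p => by
    refine (hom_unhat_lazHat hG p _).trans ((lazAt_fst hG p c).trans ?_)
    rw [p.hom_algebraMap]
  map_θ V x :=
    (hom_unhat_lazHat hG (G.θPt (RingHom.id k) V) x).trans (lazAt_θPt hG V x)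
  map_E := eq_of_points fun T _ η p =>
    (hom_unhat_lazHat hG p _).trans (lazAt_E_zero hG p)

lemma lazPreMap_pull_add (p q : G.Pt η) :
    (lazPreMap hG).pull (p + q) = addPt ((lazPreMap hG).pull p) ((lazPreMap hG).pull q) := by
  have aux (p : G.Pt η) (z : Laz.{u} A.plus) : ((lazPreMap hG).pull p).hom z = lazAt hG p z :=
    hom_unhat_lazHat hG p z
  refine (addPt_eq (Φ := evalPt hG (extendPt hG (extendPt hG (G.θPt η) p) q))
    (fun c => ?_) (fun x => ?_) fun x => ?_).symm
  · exact (evalPt_rs hG _ _ c).trans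
      ((congrArg (evalPt hG · c) (extendPt_comap_fst hG _ q)).trans (aux p c).symm)
  · exact (evalPt_rs hG _ _ x).trans
      ((congrArg (evalPt hG · x) (extendPt_comap_plusMap hG _ p q)).trans (aux q x).symm)
  · exact (evalPt_rs hG _ _ x).trans
      ((congrArg (evalPt hG · x) (extendPt_comap_sumMap hG _ p q)).trans (aux (p + q) x).symm)

/-- The morphism from the universal formal group law. -/
def fromLazardFGL : HomOver (LinearMap.id : A →ₗ[ZMod 2] A) (classify hG) (lazardFGL.{u} A) G :=
  (lazPreMap hG).homOver (lazPreMap_pull_add hG)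

end Universal

end EquivariantFGL

/-- The ground ring map of any morphism must be `classify hG`, because the classifying map of the
source is the identity. The map of algebras over it is then unique by `homOver_ext`. -/
lemma lazardFGL_isUniversal (A : El₂) : (lazardFGL.{u} A).IsUniversalTwoTorsion := by
  refine ⟨lazardFGL_isTwoTorsion A, fun k' _ G hG =>
    ⟨⟨⟨⟨_, EquivariantFGL.fromLazardFGL hG⟩⟩, fun ⟨f, g⟩ => ?_⟩⟩⟩
  have hf : f = EquivariantFGL.classify hG := RingHom.ext fun z => by
    rw [EquivariantFGL.classify_homOver (lazardFGL_isTwoTorsion A) hG g, lazard.X.rs_id,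
      classify_lazardFGL]
  subst hf
  exact congrArg (Sigma.mk _) (EquivariantFGL.homOver_ext (lazardFGL_isTwoTorsion A) _ _)

/-- The global Lazard ring whose underlying functor is the initial global group law. -/
def lazardRing : GlobalLazardRing.{u} where
  L := lazard.X
  F := lazardFGL
  universal := lazardFGL_isUniversal
  res_classifies α := ⟨lazard.fgl α.hom.hom, lazard.fgl_isPushforward _, ⟨lazard.fglRes _⟩⟩

/-! ### Comparison of the global Lazard ring with the initial global group law -/

namespace EquivariantFGL

/-- Doubling may be tested on points, and the pull-back of points is additive and carries the
coordinate of `G` to that of `F`. It is needed for push-forwards, for which 2-torsion is not part of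
the data. -/
lemma HomOver.isTwoTorsion {A B : Type} [AddCommGroup A] [Module (ZMod 2) A] [AddCommGroup B]
    [Module (ZMod 2) B] {k k' : Type u} [CommRing k] [CommRing k'] {α : B →ₗ[ZMod 2] A}
    {f : k →+* k'} {F : EquivariantFGL B k} {G : EquivariantFGL A k'} (g : HomOver α f F G)
    (hF : F.IsTwoTorsion) : G.IsTwoTorsion := by
  refine G.completion_I_ext fun T _ η p => ?_
  refine (Pt.hat₁_mulHat p _).trans (Eq.trans ?_ (_root_.map_zero p.hat₁).symm)
  change (p + p).hom G.y = 0
  rw [← g.map_y]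
  change (g.pull η (p + p)).hom F.y = 0
  rw [_root_.map_add, F.add_self hF, F.zero_y]

/-- The inverse is the ground ring map of the morphism from `F` to `lazardFGL A`. One composite is
the classifying map of `lazardFGL A`, hence the identity; the other underlies an endomorphism of the
initial object `F`. -/
lemma classify_bijective {A : El₂} {k : Type u} [CommRing k] {F : EquivariantFGL A k}
    (hF : F.IsUniversalTwoTorsion) : Function.Bijective (classify hF.1) := by
  obtain ⟨⟨⟨⟨f, g⟩⟩, -⟩⟩ := hF.2 _ (lazardFGL A) (lazardFGL_isTwoTorsion A)
  refine Function.bijective_iff_has_inverse.2 ⟨f, fun z => ?_, fun c => ?_⟩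
  · have h := classify_homOver hF.1 (lazardFGL_isTwoTorsion A) g z
    rw [lazard.X.rs_id, classify_lazardFGL] at h
    exact h.symm
  · obtain ⟨hu⟩ := hF.2 _ F hF.1
    have h := hu.eq_default ⟨_, (fromLazardFGL hF.1).comp g rfl⟩
    have h' := hu.eq_default ⟨_, HomOver.id F⟩
    exact RingHom.congr_fun (congrArg Sigma.fst (h.trans h'.symm)) c

end EquivariantFGL

namespace GlobalLazardRing

variable (𝓛 : GlobalLazardRing.{u}) {A B : El₂}

/-- The isomorphism from the value of the initial global group law. -/
def comparison (A : El₂) : Laz.{u} A ≃+* 𝓛.L.obj (op A) :=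
  RingEquiv.ofBijective _ (EquivariantFGL.classify_bijective (𝓛.universal A))

/-- The push-forward `G` of `F B` is reached from `F B` over the identity and from `F A` over the
restriction, so its classifying map computes both sides. -/
lemma comparison_rs (α : B →ₗ[ZMod 2] A) (z : Laz.{u} A) :
    𝓛.comparison B (lazard.X.rs α z) = 𝓛.L.rs α (𝓛.comparison A z) := by
  obtain ⟨G, ⟨c, -⟩, ⟨g⟩⟩ := 𝓛.res_classifies (FGModuleCat.ofHom α : B ⟶ A)
  have hG := g.isTwoTorsion (𝓛.universal A).1
  have h₁ := EquivariantFGL.classify_homOver (𝓛.universal B).1 hG c z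
  have h₂ := EquivariantFGL.classify_homOver (𝓛.universal A).1 hG g z
  rw [lazard.X.rs_id] at h₂
  exact h₁.symm.trans h₂

lemma comparison_euler (V : Character A) :
    𝓛.comparison A (lazard.euler V) = (𝓛.F A).euler V :=
  EquivariantFGL.classify_euler _ V

lemma comparison_e : 𝓛.comparison C₂ lazard.e = 𝓛.eσ := by
  rw [← lazard.euler_id, comparison_euler]
  rfl

lemma comparison_pullback (V : Character A) :
    𝓛.comparison A (lazard.euler V) = 𝓛.L.pullback 𝓛.eσ V := by
  rw [← comparison_e]
  exact 𝓛.comparison_rs (A := C₂) V _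

lemma euler_eq_pullback (V : Character A) : (𝓛.F A).euler V = 𝓛.L.pullback 𝓛.eσ V := by
  rw [← comparison_euler, comparison_pullback]

lemma isCoordinate : 𝓛.L.IsCoordinate 𝓛.eσ := by
  refine El₂Algebra.isCoordinate_of (fun A V b hb x hx => ?_) (fun A => ?_)
    (fun A V b hb x hx => ?_)
  · obtain ⟨z, rfl⟩ := (𝓛.comparison A).surjective x
    rw [← comparison_pullback, ← map_mul, map_eq_zero_iff _ (𝓛.comparison A).injective] at hx
    rw [lazard.euler_mul_cancel hb (y := 0) (hx.trans (mul_zero _).symm), map_zero]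
  · rw [← comparison_pullback, lazard.euler_zero, map_zero]
  · obtain ⟨z, rfl⟩ := (𝓛.comparison A).surjective x
    rw [← comparison_rs, map_eq_zero_iff _ (𝓛.comparison A).injective] at hx
    obtain ⟨g, rfl⟩ := lazard.exists_eq_euler_mul hb hx
    exact ⟨𝓛.comparison A g, by rw [map_mul, comparison_pullback]⟩

/-- The global group law underlying a global Lazard ring. -/
def toGlobalGroupLaw : GlobalGroupLaw.{u} := ⟨𝓛.L, 𝓛.eσ, 𝓛.isCoordinate⟩

/-- The isomorphism of functors from the initial global group law. -/
def comparisonIso : lazard.{u}.X ≅ 𝓛.L :=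
  NatIso.ofComponents (fun A => (𝓛.comparison A.unop).toCommRingCatIso) fun f =>
    CommRingCat.hom_ext <| RingHom.ext fun z => 𝓛.comparison_rs f.unop.hom.hom z

/-- Initiality transports along the comparison isomorphism, which matches the coordinates. -/
lemma toGlobalGroupLaw_isInitial : 𝓛.toGlobalGroupLaw.IsInitial := by
  intro Y
  obtain ⟨φ, hφ, huniq⟩ := initialLaw_isInitial.{u} Y
  have he : (𝓛.comparisonIso.inv.app (op C₂)).hom 𝓛.eσ = lazard.e := by
    rw [← comparison_e]
    exact (𝓛.comparison C₂).symm_apply_apply _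
  refine ⟨𝓛.comparisonIso.inv ≫ φ, (congrArg (φ.app (op C₂)).hom he).trans hφ, fun ψ hψ => ?_⟩
  refine (Iso.eq_inv_comp 𝓛.comparisonIso).2 ?_
  exact huniq _ ((congrArg (ψ.app (op C₂)).hom 𝓛.comparison_e).trans hψ)

end GlobalLazardRing

lemma GlobalGroupLaw.IsInitial.existsUnique_iso {X Y : GlobalGroupLaw.{u}} (hX : X.IsInitial)
    (hY : Y.IsInitial) : ∃! i : X.X ≅ Y.X, (i.hom.app (op C₂)).hom X.e = Y.e := by
  obtain ⟨φ, hφ, huniq⟩ := hX Y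
  obtain ⟨ψ, hψ, -⟩ := hY X
  refine ⟨⟨φ, ψ, (hX X).unique ?_ rfl, (hY Y).unique ?_ rfl⟩, hφ, fun i hi => Iso.ext (huniq _ hi)⟩
  · exact (congrArg (ψ.app (op C₂)).hom hφ).trans hψ
  · exact (congrArg (φ.app (op C₂)).hom hψ).trans hφ

end

theorem mainTheorem7 :
    (∃ X : GlobalGroupLaw.{u}, X.IsInitial) ∧
    Nonempty GlobalLazardRing.{u} ∧
    ∀ 𝓛 : GlobalLazardRing.{u},
      (∀ X : GlobalGroupLaw.{u}, X.IsInitial →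
        ∃! i : 𝓛.L ≅ X.X, (i.hom.app (op C₂)).hom 𝓛.eσ = X.e) ∧
      𝓛.L.IsCoordinate 𝓛.eσ ∧
      ∀ (A : El₂) (V : Character A), V ≠ 0 →
        (𝓛.F A).euler V ∈ nonZeroDivisors (𝓛.L.obj (op A)) := by
  refine ⟨⟨lazard, initialLaw_isInitial⟩, ⟨lazardRing⟩, fun 𝓛 =>
    ⟨fun X hX => 𝓛.toGlobalGroupLaw_isInitial.existsUnique_iso hX, 𝓛.isCoordinate,
      fun A V hV => ?_⟩⟩
  rw [𝓛.euler_eq_pullback, mem_nonZeroDivisors_iff_right]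
  intro x hx
  refine (𝓛.isCoordinate A V hV).1 ?_
  beta_reduce
  rw [mul_zero, mul_comm, hx]
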